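/- Let $N$ be a compact smooth surface without boundary, let $X$ be a smooth $3$-dimensional manifold with smooth Riemannian metrics $g$ and $g_0$, and let $E\subset X$ (an end of $X$). An adapted coordinate system on $E$ is a diffeomorphism $(r,x)$ of $E$ onto $[a,+\infty)\times N$, for some $a\in\mathbb R$, in which $$g=dr^2+G(r),\qquad g_0=dr^2+\mathring h(r)^2\,\hat G,$$ where $G(r)$ is a family of smooth Riemannian metrics on $N$, $\mathring h$ is a smooth positive function on $[a,+\infty)$ and $\hat G$ is a fixed smooth Riemannian metric on $N$. The radial mass of $g$ relative to $g_0$ in these coordinates is $$\mathcal M(r)=\int_N \mathring h(r)^2\,\bigl(\mathring H-H\bigr)(r,x)\,d\mu_{\hat G}(x),$$ where $H$ and $\mathring H$ are the mean curvatures of the level set $\{r\}\times N$ for $g$ and $g_0$, with respect to $\partial_r$ (that is, $H=\frac12\operatorname{tr}(G^{-1}\partial_rG)$, and similarly for $\mathring H$), and the mass at infinity is $\mathcal M(+\infty)=\lim_{r\to+\infty}\mathcal M(r)$. Suppose that $E$ has two adapted coordinate systems for the same pair $(g,g_0)$ and the same $N$, with data $(a,G,\mathring h,\hat G)$ and $(\widetilde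 a,\widetilde G,\widetilde{\mathring h},\widetilde{\hat G})$ and radial masses $\mathcal M$ and $\widetilde{\mathcal M}$. Let $v=\ln(h_0/h)$ with $h_0=\sqrt{\det g_0}$ and $h=\sqrt{\det g}$ (the quotient does not depend on the coordinates), and let $\Delta_0$ be the Laplacian of $g_0$. If $\Delta_0 v\in L^1(E,g_0)$, then both masses at infinity exist (as finite limits) and $$\mathcal M(+\infty)=\widetilde{\mathcal M}(+\infty).$$ -/

import Mathlib

open Set Filter Topology MeasureTheory
open scoped Manifold ContDiff

noncomputable section

/-- Smooth Riemannian metrics on a `d`-dimensional manifold `M`. -/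
abbrev RiemMetric {d : ℕ} {H : Type*} [TopologicalSpace H]
    (I : ModelWithCorners ℝ (EuclideanSpace ℝ (Fin d)) H) (M : Type*) [TopologicalSpace M]
    [ChartedSpace H M] [IsManifold I ∞ M] :=
  Bundle.ContMDiffRiemannianMetric I ∞ (EuclideanSpace ℝ (Fin d))
    (fun p : M => TangentSpace I p)

/-- The `i`-th vector of the standard basis of `ℝ ^ d`. -/
abbrev stdVec {d : ℕ} (i : Fin d) : EuclideanSpace ℝ (Fin d) := EuclideanSpace.single i 1

section Riemannian

variable {d : ℕ} {H : Type*} [TopologicalSpace H]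
  {I : ModelWithCorners ℝ (EuclideanSpace ℝ (Fin d)) H} {M : Type*} [TopologicalSpace M]
  [ChartedSpace H M] [IsManifold I ∞ M]

/-- The Gram matrix of `g` at `p`, in the basis of `T_p M` that comes from the identification of
`T_p M` with the model space `ℝ ^ d` (the coordinate basis of the preferred chart at `p`). -/
def gramAt (g : RiemMetric I M) (p : M) : Matrix (Fin d) (Fin d) ℝ :=
  Matrix.of fun i j =>
    g.inner p (stdVec i : EuclideanSpace ℝ (Fin d)) (stdVec j : EuclideanSpace ℝ (Fin d))

/-- The coordinate vector field `∂_i` of the preferred chart at `c`, at the point with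
coordinates `y`. -/
def coordVec (I : ModelWithCorners ℝ (EuclideanSpace ℝ (Fin d)) H) (c : M) (i : Fin d)
    (y : EuclideanSpace ℝ (Fin d)) : TangentSpace I ((extChartAt I c).symm y) :=
  mfderivWithin 𝓘(ℝ, EuclideanSpace ℝ (Fin d)) I (extChartAt I c).symm (range I) y (stdVec i)

/-- The matrix `g_ij` of `g` in the preferred chart at `c`, at the point with coordinates `y`. -/
def metricInChart (g : RiemMetric I M) (c : M) (y : EuclideanSpace ℝ (Fin d)) :
    Matrix (Fin d) (Fin d) ℝ :=
  Matrix.of fun i j =>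
    g.inner ((extChartAt I c).symm y) (coordVec I c i y) (coordVec I c j y)

/-- The volume density `√(det g_ij)` in the chart at `c`. -/
def densityInChart (g : RiemMetric I M) (c : M) (y : EuclideanSpace ℝ (Fin d)) : ℝ :=
  Real.sqrt (metricInChart g c y).det

/-- The partial derivative `∂_i f` on the range of the model with corners
(the usual one at interior points). -/
def partialDeriv (I : ModelWithCorners ℝ (EuclideanSpace ℝ (Fin d)) H) (i : Fin d)
    (f : EuclideanSpace ℝ (Fin d) → ℝ) (y : EuclideanSpace ℝ (Fin d)) : ℝ :=
  fderivWithin ℝ f (range I) y (stdVec i)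

/-- The Laplacian of `g`, `Δ f = - (det g)^(-1/2) ∂_i ((det g)^(1/2) g^ij ∂_j f)`,
computed at `p` in the chart at `p`; the sign convention makes it a nonnegative operator. -/
def laplacian (g : RiemMetric I M) (f : M → ℝ) (p : M) : ℝ :=
  -((densityInChart g p (extChartAt I p p))⁻¹ *
    ∑ i, partialDeriv I i
      (fun y => densityInChart g p y *
        ∑ j, (metricInChart g p y)⁻¹ i j *
          partialDeriv I j (fun z => f ((extChartAt I p).symm z)) y)
      (extChartAt I p p))

/-- The Riemannian volume of the domain of the chart at `c`: the measure `√(det g_ij) dy` on the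
target of the chart, transported to `M`. It gives no mass to the complement of the domain. -/
def chartVolume [MeasurableSpace M] (g : RiemMetric I M) (c : M) : Measure M :=
  ((volume.restrict (extChartAt I c).target).withDensity
    (fun y => ENNReal.ofReal (densityInChart g c y))).map (extChartAt I c).symm

/-- The Riemannian volume measure of `g`. Each `chartVolume g c` is the restriction of the
Riemannian volume to the domain of a chart, so on a second countable manifold their least upper
bound (in the complete lattice of measures) is the Riemannian volume. -/
def riemVolume [MeasurableSpace M] (g : RiemMetric I M) : Measure M :=
  ⨆ c : M, chartVolume g c

/-- The function `ln (√(det g₀) / √(det g))`. Both determinants are taken in the same basis of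
the tangent space, and the quotient does not depend on it. -/
def logVolumeRatio (g₀ g : RiemMetric I M) (p : M) : ℝ :=
  Real.log (Real.sqrt (gramAt g₀ p).det / Real.sqrt (gramAt g p).det)

end Riemannian

section Radial

variable {d : ℕ} {N : Type*} [TopologicalSpace N]
  [ChartedSpace (EuclideanSpace ℝ (Fin d)) N] [IsManifold (𝓡 d) ∞ N]

/-- The matrix at `x` of a family of bilinear forms on the tangent spaces of `N`. -/
def formMatrix (B : ∀ x : N, TangentSpace (𝓡 d) x →L[ℝ] TangentSpace (𝓡 d) x →L[ℝ] ℝ) (x : N) :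
    Matrix (Fin d) (Fin d) ℝ :=
  Matrix.of fun i j =>
    B x (stdVec i : EuclideanSpace ℝ (Fin d)) (stdVec j : EuclideanSpace ℝ (Fin d))

/-- The second fundamental form of the slice `{r} × N` in `[a, ∞) × N`, with respect to the normal
`∂_r`, for a metric `dr² + B(r)`: it is `½ ∂_r B`, here as a matrix at `x`. -/
def secondForm (a : ℝ)
    (B : ℝ → ∀ x : N, TangentSpace (𝓡 d) x →L[ℝ] TangentSpace (𝓡 d) x →L[ℝ] ℝ)
    (r : ℝ) (x : N) : Matrix (Fin d) (Fin d) ℝ :=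
  Matrix.of fun i j => (1 / 2) * derivWithin (fun s => formMatrix (B s) x i j) (Ici a) r

/-- The Weingarten map of the slice `{r} × N` for `dr² + B(r)`: the second fundamental form with
an index raised by `B(r)`. -/
def weingarten (a : ℝ)
    (B : ℝ → ∀ x : N, TangentSpace (𝓡 d) x →L[ℝ] TangentSpace (𝓡 d) x →L[ℝ] ℝ)
    (r : ℝ) (x : N) : Matrix (Fin d) (Fin d) ℝ :=
  (formMatrix (B r) x)⁻¹ * secondForm a B r x

/-- The mean curvature (trace of the Weingarten map) of the slice `{r} × N` for `dr² + B(r)`. -/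
def meanCurv (a : ℝ)
    (B : ℝ → ∀ x : N, TangentSpace (𝓡 d) x →L[ℝ] TangentSpace (𝓡 d) x →L[ℝ] ℝ)
    (r : ℝ) (x : N) : ℝ :=
  (weingarten a B r x).trace

end Radial

/-- A coordinate system `(r, x)` on the subset `E` of the manifold `X`, making it diffeomorphic to
`[a, ∞) × N`, in which `g = dr² + G(r)` and `g₀ = dr² + (h r)² Ghat`. -/
structure WarpedCoordinates {d : ℕ} {H : Type*} [TopologicalSpace H]
    {I : ModelWithCorners ℝ (EuclideanSpace ℝ (Fin (d + 1))) H} {X : Type*} [TopologicalSpace X]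
    [ChartedSpace H X] [IsManifold I ∞ X] (g g₀ : RiemMetric I X) (E : Set X)
    (N : Type*) [TopologicalSpace N] [ChartedSpace (EuclideanSpace ℝ (Fin d)) N]
    [IsManifold (𝓡 d) ∞ N] where
  /-- The initial value of the radial coordinate. -/
  a : ℝ
  /-- The parametrization of `E` by `[a, ∞) × N` (only its values there matter). -/
  param : ℝ × N → X
  /-- The coordinates `(r, x)` on `E` (only the values on `E` matter). -/
  coord : X → ℝ × N
  param_mem : ∀ q ∈ Ici a ×ˢ (univ : Set N), param q ∈ E
  coord_mem : ∀ p ∈ E, coord p ∈ Ici a ×ˢ (univ : Set N)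
  coord_param : ∀ q ∈ Ici a ×ˢ (univ : Set N), coord (param q) = q
  param_coord : ∀ p ∈ E, param (coord p) = p
  smooth_param :
    ContMDiffOn (𝓘(ℝ, ℝ).prod (𝓡 d)) I ∞ param (Ici a ×ˢ (univ : Set N))
  smooth_coord : ContMDiffOn I (𝓘(ℝ, ℝ).prod (𝓡 d)) ∞ coord E
  /-- The family of metrics `G(r)` on `N` (only `r ≥ a` matters). -/
  G : ℝ → RiemMetric (𝓡 d) N
  /-- The warping function. -/
  h : ℝ → ℝ
  /-- The fixed metric on `N`. -/
  Ghat : RiemMetric (𝓡 d) N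
  smooth_h : ContDiffOn ℝ ∞ h (Ici a)
  h_pos : ∀ r ∈ Ici a, 0 < h r
  metric_eq : ∀ r ∈ Ici a, ∀ (x : N) (s t : ℝ) (u w : EuclideanSpace ℝ (Fin d)),
    g.inner (param (r, x))
      (mfderivWithin (𝓘(ℝ, ℝ).prod (𝓡 d)) I param (Ici a ×ˢ (univ : Set N)) (r, x) (s, u))
      (mfderivWithin (𝓘(ℝ, ℝ).prod (𝓡 d)) I param (Ici a ×ˢ (univ : Set N)) (r, x) (t, w))
      = s * t + (G r).inner x u w
  background_eq : ∀ r ∈ Ici a, ∀ (x : N) (s t : ℝ) (u w : EuclideanSpace ℝ (Fin d)),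
    g₀.inner (param (r, x))
      (mfderivWithin (𝓘(ℝ, ℝ).prod (𝓡 d)) I param (Ici a ×ˢ (univ : Set N)) (r, x) (s, u))
      (mfderivWithin (𝓘(ℝ, ℝ).prod (𝓡 d)) I param (Ici a ×ˢ (univ : Set N)) (r, x) (t, w))
      = s * t + h r ^ 2 * Ghat.inner x u w

namespace WarpedCoordinates

variable {d : ℕ} {H : Type*} [TopologicalSpace H]
  {I : ModelWithCorners ℝ (EuclideanSpace ℝ (Fin (d + 1))) H} {X : Type*} [TopologicalSpace X]
  [ChartedSpace H X] [IsManifold I ∞ X] {g g₀ : RiemMetric I X} {E : Set X}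
  {N : Type*} [TopologicalSpace N] [ChartedSpace (EuclideanSpace ℝ (Fin d)) N]
  [IsManifold (𝓡 d) ∞ N]

/-- The radial mass `m(r, x) = h² (H₀ - H)` of `g` relative to `g₀`, where `H` and `H₀` are the
mean curvatures of the level set of `r` for `g` and for `g₀`. -/
def radialMass (C : WarpedCoordinates g g₀ E N) (r : ℝ) (x : N) : ℝ :=
  C.h r ^ 2 *
    (meanCurv C.a (fun s y => C.h s ^ 2 • C.Ghat.inner y) r x
      - meanCurv C.a (fun s y => (C.G s).inner y) r x)

/-- The radial mass of `g` relative to `g₀` on the level set `N(r)`: the integral of `m(r, ·)`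
over `N` for the Riemannian volume of the fixed metric. -/
def mass [MeasurableSpace N] (C : WarpedCoordinates g g₀ E N) (r : ℝ) : ℝ :=
  ∫ x, C.radialMass r x ∂(riemVolume C.Ghat)

/-- The mass at infinity exists and is equal to `μ`. -/
def HasMassAtInfinity [MeasurableSpace N] (C : WarpedCoordinates g g₀ E N) (μ : ℝ) : Prop :=
  Tendsto C.mass atTop (𝓝 μ)

end WarpedCoordinates

end

/-! Write v for `logVolumeRatio g₀ g`. In warped coordinates the mean curvature of a slice is the
radial derivative of the logarithm of its volume density, so H₀ - H = ∂_r v and the mass density is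
the flux h² ∂_r v (`radialMass_eq`, `mass_eq`). The slices are two-dimensional, so the background
volume is h² dr dμ and the slice term of h² Δ₀ carries no power of h: h² Δ₀ v = -∂_r(h² ∂_r v) + Δ
v, the last Laplacian being that of `Ghat` on the slice (`coordLaplacian_warp`, `laplacian_param`).
It integrates to zero over the closed surface (`integral_laplacian_eq_zero`), hence M(R) - M(b) is
minus the integral of h² Δ₀ v over the slab b < r < R (`mass_sub_mass`). As h² dr dμ is the
Riemannian volume of g₀ on r > a (`riemVolume_restrict_param`), integrability of Δ₀ v makes M(R)
converge (`exists_hasMassAtInfinity`).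

For independence, the radial functions of the two systems are compared. A transition map sends the
boundary slice to the boundary slice, since an interior minimum of the radial coordinate would be a
critical point. Each radial coordinate changes at rate at most 1 along the radial lines of the
other, because ∂_r has g₀-length 1; using both transitions, the two differ by the constant a' - a
(`transition_fst`). Equality in the length estimate then forces the radial vector fields to coincide
(`dparam_radial_eq`), so ∂_r v is a single function on the interior of the end.

The integral of that function over a slab b < r < c, for the volume of g₀, is the integral of M over
(b, c) in either system, up to the shift (`setIntegral_mass_eq`). Comparing slab integrals avoids
identifying the area measures of individual slices; averages over unit intervals have the same
limits as M, whence the equality.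

The rest is local geometry: `sum_fderiv_piola` makes the coordinate Laplacian independent of
coordinates, and `riemVolume_restrict_eq` identifies a supremum of chart volumes with a given
measure. -/

noncomputable section

/-! ### Derivative of a determinant and the Piola identity. -/

section Euclidean

/-- The derivative of a determinant along a curve of matrices. -/
theorem hasDerivAt_det {n : Type*} [Fintype n] [DecidableEq n] {A : ℝ → Matrix n n ℝ}
    {A' : Matrix n n ℝ} {t : ℝ} (h : ∀ i j, HasDerivAt (fun s => A s i j) (A' i j) t) :
    HasDerivAt (fun s => (A s).det) ((A t).adjugate * A').trace t := by
  have h1 : HasDerivAt (fun s => ∑ σ : Equiv.Perm n, ((Equiv.Perm.sign σ : ℤ) : ℝ) *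
      ∏ i, A s (σ i) i)
      (∑ σ : Equiv.Perm n, ((Equiv.Perm.sign σ : ℤ) : ℝ) *
        ∑ i, (∏ j ∈ Finset.univ.erase i, A t (σ j) j) • A' (σ i) i) t :=
    HasDerivAt.fun_sum fun σ _ =>
      (HasDerivAt.fun_finsetProd fun i _ => h (σ i) i).const_mul _
  have h2 : ((A t).adjugate * A').trace = ∑ σ : Equiv.Perm n, ((Equiv.Perm.sign σ : ℤ) : ℝ) *
        ∑ i, (∏ j ∈ Finset.univ.erase i, A t (σ j) j) • A' (σ i) i := by
    -- Cramer's rule: each diagonal entry of the product is the determinant with one column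
    -- differentiated.
    have h3 : ∀ i, ((A t).adjugate * A') i i = ((A t).updateCol i (fun k => A' k i)).det := by
      intro i
      rw [← Matrix.cramer_apply, Matrix.cramer_eq_adjugate_mulVec]
      rfl
    simp only [Matrix.trace, Matrix.diag_apply, h3, Matrix.det_apply', Finset.mul_sum]
    rw [Finset.sum_comm]
    refine Finset.sum_congr rfl fun σ _ => Finset.sum_congr rfl fun i _ => ?_
    congr 1
    rw [← Finset.prod_erase_mul _ _ (Finset.mem_univ i), Matrix.updateCol_self, smul_eq_mul]
    congr 1
    refine Finset.prod_congr rfl fun j hj => ?_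
    rw [Matrix.updateCol_ne (Finset.ne_of_mem_erase hj)]
  rw [h2]
  simpa only [Matrix.det_apply'] using h1

variable {n : ℕ}

/-- The Jacobian matrix of `T` at `x`. -/
def jacobian (T : EuclideanSpace ℝ (Fin n) → EuclideanSpace ℝ (Fin n))
    (x : EuclideanSpace ℝ (Fin n)) : Matrix (Fin n) (Fin n) ℝ :=
  Matrix.of fun a i => fderiv ℝ T x (stdVec i) a

theorem euclidean_sum_stdVec (w : EuclideanSpace ℝ (Fin n)) : w = ∑ i, w i • stdVec i := by
  ext j
  simp [Finset.sum_apply, Pi.single_apply]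

theorem clm_apply_eq_sum_stdVec {F : Type*} [AddCommGroup F] [Module ℝ F] [TopologicalSpace F]
    (L : EuclideanSpace ℝ (Fin n) →L[ℝ] F) (w : EuclideanSpace ℝ (Fin n)) :
    L w = ∑ i, w i • L (stdVec i) := by
  conv_lhs => rw [euclidean_sum_stdVec w]
  simp

/-- The Piola identity: the divergence of the Piola transform of a vector field. -/
theorem sum_fderiv_piola {T : EuclideanSpace ℝ (Fin n) → EuclideanSpace ℝ (Fin n)}
    {q : EuclideanSpace ℝ (Fin n)} (hT : ContDiffAt ℝ 2 T q)
    {V W : Fin n → EuclideanSpace ℝ (Fin n) → ℝ}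
    (hV : ∀ i, DifferentiableAt ℝ (V i) q) (hW : ∀ a, DifferentiableAt ℝ (W a) (T q))
    (hdet : (jacobian T q).det ≠ 0)
    (h : ∀ᶠ x in 𝓝 q, ∀ a, ∑ i, jacobian T x a i * V i x = (jacobian T x).det * W a (T x)) :
    ∑ i, fderiv ℝ (V i) q (stdVec i)
      = (jacobian T q).det * ∑ a, fderiv ℝ (W a) (T q) (stdVec a) := by
  have hTd : DifferentiableAt ℝ T q := hT.differentiableAt (by norm_num)
  have hT' : DifferentiableAt ℝ (fderiv ℝ T) q :=
    (hT.fderiv_right (m := 1) (by norm_num)).differentiableAt (by norm_num)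
  have hsym := hT.isSymmSndFDerivAt (by simp)
  set J := jacobian T q with hJ
  set d := J.det with hd
  set K := J.adjugate with hK
  -- `Hm k` is the derivative of the Jacobian matrix in direction `k`; `Hsym` is the symmetry of
  -- second derivatives, exchanging the direction with the column.
  let Hm : Fin n → Matrix (Fin n) (Fin n) ℝ := fun k =>
    Matrix.of fun a i => fderiv ℝ (fderiv ℝ T) q (stdVec k) (stdVec i) a
  have Hsym : ∀ k a i, Hm k a i = Hm i a k := fun k a i => by
    simp only [Hm, Matrix.of_apply]
    rw [hsym.eq]
  have hentry : ∀ k a i, HasDerivAt (fun t : ℝ => jacobian T (q + t • stdVec k) a i)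
      (Hm k a i) 0 := by
    intro k a i
    have h1 : HasDerivAt (fun t : ℝ => fderiv ℝ T (q + t • stdVec k))
        (fderiv ℝ (fderiv ℝ T) q (stdVec k)) 0 := (hT'.hasFDerivAt.hasLineDerivAt (stdVec k))
    have h2 := h1.clm_apply (hasDerivAt_const (0 : ℝ) (stdVec i : EuclideanSpace ℝ (Fin n)))
    have h3 := ((EuclideanSpace.proj a : EuclideanSpace ℝ (Fin n) →L[ℝ] ℝ).hasFDerivAt
      (x := fderiv ℝ T (q + (0 : ℝ) • stdVec k) (stdVec i))).comp_hasDerivAt (0 : ℝ) h2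
    simpa [jacobian, Function.comp_def, Hm] using h3
  have hq0 : ∀ k : Fin n, q + (0 : ℝ) • stdVec k = q := fun k => by simp
  -- The relation J V = (det J) W∘T differentiated in direction `k`. It is then contracted with the
  -- adjugate `K k a` and summed over `k` and `a`.
  have key : ∀ k a, ∑ i, (Hm k a i * V i q + J a i * fderiv ℝ (V i) q (stdVec k))
      = (K * Hm k).trace * W a (T q)
        + d * ∑ b, J b k * fderiv ℝ (W a) (T q) (stdVec b) := by
    intro k a
    have hc : Tendsto (fun t : ℝ => q + t • stdVec k) (𝓝 0) (𝓝 q) := by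
      have : ContinuousAt (fun t : ℝ => q + t • stdVec k) 0 := by fun_prop
      simpa [ContinuousAt] using this
    have e1 : (fun t : ℝ => ∑ i, jacobian T (q + t • stdVec k) a i * V i (q + t • stdVec k))
        =ᶠ[𝓝 0] fun t => (jacobian T (q + t • stdVec k)).det * W a (T (q + t • stdVec k)) := by
      filter_upwards [hc.eventually h] with t ht using ht a
    have hVd : ∀ i, HasDerivAt (fun t : ℝ => V i (q + t • stdVec k))
        (fderiv ℝ (V i) q (stdVec k)) 0 := fun i => (hV i).hasFDerivAt.hasLineDerivAt (stdVec k)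
    have hWT : HasDerivAt (fun t : ℝ => W a (T (q + t • stdVec k)))
        (∑ b, J b k * fderiv ℝ (W a) (T q) (stdVec b)) 0 := by
      have := ((hW a).hasFDerivAt.comp q hTd.hasFDerivAt).hasLineDerivAt (stdVec k)
      have h5 : ((fderiv ℝ (W a) (T q)).comp (fderiv ℝ T q)) (stdVec k)
          = ∑ b, J b k * fderiv ℝ (W a) (T q) (stdVec b) := by
        rw [ContinuousLinearMap.comp_apply, clm_apply_eq_sum_stdVec]
        simp [hJ, jacobian]
      rw [h5] at this
      exact this
    have hL : HasDerivAt
        (fun t : ℝ => ∑ i, jacobian T (q + t • stdVec k) a i * V i (q + t • stdVec k))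
        (∑ i, (Hm k a i * V i q + J a i * fderiv ℝ (V i) q (stdVec k))) 0 := by
      have := HasDerivAt.fun_sum (u := Finset.univ) fun i _ => (hentry k a i).mul (hVd i)
      simpa [hJ] using this
    have hR := (hasDerivAt_det (fun a i => hentry k a i)).mul hWT
    have := hL.unique (hR.congr_of_eventuallyEq e1)
    simpa [hJ, hd, hK] using this
  have hKJ : K * J = d • (1 : Matrix (Fin n) (Fin n) ℝ) := Matrix.adjugate_mul J
  have hJK : J * K = d • (1 : Matrix (Fin n) (Fin n) ℝ) := Matrix.mul_adjugate J
  have hKJ' : ∀ k i, ∑ a, K k a * J a i = if k = i then d else 0 := fun k i => by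
    have := congrFun (congrFun hKJ k) i
    simpa [Matrix.mul_apply, Matrix.one_apply] using this
  have hJK' : ∀ k i, ∑ a, J k a * K a i = if k = i then d else 0 := fun k i => by
    have := congrFun (congrFun hJK k) i
    simpa [Matrix.mul_apply, Matrix.one_apply] using this
  have hVK : ∀ k, V k q = ∑ a, K k a * W a (T q) := by
    intro k
    have h0 : ∀ a, ∑ i, J a i * V i q = d * W a (T q) := h.self_of_nhds
    apply mul_left_cancel₀ hdet
    calc d * V k q = ∑ i, (∑ a, K k a * J a i) * V i q := by simp [hKJ']
      _ = ∑ a, K k a * ∑ i, J a i * V i q := by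
        simp only [Finset.sum_mul, Finset.mul_sum]
        rw [Finset.sum_comm]
        simp only [mul_assoc]
      _ = d * ∑ a, K k a * W a (T q) := by
        simp only [h0, Finset.mul_sum]
        refine Finset.sum_congr rfl fun a _ => by ring
  -- Since K J = d, the derivatives of `V` collapse to d times the divergence of `V`; in `sum2`, J K
  -- = d does the same for `W`.
  have sum1 : ∑ k, ∑ a, K k a * ∑ i, (Hm k a i * V i q + J a i * fderiv ℝ (V i) q (stdVec k))
      = ∑ k, ∑ a, ∑ i, K k a * Hm k a i * V i q + d * ∑ i, fderiv ℝ (V i) q (stdVec i) := by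
    have : ∀ k, ∑ a, K k a * ∑ i, J a i * fderiv ℝ (V i) q (stdVec k)
        = d * fderiv ℝ (V k) q (stdVec k) := fun k => by
      calc _ = ∑ i, (∑ a, K k a * J a i) * fderiv ℝ (V i) q (stdVec k) := by
            simp only [Finset.sum_mul, Finset.mul_sum]
            rw [Finset.sum_comm]
            simp only [mul_assoc]
        _ = _ := by simp [hKJ']
    rw [Finset.mul_sum, ← Finset.sum_congr rfl fun k _ => this k, ← Finset.sum_add_distrib]
    refine Finset.sum_congr rfl fun k _ => ?_
    rw [← Finset.sum_add_distrib]
    refine Finset.sum_congr rfl fun a _ => ?_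
    rw [Finset.sum_add_distrib, mul_add, Finset.mul_sum]
    simp only [mul_assoc]
  have sum2 : ∑ k, ∑ a, K k a * ((K * Hm k).trace * W a (T q)
        + d * ∑ b, J b k * fderiv ℝ (W a) (T q) (stdVec b))
      = ∑ k, (K * Hm k).trace * V k q + d * (d * ∑ a, fderiv ℝ (W a) (T q) (stdVec a)) := by
    have : ∑ k, ∑ a, K k a * ∑ b, J b k * fderiv ℝ (W a) (T q) (stdVec b)
        = d * ∑ a, fderiv ℝ (W a) (T q) (stdVec a) := by
      rw [Finset.sum_comm, Finset.mul_sum]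
      refine Finset.sum_congr rfl fun a _ => ?_
      calc _ = ∑ b, (∑ k, J b k * K k a) * fderiv ℝ (W a) (T q) (stdVec b) := by
            simp only [Finset.sum_mul, Finset.mul_sum]
            rw [Finset.sum_comm]
            refine Finset.sum_congr rfl fun b _ => Finset.sum_congr rfl fun k _ => by ring
        _ = _ := by simp [hJK']
    rw [← this, Finset.mul_sum, ← Finset.sum_add_distrib]
    refine Finset.sum_congr rfl fun k _ => ?_
    rw [hVK k, Finset.mul_sum, Finset.mul_sum, ← Finset.sum_add_distrib]
    refine Finset.sum_congr rfl fun a _ => by ring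
  -- The second derivatives of `T` on the two sides agree after exchanging `k` and `i`, so they
  -- cancel.
  have sum3 : ∑ k, ∑ a, ∑ i, K k a * Hm k a i * V i q = ∑ k, (K * Hm k).trace * V k q := by
    simp only [Matrix.trace, Matrix.diag_apply, Matrix.mul_apply, Finset.sum_mul]
    have : ∀ k, ∑ a, ∑ i, K k a * Hm k a i * V i q = ∑ i, ∑ a, K k a * Hm k a i * V i q :=
      fun k => Finset.sum_comm
    simp only [this]
    rw [Finset.sum_comm]
    refine Finset.sum_congr rfl fun k _ => Finset.sum_congr rfl fun i _ =>
      Finset.sum_congr rfl fun a _ => by rw [Hsym]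
  have := sum1.symm.trans ((Finset.sum_congr rfl fun k _ => Finset.sum_congr rfl fun a _ => by
    rw [key k a]).trans sum2)
  rw [sum3] at this
  exact mul_left_cancel₀ hdet (add_left_cancel this)

end Euclidean

/-! ### Invariance of the coordinate Laplacian. -/

section Euclidean

theorem contDiffAt_det {ι E : Type*} [Fintype ι] [DecidableEq ι] [NormedAddCommGroup E]
    [NormedSpace ℝ E] {A : E → Matrix ι ι ℝ} {q : E}
    {k : WithTop ℕ∞} (h : ∀ i j, ContDiffAt ℝ k (fun x => A x i j) q) :
    ContDiffAt ℝ k (fun x => (A x).det) q := by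
  simp only [Matrix.det_apply']
  exact ContDiffAt.sum fun σ _ => contDiffAt_const.mul (contDiffAt_prod fun i _ => h _ _)

/-- The inverse is the adjugate over the determinant, and entries of the adjugate are determinants
of the matrix with one row replaced by a constant row. -/
theorem contDiffAt_matrix_inv {ι E : Type*} [Fintype ι] [DecidableEq ι] [NormedAddCommGroup E]
    [NormedSpace ℝ E] {A : E → Matrix ι ι ℝ} {q : E}
    {k : WithTop ℕ∞} (h : ∀ i j, ContDiffAt ℝ k (fun x => A x i j) q) (hq : (A q).det ≠ 0)
    (i j : ι) : ContDiffAt ℝ k (fun x => (A x)⁻¹ i j) q := by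
  simp only [Matrix.inv_def, Ring.inverse_eq_inv', Matrix.smul_apply, smul_eq_mul,
    Matrix.adjugate_apply]
  refine ((contDiffAt_det h).inv hq).mul (contDiffAt_det fun a b => ?_)
  by_cases hb : a = j
  · subst hb
    simpa using contDiffAt_const
  · simpa [Matrix.updateRow_ne hb] using h a b

variable {n : ℕ}

/-- The vector density `√(det A) A⁻¹ ∇f`. -/
def gradientFlux (A : EuclideanSpace ℝ (Fin n) → Matrix (Fin n) (Fin n) ℝ)
    (f : EuclideanSpace ℝ (Fin n) → ℝ) (i : Fin n) (y : EuclideanSpace ℝ (Fin n)) : ℝ :=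
  √(A y).det * ∑ j, (A y)⁻¹ i j * fderiv ℝ f y (stdVec j)

/-- The Laplacian, in coordinates, of the metric with matrix `A`. -/
def coordLaplacian (A : EuclideanSpace ℝ (Fin n) → Matrix (Fin n) (Fin n) ℝ)
    (f : EuclideanSpace ℝ (Fin n) → ℝ) (q : EuclideanSpace ℝ (Fin n)) : ℝ :=
  -((√(A q).det)⁻¹ * ∑ i, fderiv ℝ (gradientFlux A f i) q (stdVec i))

theorem contDiffAt_gradientFlux {A : EuclideanSpace ℝ (Fin n) → Matrix (Fin n) (Fin n) ℝ}
    {f : EuclideanSpace ℝ (Fin n) → ℝ} {q : EuclideanSpace ℝ (Fin n)}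
    (hA : ∀ i j, ContDiffAt ℝ ∞ (fun x => A x i j) q) (hf : ContDiffAt ℝ ∞ f q)
    (hq : 0 < (A q).det) (i : Fin n) : ContDiffAt ℝ ∞ (gradientFlux A f i) q :=
  ((contDiffAt_det hA).sqrt hq.ne').mul <| ContDiffAt.sum fun j _ =>
    (contDiffAt_matrix_inv hA hq.ne' i j).mul
      ((hf.fderiv_right (m := ∞) (by simp)).clm_apply
        (contDiffAt_const (c := (stdVec j : EuclideanSpace ℝ (Fin n)))))

theorem Filter.EventuallyEq.gradientFlux
    {A B : EuclideanSpace ℝ (Fin n) → Matrix (Fin n) (Fin n) ℝ}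
    {f g : EuclideanSpace ℝ (Fin n) → ℝ} {q : EuclideanSpace ℝ (Fin n)}
    (hA : A =ᶠ[𝓝 q] B) (hf : f =ᶠ[𝓝 q] g) (i : Fin n) :
    gradientFlux A f i =ᶠ[𝓝 q] gradientFlux B g i := by
  filter_upwards [hA, hf.fderiv (𝕜 := ℝ)] with x hx hx'
  rw [_root_.gradientFlux, _root_.gradientFlux, hx, hx']

theorem Filter.EventuallyEq.coordLaplacian_eq
    {A B : EuclideanSpace ℝ (Fin n) → Matrix (Fin n) (Fin n) ℝ}
    {f g : EuclideanSpace ℝ (Fin n) → ℝ} {q : EuclideanSpace ℝ (Fin n)}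
    (hA : A =ᶠ[𝓝 q] B) (hf : f =ᶠ[𝓝 q] g) : coordLaplacian A f q = coordLaplacian B g q := by
  simp only [coordLaplacian, (hA.gradientFlux hf _).fderiv_eq, hA.self_of_nhds]

theorem contDiffAt_jacobian {T : EuclideanSpace ℝ (Fin n) → EuclideanSpace ℝ (Fin n)}
    {q : EuclideanSpace ℝ (Fin n)} (hT : ContDiffAt ℝ ∞ T q) (a i : Fin n) :
    ContDiffAt ℝ ∞ (fun x => jacobian T x a i) q :=
  (EuclideanSpace.proj a : EuclideanSpace ℝ (Fin n) →L[ℝ] ℝ).contDiff.contDiffAt.comp q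
    ((hT.fderiv_right (m := ∞) (by simp)).clm_apply contDiffAt_const)

theorem sqrt_det_conj (J A : Matrix (Fin n) (Fin n) ℝ) :
    √(J.transpose * A * J).det = |J.det| * √A.det := by
  rw [Matrix.det_mul, Matrix.det_mul, Matrix.det_transpose,
    show J.det * A.det * J.det = J.det ^ 2 * A.det by ring, Real.sqrt_mul (sq_nonneg _),
    Real.sqrt_sq_eq_abs]

/-- The Laplacian in coordinates is invariant under changes of coordinates. -/
theorem coordLaplacian_comp {T : EuclideanSpace ℝ (Fin n) → EuclideanSpace ℝ (Fin n)}
    {A : EuclideanSpace ℝ (Fin n) → Matrix (Fin n) (Fin n) ℝ}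
    {f : EuclideanSpace ℝ (Fin n) → ℝ} {q : EuclideanSpace ℝ (Fin n)}
    (hT : ContDiffAt ℝ ∞ T q) (hdet : (jacobian T q).det ≠ 0)
    (hA : ∀ i j, ContDiffAt ℝ ∞ (fun x => A x i j) (T q)) (hf : ContDiffAt ℝ ∞ f (T q))
    (hq : 0 < (A (T q)).det) :
    coordLaplacian (fun x => (jacobian T x).transpose * A (T x) * jacobian T x) (f ∘ T) q
      = coordLaplacian A f (T q) := by
  have hB : ∀ i j, ContDiffAt ℝ ∞
      (fun x => ((jacobian T x).transpose * A (T x) * jacobian T x) i j) q := by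
    intro i j
    simp only [Matrix.mul_apply, Matrix.transpose_apply]
    exact ContDiffAt.sum fun b _ => (ContDiffAt.sum fun a _ =>
      (contDiffAt_jacobian hT a i).mul ((hA a b).comp q hT)).mul (contDiffAt_jacobian hT b j)
  have hBq : 0 < ((jacobian T q).transpose * A (T q) * jacobian T q).det := by
    rw [Matrix.det_mul, Matrix.det_mul, Matrix.det_transpose,
      show (jacobian T q).det * (A (T q)).det * (jacobian T q).det
        = (jacobian T q).det ^ 2 * (A (T q)).det by ring]
    positivity
  -- The volume density changes by |det J| whereas the Piola identity involves det J. The sign `ε`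
  -- is locally constant, so it can be absorbed into the target vector field.
  obtain ⟨ε, hε, hsign⟩ : ∃ ε : ℝ, ε * ε = 1 ∧
      ∀ᶠ x in 𝓝 q, |(jacobian T x).det| = ε * (jacobian T x).det := by
    have hc : ContinuousAt (fun x => (jacobian T x).det) q :=
      (contDiffAt_det (contDiffAt_jacobian hT)).continuousAt
    rcases lt_or_gt_of_ne hdet with h | h
    · refine ⟨-1, by norm_num, ?_⟩
      filter_upwards [hc.eventually_lt_const h] with x hx
      rw [abs_of_neg hx]; ring
    · refine ⟨1, by norm_num, ?_⟩
      filter_upwards [hc.eventually_const_lt h] with x hx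
      rw [abs_of_pos hx]; ring
  have hne : ∀ᶠ x in 𝓝 q, (jacobian T x).det ≠ 0 :=
    (contDiffAt_det (contDiffAt_jacobian hT)).continuousAt.eventually_ne hdet
  have hTd : ∀ᶠ x in 𝓝 q, DifferentiableAt ℝ T x :=
    ((hT.of_le (m := 1) (by exact_mod_cast le_top)).eventually (by simp)).mono
      fun x hx => hx.differentiableAt (by norm_num)
  have hfd : ∀ᶠ x in 𝓝 q, DifferentiableAt ℝ f (T x) :=
    hT.continuousAt.eventually (((hf.of_le (m := 1) (by exact_mod_cast le_top)).eventually
      (by simp)).mono fun x hx => hx.differentiableAt (by norm_num))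
  have hpiola := sum_fderiv_piola (hT.of_le (by norm_cast))
    (V := gradientFlux (fun x => (jacobian T x).transpose * A (T x) * jacobian T x) (f ∘ T))
    (W := fun a y => ε * gradientFlux A f a y)
    (fun i => (contDiffAt_gradientFlux hB (hf.comp q hT) hBq i).differentiableAt (by simp))
    (fun a => ((contDiffAt_gradientFlux hA hf hq a).differentiableAt (by simp)).const_mul ε)
    hdet ?_
  · simp only [coordLaplacian]
    rw [hpiola, sqrt_det_conj]
    have hs := hsign.self_of_nhds
    have e : ∀ a, fderiv ℝ (fun y => ε * gradientFlux A f a y) (T q)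
        = ε • fderiv ℝ (gradientFlux A f a) (T q) := fun a =>
      fderiv_const_mul ((contDiffAt_gradientFlux hA hf hq a).differentiableAt (by simp)) ε
    simp only [e, smul_apply, smul_eq_mul, ← Finset.mul_sum]
    rw [hs]
    have : √(A (T q)).det ≠ 0 := (Real.sqrt_pos.2 hq).ne'
    have hε0 : ε ≠ 0 := fun h => by simp [h] at hε
    field_simp
  -- The two gradient fluxes are related by the Piola transform: the gradient pulls back by Jᵀ, and
  -- J (Jᵀ A J)⁻¹ Jᵀ = A⁻¹.
  · filter_upwards [hsign, hne, hTd, hfd] with x hs hx hTx hfx a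
    have hgrad : (fun j => fderiv ℝ (f ∘ T) x (stdVec j))
        = (jacobian T x).transpose.mulVec (fun b => fderiv ℝ f (T x) (stdVec b)) := by
      funext j
      rw [fderiv_comp x hfx hTx, ContinuousLinearMap.comp_apply, clm_apply_eq_sum_stdVec]
      simp [Matrix.mulVec, dotProduct, jacobian]
    set J := jacobian T x
    set w := fun b => fderiv ℝ f (T x) (stdVec b)
    have hu : IsUnit J.det := hx.isUnit
    have hut : IsUnit J.transpose.det := by rwa [Matrix.det_transpose]
    have hmat : J * (J.transpose * A (T x) * J)⁻¹ * J.transpose = (A (T x))⁻¹ := by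
      rw [Matrix.mul_inv_rev, Matrix.mul_inv_rev, ← Matrix.mul_assoc, Matrix.mul_nonsing_inv _ hu,
        Matrix.one_mul, Matrix.mul_assoc, Matrix.nonsing_inv_mul _ hut, Matrix.mul_one]
    have h1 : ∀ i, gradientFlux (fun x => (jacobian T x).transpose * A (T x) * jacobian T x)
        (f ∘ T) i x = √(J.transpose * A (T x) * J).det *
          ((J.transpose * A (T x) * J)⁻¹.mulVec (J.transpose.mulVec w)) i := by
      intro i
      rw [← hgrad]
      rfl
    have h2 : gradientFlux A f a (T x) = √(A (T x)).det * ((A (T x))⁻¹.mulVec w) a := rfl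
    rw [h2, ← hmat, ← Matrix.mulVec_mulVec, ← Matrix.mulVec_mulVec]
    simp only [h1, sqrt_det_conj, hs]
    conv_rhs => rw [Matrix.mulVec, dotProduct]
    simp only [Finset.mul_sum]
    exact Finset.sum_congr rfl fun i _ => by ring

end Euclidean

/-! ### Matrices of endomorphisms and bilinear forms. -/

section LinearAlgebra

variable {n : ℕ}

/-- The matrix of an endomorphism in the standard basis. -/
def clmMatrix (P : EuclideanSpace ℝ (Fin n) →L[ℝ] EuclideanSpace ℝ (Fin n)) :
    Matrix (Fin n) (Fin n) ℝ :=
  Matrix.of fun a i => P (stdVec i) a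

/-- The matrix of a bilinear form in the standard basis. -/
def bilinMatrix (B : EuclideanSpace ℝ (Fin n) →L[ℝ] EuclideanSpace ℝ (Fin n) →L[ℝ] ℝ) :
    Matrix (Fin n) (Fin n) ℝ :=
  Matrix.of fun i j => B (stdVec i) (stdVec j)

theorem bilin_apply_eq_sum (B : EuclideanSpace ℝ (Fin n) →L[ℝ] EuclideanSpace ℝ (Fin n) →L[ℝ] ℝ)
    (u w : EuclideanSpace ℝ (Fin n)) :
    B u w = ∑ i, ∑ j, u i * bilinMatrix B i j * w j := by
  rw [clm_apply_eq_sum_stdVec B u]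
  simp only [sum_apply, smul_apply, smul_eq_mul]
  refine Finset.sum_congr rfl fun i _ => ?_
  rw [clm_apply_eq_sum_stdVec (B (stdVec i)) w, Finset.mul_sum]
  refine Finset.sum_congr rfl fun j _ => ?_
  simp only [bilinMatrix, Matrix.of_apply, smul_eq_mul]
  ring

theorem bilin_comp_matrix (B : EuclideanSpace ℝ (Fin n) →L[ℝ] EuclideanSpace ℝ (Fin n) →L[ℝ] ℝ)
    (P : EuclideanSpace ℝ (Fin n) →L[ℝ] EuclideanSpace ℝ (Fin n)) :
    (Matrix.of fun i j => B (P (stdVec i)) (P (stdVec j)))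
      = (clmMatrix P).transpose * bilinMatrix B * clmMatrix P := by
  ext i j
  rw [Matrix.of_apply, bilin_apply_eq_sum]
  simp only [Matrix.mul_apply, Matrix.transpose_apply, clmMatrix, Matrix.of_apply, Finset.sum_mul]
  rw [Finset.sum_comm]

theorem bilinMatrix_det_pos {B : EuclideanSpace ℝ (Fin n) →L[ℝ] EuclideanSpace ℝ (Fin n) →L[ℝ] ℝ}
    (hs : ∀ u w, B u w = B w u) (hp : ∀ u, u ≠ 0 → 0 < B u u) : 0 < (bilinMatrix B).det := by
  refine Matrix.PosDef.det_pos (Matrix.PosDef.of_dotProduct_mulVec_pos ?_ fun x hx => ?_)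
  · ext i j
    simp [bilinMatrix, hs (stdVec i)]
  · have h := hp (WithLp.toLp 2 x) (fun h => hx (by simpa using congrArg WithLp.ofLp h))
    rw [bilin_apply_eq_sum] at h
    simpa [dotProduct, Matrix.mulVec, Finset.mul_sum, mul_assoc] using h

theorem clm_det_eq (P : EuclideanSpace ℝ (Fin n) →L[ℝ] EuclideanSpace ℝ (Fin n)) :
    P.det = (clmMatrix P).det := by
  rw [ContinuousLinearMap.det,
    ← LinearMap.det_toMatrix (EuclideanSpace.basisFun (Fin n) ℝ).toBasis]
  congr 1

theorem clmMatrix_det_ne_zero {P : EuclideanSpace ℝ (Fin n) →L[ℝ] EuclideanSpace ℝ (Fin n)}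
    (hP : Function.Injective P) : (clmMatrix P).det ≠ 0 := by
  rw [← clm_det_eq]
  have h : IsUnit (LinearMap.det (P : EuclideanSpace ℝ (Fin n) →ₗ[ℝ] EuclideanSpace ℝ (Fin n))) :=
    LinearMap.isUnit_det _ ((Module.End.isUnit_iff _).2
      ⟨hP, LinearMap.injective_iff_surjective.1 hP⟩)
  exact h.ne_zero

theorem bilin_comp_det_pos {B : EuclideanSpace ℝ (Fin n) →L[ℝ] EuclideanSpace ℝ (Fin n) →L[ℝ] ℝ}
    (hs : ∀ u w, B u w = B w u) (hp : ∀ u, u ≠ 0 → 0 < B u u)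
    {P : EuclideanSpace ℝ (Fin n) →L[ℝ] EuclideanSpace ℝ (Fin n)} (hP : Function.Injective P) :
    0 < (Matrix.of fun i j => B (P (stdVec i)) (P (stdVec j))).det := by
  rw [bilin_comp_matrix, Matrix.det_mul, Matrix.det_mul, Matrix.det_transpose,
    show (clmMatrix P).det * (bilinMatrix B).det * (clmMatrix P).det
      = (clmMatrix P).det ^ 2 * (bilinMatrix B).det by ring]
  have := clmMatrix_det_ne_zero hP
  have := bilinMatrix_det_pos hs hp
  positivity

end LinearAlgebra

/-! ### Metric, Laplacian and volume ratio in local parametrizations. -/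

section Manifold

variable {d : ℕ} {H : Type*} [TopologicalSpace H]
  {I : ModelWithCorners ℝ (EuclideanSpace ℝ (Fin d)) H} {M : Type*} [TopologicalSpace M]
  [ChartedSpace H M] [IsManifold I ∞ M]

/-- The matrix of the metric `g` in the frame `∂_i σ`. -/
def pullGram (g : RiemMetric I M) (σ : EuclideanSpace ℝ (Fin d) → M)
    (q : EuclideanSpace ℝ (Fin d)) : Matrix (Fin d) (Fin d) ℝ :=
  Matrix.of fun i j => g.inner (σ q)
    (mfderiv 𝓘(ℝ, EuclideanSpace ℝ (Fin d)) I σ q (stdVec i))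
    (mfderiv 𝓘(ℝ, EuclideanSpace ℝ (Fin d)) I σ q (stdVec j))

/-- Every tangent space unfolds to the model space, so the same vectors make sense at both points
and no cast is needed. -/
theorem RiemMetric.inner_congr (g : RiemMetric I M) {p p' : M} (h : p = p')
    (u w : EuclideanSpace ℝ (Fin d)) : g.inner p u w = g.inner p' u w := by
  subst h; rfl

/-- A change of frame multiplies both densities by the same factor |det P|, which cancels in the
quotient. -/
theorem logVolumeRatio_eq (g₀ g : RiemMetric I M) (p : M)
    {P : EuclideanSpace ℝ (Fin d) →L[ℝ] EuclideanSpace ℝ (Fin d)} (hP : Function.Injective P) :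
    logVolumeRatio g₀ g p = Real.log
      (√(Matrix.of fun i j => g₀.inner p (P (stdVec i)) (P (stdVec j))).det
        / √(Matrix.of fun i j => g.inner p (P (stdVec i)) (P (stdVec j))).det) := by
  have h0 := bilin_comp_matrix (g₀.inner p) P
  have h1 := bilin_comp_matrix (g.inner p) P
  rw [logVolumeRatio]
  have h2 : |(clmMatrix P).det| ≠ 0 := abs_ne_zero.2 (clmMatrix_det_ne_zero hP)
  have e0 : √(Matrix.of fun i j => g₀.inner p (P (stdVec i)) (P (stdVec j))).det
      = |(clmMatrix P).det| * √(gramAt g₀ p).det := by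
    refine Eq.trans (congrArg (fun A => √(Matrix.det A)) h0) (sqrt_det_conj _ _)
  have e1 : √(Matrix.of fun i j => g.inner p (P (stdVec i)) (P (stdVec j))).det
      = |(clmMatrix P).det| * √(gramAt g p).det := by
    refine Eq.trans (congrArg (fun A => √(Matrix.det A)) h1) (sqrt_det_conj _ _)
  rw [e0, e1, mul_div_mul_left _ _ h2]

/-- The vectors ∂_i σ form smooth fields along `σ`, and the metric is a smooth section of the bundle
of bilinear forms to which they are applied. -/
theorem contDiffAt_pullGram (g : RiemMetric I M) {σ : EuclideanSpace ℝ (Fin d) → M}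
    {q : EuclideanSpace ℝ (Fin d)}
    (hσ : ContMDiffAt 𝓘(ℝ, EuclideanSpace ℝ (Fin d)) I ∞ σ q) (i j : Fin d) :
    ContDiffAt ℝ ∞ (fun x => pullGram g σ x i j) q := by
  have hv : ∀ i : Fin d, ContMDiffAt 𝓘(ℝ, EuclideanSpace ℝ (Fin d)) I.tangent ∞
      (fun x => (Bundle.TotalSpace.mk' (EuclideanSpace ℝ (Fin d)) (σ x)
        (mfderiv 𝓘(ℝ, EuclideanSpace ℝ (Fin d)) I σ x (stdVec i)) : TangentBundle I M)) q := by
    intro i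
    have hc : ContMDiffAt 𝓘(ℝ, EuclideanSpace ℝ (Fin d))
        𝓘(ℝ, EuclideanSpace ℝ (Fin d)).tangent ∞
        (fun x => (Bundle.TotalSpace.mk' (EuclideanSpace ℝ (Fin d)) x
          (stdVec i : EuclideanSpace ℝ (Fin d)) :
          TangentBundle 𝓘(ℝ, EuclideanSpace ℝ (Fin d)) (EuclideanSpace ℝ (Fin d)))) q :=
      contMDiffAt_vectorSpace_iff_contDiffAt.2 contDiffAt_const
    exact ContMDiffAt.clm_apply_of_inCoordinates
      (ContMDiffAt.mfderiv_const hσ (m := ∞) (by simp)) hc hσ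
  have h := ContMDiffAt.clm_bundle_apply₂ (F₁ := EuclideanSpace ℝ (Fin d))
    (F₂ := EuclideanSpace ℝ (Fin d)) (F₃ := ℝ) (E₃ := Bundle.Trivial M ℝ)
    (g.contMDiff.contMDiffAt.comp q hσ) (hv i) (hv j)
  rw [Bundle.contMDiffAt_totalSpace] at h
  exact h.2.contDiffAt

end Manifold

section Manifold

variable {d : ℕ} {H : Type*} [TopologicalSpace H]
  {I : ModelWithCorners ℝ (EuclideanSpace ℝ (Fin d)) H} {M : Type*} [TopologicalSpace M]
  [ChartedSpace H M] [IsManifold I ∞ M]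

theorem metricInChart_eq_pullGram (g : RiemMetric I M) (c : M) {y : EuclideanSpace ℝ (Fin d)}
    (hy : range I ∈ 𝓝 y) : metricInChart g c y = pullGram g (extChartAt I c).symm y := by
  simp only [metricInChart, coordVec, pullGram, mfderivWithin_of_mem_nhds hy]

theorem contMDiffAt_extChartAt_symm_of_mem_nhds {c : M} {y : EuclideanSpace ℝ (Fin d)}
    (hy : y ∈ (extChartAt I c).target) (hr : range I ∈ 𝓝 y) :
    ContMDiffAt 𝓘(ℝ, EuclideanSpace ℝ (Fin d)) I ∞ (extChartAt I c).symm y := by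
  refine (contMDiffOn_extChartAt_symm c y hy).contMDiffAt ?_
  have := extChartAt_target_mem_nhdsWithin_of_mem hy
  rwa [nhdsWithin_eq_nhds.2 hr] at this

theorem contDiffAt_metricInChart (g : RiemMetric I M) {c : M} {y : EuclideanSpace ℝ (Fin d)}
    (hy : y ∈ (extChartAt I c).target) (hr : range I ∈ 𝓝 y) (i j : Fin d) :
    ContDiffAt ℝ ∞ (fun x => metricInChart g c x i j) y := by
  refine (contDiffAt_pullGram g (contMDiffAt_extChartAt_symm_of_mem_nhds hy hr) i j
    ).congr_of_eventuallyEq ?_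
  filter_upwards [eventually_mem_nhds_iff.2 hr] with x hx
  rw [metricInChart_eq_pullGram g c hx]

theorem metricInChart_det_pos (g : RiemMetric I M) {c : M} {y : EuclideanSpace ℝ (Fin d)}
    (hy : y ∈ (extChartAt I c).target) : 0 < (metricInChart g c y).det := by
  obtain ⟨e, he⟩ := isInvertible_mfderivWithin_extChartAt_symm hy
  refine bilin_comp_det_pos (B := g.inner ((extChartAt I c).symm y))
    (fun u w => g.symm _ u w) (fun u hu => g.pos _ u hu)
    (P := mfderivWithin 𝓘(ℝ, EuclideanSpace ℝ (Fin d)) I (extChartAt I c).symm (range I) y) ?_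
  rw [← he]
  exact e.injective

theorem mfderiv_extChartAt_comp {σ : EuclideanSpace ℝ (Fin d) → M}
    {x : EuclideanSpace ℝ (Fin d)} {c : M}
    (hσ : MDifferentiableAt 𝓘(ℝ, EuclideanSpace ℝ (Fin d)) I σ x)
    (hc : σ x ∈ (extChartAt I c).source) (w : EuclideanSpace ℝ (Fin d)) :
    fderiv ℝ (extChartAt I c ∘ σ) x w
      = mfderiv I 𝓘(ℝ, EuclideanSpace ℝ (Fin d)) (extChartAt I c) (σ x)
        (mfderiv 𝓘(ℝ, EuclideanSpace ℝ (Fin d)) I σ x w) := by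
  rw [← mfderiv_eq_fderiv, mfderiv_comp x (mdifferentiableAt_extChartAt (by simpa using hc)) hσ]
  rfl

/-- The differential of `σ` factors through that of its coordinate expression, so the two Gram
matrices are congruent by the Jacobian. -/
theorem pullGram_eq (g : RiemMetric I M) {σ : EuclideanSpace ℝ (Fin d) → M}
    {x : EuclideanSpace ℝ (Fin d)} {c : M}
    (hσ : MDifferentiableAt 𝓘(ℝ, EuclideanSpace ℝ (Fin d)) I σ x)
    (hc : σ x ∈ (extChartAt I c).source) :
    pullGram g σ x = (jacobian (extChartAt I c ∘ σ) x).transpose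
      * metricInChart g c ((extChartAt I c ∘ σ) x) * jacobian (extChartAt I c ∘ σ) x := by
  let y := (extChartAt I c ∘ σ) x
  let P : EuclideanSpace ℝ (Fin d) →L[ℝ] EuclideanSpace ℝ (Fin d) :=
    mfderivWithin 𝓘(ℝ, EuclideanSpace ℝ (Fin d)) I (extChartAt I c).symm (range I) y
  let S : EuclideanSpace ℝ (Fin d) →L[ℝ] EuclideanSpace ℝ (Fin d) :=
    mfderiv 𝓘(ℝ, EuclideanSpace ℝ (Fin d)) I σ x
  let B : EuclideanSpace ℝ (Fin d) →L[ℝ] EuclideanSpace ℝ (Fin d) →L[ℝ] ℝ :=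
    g.inner ((extChartAt I c).symm y)
  have hS : ∀ w, S w = P (fderiv ℝ (extChartAt I c ∘ σ) x w) := by
    intro w
    have h := mfderivWithin_extChartAt_symm_comp_mfderiv_extChartAt' (I := I) hc
    rw [mfderiv_extChartAt_comp hσ hc]
    exact (congrArg (fun L : EuclideanSpace ℝ (Fin d) →L[ℝ] EuclideanSpace ℝ (Fin d) =>
      L (S w)) h).symm
  have h1 : pullGram g σ x = Matrix.of fun i j =>
      (B.bilinearComp P P) (fderiv ℝ (extChartAt I c ∘ σ) x (stdVec i))
        (fderiv ℝ (extChartAt I c ∘ σ) x (stdVec j)) := by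
    ext i j
    simp only [Matrix.of_apply, ContinuousLinearMap.bilinearComp_apply, ← hS]
    exact g.inner_congr ((extChartAt I c).left_inv hc).symm _ _
  rw [h1, bilin_comp_matrix]
  rfl

/-- Inverse function theorem for the coordinate expression of `σ`. The filter form serves both to
find interior points of the model and to show that images are neighborhoods. -/
theorem range_mem_nhds_of_det_ne_zero {σ : EuclideanSpace ℝ (Fin d) → M}
    {q : EuclideanSpace ℝ (Fin d)} {c : M}
    (hσ : ContMDiffAt 𝓘(ℝ, EuclideanSpace ℝ (Fin d)) I ∞ σ q)
    (hc : σ q ∈ (extChartAt I c).source)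
    (hdet : (fderiv ℝ (extChartAt I c ∘ σ) q).det ≠ 0) :
    map (extChartAt I c ∘ σ) (𝓝 q) = 𝓝 (extChartAt I c (σ q)) := by
  have hT : ContDiffAt ℝ ∞ (extChartAt I c ∘ σ) q :=
    ((contMDiffAt_extChartAt' (by simpa using hc)).comp q hσ).contDiffAt
  have hs := hT.hasStrictFDerivAt (by simp)
  rw [← ContinuousLinearMap.coe_toContinuousLinearEquivOfDetNeZero _ hdet] at hs
  exact hs.map_nhds_eq_of_equiv

theorem extChartAt_comp_det_ne_zero (g : RiemMetric I M) {σ : EuclideanSpace ℝ (Fin d) → M}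
    {q : EuclideanSpace ℝ (Fin d)} {c : M}
    (hσ : MDifferentiableAt 𝓘(ℝ, EuclideanSpace ℝ (Fin d)) I σ q)
    (hc : σ q ∈ (extChartAt I c).source) (hdet : (pullGram g σ q).det ≠ 0) :
    (fderiv ℝ (extChartAt I c ∘ σ) q).det ≠ 0 := by
  intro h0
  apply hdet
  rw [pullGram_eq g hσ hc, Matrix.det_mul]
  have : (jacobian (extChartAt I c ∘ σ) q).det = 0 := by
    rw [← h0, clm_det_eq]; rfl
  rw [this, mul_zero]

/-- The manifold may have boundary. A nondegenerate parametrization, smooth on a full Euclidean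
neighborhood, covers a neighborhood in the chart, so it can only hit interior points. -/
theorem range_mem_nhds (g : RiemMetric I M) {σ : EuclideanSpace ℝ (Fin d) → M}
    {q : EuclideanSpace ℝ (Fin d)} {c : M}
    (hσ : ContMDiffAt 𝓘(ℝ, EuclideanSpace ℝ (Fin d)) I ∞ σ q)
    (hc : σ q ∈ (extChartAt I c).source) (hdet : (pullGram g σ q).det ≠ 0) :
    range I ∈ 𝓝 (extChartAt I c (σ q)) := by
  rw [← range_mem_nhds_of_det_ne_zero hσ hc
    (extChartAt_comp_det_ne_zero g (hσ.mdifferentiableAt (by simp)) hc hdet), mem_map]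
  filter_upwards [hσ.continuousAt.preimage_mem_nhds (extChartAt_source_mem_nhds' hc)] with x hx
  exact extChartAt_target_subset_range c ((extChartAt I c).map_source hx)

/-- The image of a neighborhood under a local parametrization is a neighborhood. -/
theorem image_mem_nhds_of_pullGram (g : RiemMetric I M) {σ : EuclideanSpace ℝ (Fin d) → M}
    {q : EuclideanSpace ℝ (Fin d)}
    (hσ : ContMDiffAt 𝓘(ℝ, EuclideanSpace ℝ (Fin d)) I ∞ σ q)
    (hdet : (pullGram g σ q).det ≠ 0) {u : Set (EuclideanSpace ℝ (Fin d))} (hu : u ∈ 𝓝 q) :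
    σ '' u ∈ 𝓝 (σ q) := by
  have hc : σ q ∈ (extChartAt I (σ q)).source := mem_extChartAt_source (σ q)
  have hmap := range_mem_nhds_of_det_ne_zero hσ hc
    (extChartAt_comp_det_ne_zero g (hσ.mdifferentiableAt (by simp)) hc hdet)
  have hu' : u ∩ σ ⁻¹' (extChartAt I (σ q)).source ∈ 𝓝 q :=
    inter_mem hu (hσ.continuousAt.preimage_mem_nhds (extChartAt_source_mem_nhds' hc))
  have h1 : (extChartAt I (σ q) ∘ σ) '' (u ∩ σ ⁻¹' (extChartAt I (σ q)).source)
      ∈ 𝓝 (extChartAt I (σ q) (σ q)) := by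
    rw [← hmap]; exact image_mem_map hu'
  filter_upwards [(continuousAt_extChartAt' hc).preimage_mem_nhds h1,
    extChartAt_source_mem_nhds' hc] with p hp hps
  obtain ⟨x, ⟨hxu, hxs⟩, hx⟩ := hp
  exact ⟨x, hxu, (extChartAt I (σ q)).injOn hxs hps hx⟩

theorem laplacian_eq_coordLaplacian_chart (g : RiemMetric I M) (f : M → ℝ) {p : M}
    (hr : range I ∈ 𝓝 (extChartAt I p p)) :
    laplacian g f p = coordLaplacian (metricInChart g p) (f ∘ (extChartAt I p).symm)
      (extChartAt I p p) := by
  simp only [laplacian, coordLaplacian, densityInChart, partialDeriv]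
  congr 2
  refine Finset.sum_congr rfl fun i _ => ?_
  rw [fderivWithin_of_mem_nhds hr]
  congr 1
  refine Filter.EventuallyEq.fderiv_eq ?_
  filter_upwards [eventually_mem_nhds_iff.2 hr] with x hx
  simp only [gradientFlux, fderivWithin_of_mem_nhds hx]
  rfl

/-- The Laplacian of `f` in any local parametrization. -/
theorem laplacian_eq_coordLaplacian (g : RiemMetric I M) {σ : EuclideanSpace ℝ (Fin d) → M}
    {q : EuclideanSpace ℝ (Fin d)}
    (hσ : ContMDiffAt 𝓘(ℝ, EuclideanSpace ℝ (Fin d)) I ∞ σ q)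
    (hdet : (pullGram g σ q).det ≠ 0) {f : M → ℝ} (hf : ContMDiffAt I 𝓘(ℝ, ℝ) ∞ f (σ q)) :
    laplacian g f (σ q) = coordLaplacian (pullGram g σ) (f ∘ σ) q := by
  have hc : σ q ∈ (extChartAt I (σ q)).source := mem_extChartAt_source (σ q)
  have hr := range_mem_nhds g hσ hc hdet
  have ht : extChartAt I (σ q) (σ q) ∈ (extChartAt I (σ q)).target := mem_extChartAt_target (σ q)
  have hd := extChartAt_comp_det_ne_zero g (hσ.mdifferentiableAt (by simp)) hc hdet
  have hT : ContDiffAt ℝ ∞ (extChartAt I (σ q) ∘ σ) q :=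
    ((contMDiffAt_extChartAt' (by simp)).comp q hσ).contDiffAt
  have hf' : ContDiffAt ℝ ∞ (f ∘ (extChartAt I (σ q)).symm)
      ((extChartAt I (σ q) ∘ σ) q) := by
    refine (ContMDiffAt.comp (I' := I) _ ?_
      (contMDiffAt_extChartAt_symm_of_mem_nhds ht hr)).contDiffAt
    rwa [(extChartAt I (σ q)).left_inv hc]
  rw [laplacian_eq_coordLaplacian_chart g f hr]
  -- The coordinate change is `σ` read in the preferred chart at `σ q`, in which the Laplacian is
  -- defined.
  have h := coordLaplacian_comp hT (by rw [clm_det_eq] at hd; exact hd)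
    (contDiffAt_metricInChart g ht hr) hf' (metricInChart_det_pos g ht)
  rw [Function.comp_apply] at h
  rw [← h]
  have hs : ∀ᶠ x in 𝓝 q, σ x ∈ (extChartAt I (σ q)).source :=
    hσ.continuousAt.preimage_mem_nhds (extChartAt_source_mem_nhds' hc)
  have hm : ∀ᶠ x in 𝓝 q, MDifferentiableAt 𝓘(ℝ, EuclideanSpace ℝ (Fin d)) I σ x :=
    ((contMDiffAt_iff_contMDiffAt_nhds (n := 1) (by simp)).1 (hσ.of_le (by norm_cast))).mono
      fun x hx => hx.mdifferentiableAt (by norm_num)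
  refine Filter.EventuallyEq.coordLaplacian_eq ?_ ?_
  · filter_upwards [hs, hm] with x hx hmx
    exact (pullGram_eq g hmx hx).symm
  · filter_upwards [hs] with x hx
    simp only [Function.comp_apply, (extChartAt I (σ q)).left_inv hx]

/-- The logarithm of the ratio of the volume densities is smooth at interior points. -/
theorem contMDiffAt_logVolumeRatio (g₀ g : RiemMetric I M) {p : M}
    (hr : range I ∈ 𝓝 (extChartAt I p p)) :
    ContMDiffAt I 𝓘(ℝ, ℝ) ∞ (logVolumeRatio g₀ g) p := by
  have ht : extChartAt I p p ∈ (extChartAt I p).target := mem_extChartAt_target p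
  have h : ContDiffAt ℝ ∞ (fun y => Real.log (√(metricInChart g₀ p y).det /
      √(metricInChart g p y).det)) (extChartAt I p p) := by
    have h0 := Real.sqrt_pos.2 (metricInChart_det_pos g₀ ht)
    have h1 := Real.sqrt_pos.2 (metricInChart_det_pos g ht)
    refine ContDiffAt.log (ContDiffAt.div ?_ ?_ h1.ne') (div_pos h0 h1).ne'
    · exact (contDiffAt_det (contDiffAt_metricInChart g₀ ht hr)).sqrt
        (metricInChart_det_pos g₀ ht).ne'
    · exact (contDiffAt_det (contDiffAt_metricInChart g ht hr)).sqrt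
        (metricInChart_det_pos g ht).ne'
  refine (h.contMDiffAt.comp p (contMDiffAt_extChartAt (x := p))).congr_of_eventuallyEq ?_
  filter_upwards [extChartAt_source_mem_nhds (I := I) p] with x hx
  have hx' := (extChartAt I p).map_source hx
  obtain ⟨e, he⟩ := isInvertible_mfderivWithin_extChartAt_symm hx'
  have := logVolumeRatio_eq g₀ g ((extChartAt I p).symm (extChartAt I p x))
    (P := mfderivWithin 𝓘(ℝ, EuclideanSpace ℝ (Fin d)) I (extChartAt I p).symm (range I)
      (extChartAt I p x)) (by rw [← he]; exact e.injective)
  exact (congrArg _ ((extChartAt I p).left_inv hx).symm).trans this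

end Manifold

/-! ### The Riemannian volume as a supremum of chart volumes. -/

section Volume

theorem ContinuousOn.measurableSet_inter_preimage {α β : Type*} [TopologicalSpace α]
    [MeasurableSpace α] [OpensMeasurableSpace α] [TopologicalSpace β] [MeasurableSpace β]
    [BorelSpace β] {f : α → β} {s : Set α} (hf : ContinuousOn f s) (hs : MeasurableSet s)
    {A : Set β} (hA : MeasurableSet A) : MeasurableSet (s ∩ f ⁻¹' A) := by
  have h := (continuousOn_iff_continuous_domRestrict.1 hf).measurable hA
  have := hs.subtype_image h
  convert this using 1
  ext x
  simp [and_comm]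

variable {d : ℕ} {H : Type*} [TopologicalSpace H]
  {I : ModelWithCorners ℝ (EuclideanSpace ℝ (Fin d)) H} {M : Type*} [TopologicalSpace M]
  [ChartedSpace H M]

theorem measurableSet_extChartAt_target (c : M) : MeasurableSet (extChartAt I c).target := by
  rw [extChartAt_target]
  exact ((chartAt H c).open_target.preimage I.continuous_symm).measurableSet.inter
    I.isClosed_range.measurableSet

theorem aemeasurable_extChartAt_symm [MeasurableSpace M] [BorelSpace M] (c : M) :
    AEMeasurable (extChartAt I c).symm (volume.restrict (extChartAt I c).target) :=
  (continuousOn_extChartAt_symm c).aemeasurable (measurableSet_extChartAt_target c)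

variable [IsManifold I ∞ M]

theorem continuousOn_densityInChart [I.Boundaryless] (g : RiemMetric I M) (c : M) :
    ContinuousOn (densityInChart g c) (extChartAt I c).target := fun _ hy =>
  ((contDiffAt_det (contDiffAt_metricInChart g hy (by rw [I.range_eq_univ]; exact univ_mem))
    ).continuousAt.sqrt).continuousWithinAt

variable [MeasurableSpace M] [BorelSpace M]

theorem chartVolume_apply (g : RiemMetric I M) (c : M) {A : Set M} (hA : MeasurableSet A) :
    chartVolume g c A = ∫⁻ y in (extChartAt I c).symm ⁻¹' A ∩ (extChartAt I c).target,
      ENNReal.ofReal (densityInChart g c y) := by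
  rw [chartVolume, Measure.map_apply_of_aemeasurable
    ((aemeasurable_extChartAt_symm c).mono_ac (withDensity_absolutelyContinuous _ _)) hA,
    withDensity_apply', Measure.restrict_restrict' (measurableSet_extChartAt_target c)]

theorem chartVolume_inter_source (g : RiemMetric I M) (c : M) {A : Set M} (hA : MeasurableSet A) :
    chartVolume g c (A ∩ (extChartAt I c).source) = chartVolume g c A := by
  rw [chartVolume_apply g c hA,
    chartVolume_apply g c (hA.inter (isOpen_extChartAt_source c).measurableSet)]
  congr 2
  ext y
  simp only [mem_inter_iff, mem_preimage]
  exact ⟨fun h => ⟨h.1.1, h.2⟩, fun h => ⟨⟨h.1, (extChartAt I c).map_target h.2⟩, h.2⟩⟩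

/-- The volume of a set covered by a parametrization. -/
theorem chartVolume_apply_of_param (g : RiemMetric I M) {σ : EuclideanSpace ℝ (Fin d) → M}
    {U : Set (EuclideanSpace ℝ (Fin d))} (hU : IsOpen U)
    (hσ : ContMDiffOn 𝓘(ℝ, EuclideanSpace ℝ (Fin d)) I ∞ σ U) (hinj : InjOn σ U)
    {c : M} {A : Set M} (hA : MeasurableSet A) (hAU : A ⊆ σ '' U)
    (hAc : A ⊆ (extChartAt I c).source) :
    chartVolume g c A = ∫⁻ q in U ∩ σ ⁻¹' A, ENNReal.ofReal √(pullGram g σ q).det := by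
  have hB : MeasurableSet (U ∩ σ ⁻¹' A) :=
    hσ.continuousOn.measurableSet_inter_preimage hU.measurableSet hA
  have hσd : ∀ q ∈ U, MDifferentiableAt 𝓘(ℝ, EuclideanSpace ℝ (Fin d)) I σ q := fun q hq =>
    (hσ.contMDiffAt (hU.mem_nhds hq)).mdifferentiableAt (by simp)
  have himage : (extChartAt I c).symm ⁻¹' A ∩ (extChartAt I c).target
      = (extChartAt I c ∘ σ) '' (U ∩ σ ⁻¹' A) := by
    ext y
    constructor
    · rintro ⟨hy, hyt⟩
      obtain ⟨q, hqU, hq⟩ := hAU hy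
      refine ⟨q, ⟨hqU, ?_⟩, ?_⟩
      · rw [mem_preimage, hq]; exact hy
      · rw [Function.comp_apply, hq, (extChartAt I c).right_inv hyt]
    · rintro ⟨q, ⟨hqU, hqA⟩, rfl⟩
      refine ⟨?_, (extChartAt I c).map_source (hAc hqA)⟩
      rw [mem_preimage, Function.comp_apply, (extChartAt I c).left_inv (hAc hqA)]
      exact hqA
  have hderiv : ∀ q ∈ U ∩ σ ⁻¹' A, HasFDerivWithinAt (extChartAt I c ∘ σ)
      (fderiv ℝ (extChartAt I c ∘ σ) q) (U ∩ σ ⁻¹' A) q := by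
    rintro q ⟨hqU, hqA⟩
    have : MDifferentiableAt 𝓘(ℝ, EuclideanSpace ℝ (Fin d)) 𝓘(ℝ, EuclideanSpace ℝ (Fin d))
        (extChartAt I c ∘ σ) q :=
      (mdifferentiableAt_extChartAt (by simpa using hAc hqA)).comp q (hσd q hqU)
    exact (mdifferentiableAt_iff_differentiableAt.1 this).hasFDerivAt.hasFDerivWithinAt
  have hinj' : InjOn (extChartAt I c ∘ σ) (U ∩ σ ⁻¹' A) := by
    rintro q ⟨hqU, hqA⟩ q' ⟨hqU', hqA'⟩ h
    exact hinj hqU hqU' ((extChartAt I c).injOn (hAc hqA) (hAc hqA') h)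
  -- Change of variables by `σ` read in the chart; by `pullGram_eq` its Jacobian factor turns the
  -- chart density into the density in the frame of `σ`.
  rw [chartVolume_apply g c hA, himage,
    lintegral_image_eq_lintegral_abs_det_fderiv_mul volume hB hderiv hinj']
  refine setLIntegral_congr_fun hB ?_
  rintro q ⟨hqU, hqA⟩
  dsimp only
  rw [pullGram_eq g (hσd q hqU) (hAc hqA), sqrt_det_conj, clm_det_eq,
    ← ENNReal.ofReal_mul (abs_nonneg _)]
  rfl

/-- The Riemannian volume is determined by its values on the domains of charts. -/
theorem riemVolume_restrict_eq [SecondCountableTopology M] (g : RiemMetric I M) {ν : Measure M}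
    {O : Set M} (hO : MeasurableSet O)
    (h : ∀ c A, MeasurableSet A → A ⊆ O → A ⊆ (extChartAt I c).source →
      chartVolume g c A = ν A) :
    (riemVolume g).restrict O = ν.restrict O := by
  -- An upper bound for all chart volumes at once, hence for their supremum. The top measure is
  -- infinite on every nonempty measurable set, so nothing has to be known outside `O`.
  have hle : riemVolume g ≤ ν.restrict O + (⊤ : Measure M).restrict Oᶜ := by
    refine iSup_le fun c => Measure.le_iff.2 fun A hA => ?_
    rw [Measure.add_apply, Measure.restrict_apply hA, Measure.restrict_apply hA]
    by_cases hne : (A ∩ Oᶜ).Nonempty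
    · obtain ⟨x, hx⟩ := hne
      have h1 : (⊤ : Measure M) (A ∩ Oᶜ) = ⊤ := by
        refine top_unique ?_
        have := Measure.le_iff.1 (le_top : (⊤ : ENNReal) • Measure.dirac x ≤ ⊤) (A ∩ Oᶜ)
          (hA.inter hO.compl)
        rwa [Measure.smul_apply, Measure.dirac_apply_of_mem hx, smul_eq_mul, mul_one] at this
      rw [h1, add_top]
      exact le_top
    · have hAO : A ⊆ O := fun x hx => by
        by_contra hxO
        exact hne ⟨x, hx, hxO⟩
      rw [inter_eq_left.2 hAO, ← chartVolume_inter_source g c hA,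
        h c _ (hA.inter (isOpen_extChartAt_source c).measurableSet)
          (inter_subset_left.trans hAO) inter_subset_right]
      exact (measure_mono inter_subset_left).trans le_self_add
  have hle' : ∀ A, MeasurableSet A → A ⊆ O → riemVolume g A ≤ ν A := by
    intro A hA hAO
    refine (Measure.le_iff.1 hle A hA).trans ?_
    have he : A ∩ Oᶜ = ∅ := by
      rw [← disjoint_iff_inter_eq_empty, disjoint_compl_right_iff_subset]; exact hAO
    rw [Measure.add_apply, Measure.restrict_apply hA, Measure.restrict_apply hA, he, measure_empty,
      add_zero]
    exact measure_mono inter_subset_left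
  -- For the reverse inequality countably many chart domains suffice, and on each of them the
  -- supremum dominates the volume of that chart, which is `ν`.
  obtain ⟨s, hs, hcov⟩ := TopologicalSpace.countable_cover_nhds
    (fun c : M => extChartAt_source_mem_nhds (I := I) c)
  have hOs : O = ⋃ c ∈ s, O ∩ (extChartAt I c).source := by
    rw [← inter_iUnion₂, hcov, inter_univ]
  rw [hOs, Measure.restrict_biUnion_congr hs]
  intro c _
  have hm : MeasurableSet (O ∩ (extChartAt I c).source) :=
    hO.inter (isOpen_extChartAt_source c).measurableSet
  ext A hA
  rw [Measure.restrict_apply hA, Measure.restrict_apply hA]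
  refine le_antisymm (hle' _ (hA.inter hm) (inter_subset_right.trans inter_subset_left)) ?_
  rw [← h c _ (hA.inter hm) (inter_subset_right.trans inter_subset_left)
    (inter_subset_right.trans inter_subset_right)]
  exact Measure.le_iff'.1 (le_iSup (fun c => chartVolume g c) c) _

theorem chartVolume_restrict_source (g : RiemMetric I M) (c : M) :
    (chartVolume g c).restrict (extChartAt I c).source = chartVolume g c := by
  ext A hA
  rw [Measure.restrict_apply hA, chartVolume_inter_source g c hA]

/-- Chart volumes agree on overlaps: the inverse of one chart is a parametrization to which
`chartVolume_apply_of_param` applies for the other. -/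
theorem riemVolume_restrict_source [I.Boundaryless] [SecondCountableTopology M]
    (g : RiemMetric I M) (c : M) :
    (riemVolume g).restrict (extChartAt I c).source = chartVolume g c := by
  rw [← chartVolume_restrict_source g c]
  refine riemVolume_restrict_eq g (isOpen_extChartAt_source c).measurableSet
    fun c' A hA hAc hAc' => ?_
  rw [chartVolume_apply_of_param g (isOpen_extChartAt_target c) (contMDiffOn_extChartAt_symm c)
    (extChartAt I c).symm.injOn hA ?_ hAc', chartVolume_apply g c hA, inter_comm]
  · congr 1
    funext y
    rw [densityInChart, metricInChart_eq_pullGram g c (by rw [I.range_eq_univ]; exact univ_mem)]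
  · intro p hp
    exact ⟨extChartAt I c p, (extChartAt I c).map_source (hAc hp),
      (extChartAt I c).left_inv (hAc hp)⟩

/-- The density is continuous, so each point has a neighborhood of finite volume, lying over a
compact subset of a chart target; compactness does the rest. -/
instance isFiniteMeasure_riemVolume [I.Boundaryless] [CompactSpace M] [SecondCountableTopology M]
    (g : RiemMetric I M) : IsFiniteMeasure (riemVolume g) := by
  have : IsLocallyFiniteMeasure (riemVolume g) := by
    refine ⟨fun x => ?_⟩
    have ht : (extChartAt I x).target ∈ 𝓝 (extChartAt I x x) := extChartAt_target_mem_nhds x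
    obtain ⟨K, hK, hKt, hKc⟩ := local_compact_nhds ht
    have hnhds : (extChartAt I x).source ∩ extChartAt I x ⁻¹' K ∈ 𝓝 x :=
      inter_mem (extChartAt_source_mem_nhds x)
        ((continuousAt_extChartAt x).preimage_mem_nhds hK)
    have hms : MeasurableSet ((extChartAt I x).source ∩ extChartAt I x ⁻¹' K) :=
      (continuousOn_extChartAt x).measurableSet_inter_preimage
        (isOpen_extChartAt_source x).measurableSet hKc.measurableSet
    refine ⟨_, hnhds, ?_⟩
    rw [← inter_eq_left.2 (inter_subset_left (s := (extChartAt I x).source)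
      (t := extChartAt I x ⁻¹' K)), ← Measure.restrict_apply hms, riemVolume_restrict_source,
      chartVolume_apply g x hms]
    refine lt_of_le_of_lt (lintegral_mono_set (t := K) ?_) ?_
    · rintro y ⟨⟨_, hy⟩, hyt⟩
      rwa [mem_preimage, (extChartAt I x).right_inv hyt] at hy
    · have := ((continuousOn_densityInChart g x).mono hKt).integrableOn_compact (μ := volume) hKc
      exact this.lintegral_lt_top
  infer_instance

/-- The integral of a function over the domain of a chart. -/
theorem setIntegral_riemVolume_source [I.Boundaryless] [SecondCountableTopology M]
    (g : RiemMetric I M) (c : M) {F : M → ℝ} (hF : ContinuousOn F (extChartAt I c).source) :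
    ∫ x in (extChartAt I c).source, F x ∂riemVolume g
      = ∫ y in (extChartAt I c).target, densityInChart g c y * F ((extChartAt I c).symm y) := by
  have hF' : AEStronglyMeasurable F (chartVolume g c) := by
    rw [← chartVolume_restrict_source]
    exact hF.aestronglyMeasurable (isOpen_extChartAt_source c).measurableSet
  rw [riemVolume_restrict_source]
  rw [chartVolume] at hF' ⊢
  rw [integral_map ((aemeasurable_extChartAt_symm c).mono_ac
    (withDensity_absolutelyContinuous _ _)) hF',
    integral_withDensity_eq_integral_toReal_smul₀
      ((continuousOn_densityInChart g c).aemeasurable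
        (measurableSet_extChartAt_target c)).ennreal_ofReal
      (ae_of_all _ fun _ => ENNReal.ofReal_lt_top)]
  simp only [smul_eq_mul, densityInChart, ENNReal.toReal_ofReal (Real.sqrt_nonneg _)]

end Volume

/-! ### The integral of a Laplacian over a closed manifold. -/

section Divergence

variable {d : ℕ}

/-- The integral of a partial derivative of a compactly supported function vanishes. -/
theorem integral_fderiv_eq_zero {f : EuclideanSpace ℝ (Fin d) → ℝ} (hf : ContDiff ℝ 1 f)
    (hc : HasCompactSupport f) (w : EuclideanSpace ℝ (Fin d)) :
    ∫ y, fderiv ℝ f y w = 0 := by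
  have hd : Continuous fun y => fderiv ℝ f y w :=
    (hf.continuous_fderiv (by norm_num)).clm_apply continuous_const
  -- Integration by parts against the constant function 1.
  have h := integral_mul_fderiv_eq_neg_fderiv_mul_of_integrable (μ := volume)
    (f := fun _ : EuclideanSpace ℝ (Fin d) => (1 : ℝ)) (g := f) (v := w)
    (by simp) (by simpa using hd.integrable_of_hasCompactSupport (hc.fderiv_apply ℝ w))
    (by simpa using hf.continuous.integrable_of_hasCompactSupport hc)
    (fun x _ => differentiableAt_const _) (fun x _ => hf.differentiable (by norm_num) x)
  simpa using h

/-- The divergence theorem for a vector field on an open set with compact support there. -/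
theorem setIntegral_fderiv_eq_zero {f : EuclideanSpace ℝ (Fin d) → ℝ}
    {U K : Set (EuclideanSpace ℝ (Fin d))} (hU : IsOpen U) (hK : IsCompact K) (hKU : K ⊆ U)
    (hf : ∀ y ∈ U, ContDiffAt ℝ 1 f y) (h0 : ∀ y ∈ U, y ∉ K → f y = 0)
    (w : EuclideanSpace ℝ (Fin d)) :
    IntegrableOn (fun y => fderiv ℝ f y w) U ∧ ∫ y in U, fderiv ℝ f y w = 0 := by
  have hin : ∀ y ∈ U, U.indicator f =ᶠ[𝓝 y] f := fun y hy => by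
    filter_upwards [hU.mem_nhds hy] with z hz using indicator_of_mem hz f
  have hout : ∀ y, y ∉ K → U.indicator f y = 0 := fun y hy => by
    by_cases hyU : y ∈ U
    · rw [indicator_of_mem hyU, h0 y hyU hy]
    · exact indicator_of_notMem hyU f
  have hout' : ∀ y, y ∉ K → U.indicator f =ᶠ[𝓝 y] fun _ => 0 := fun y hy => by
    filter_upwards [hK.isClosed.isOpen_compl.mem_nhds hy] with z hz using hout z hz
  -- The extension by zero is C¹ because it equals `f` near points of `K` and vanishes near all
  -- other points.
  have hs : ContDiff ℝ 1 (U.indicator f) := contDiff_iff_contDiffAt.2 fun y => by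
    by_cases hy : y ∈ K
    · exact (hf y (hKU hy)).congr_of_eventuallyEq (hin y (hKU hy))
    · exact contDiffAt_const.congr_of_eventuallyEq (hout' y hy)
  have hcs : HasCompactSupport (U.indicator f) := HasCompactSupport.intro hK hout
  have hcongr : ∀ y ∈ U, fderiv ℝ (U.indicator f) y w = fderiv ℝ f y w := fun y hy => by
    rw [(hin y hy).fderiv_eq]
  have hd : Continuous fun y => fderiv ℝ (U.indicator f) y w :=
    (hs.continuous_fderiv (by norm_num)).clm_apply continuous_const
  refine ⟨(hd.integrable_of_hasCompactSupport (hcs.fderiv_apply ℝ w)).integrableOn.congr_fun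
    hcongr hU.measurableSet, ?_⟩
  rw [← setIntegral_congr_fun hU.measurableSet hcongr]
  refine (setIntegral_eq_integral_of_forall_compl_eq_zero fun y hy => ?_).trans
    (integral_fderiv_eq_zero hs hcs w)
  rw [(hout' y fun h => hy (hKU h)).fderiv_eq]
  simp

theorem continuousAt_coordLaplacian {A : EuclideanSpace ℝ (Fin d) → Matrix (Fin d) (Fin d) ℝ}
    {f : EuclideanSpace ℝ (Fin d) → ℝ} {q : EuclideanSpace ℝ (Fin d)}
    (hA : ∀ i j, ContDiffAt ℝ ∞ (fun x => A x i j) q) (hf : ContDiffAt ℝ ∞ f q)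
    (hq : 0 < (A q).det) : ContinuousAt (coordLaplacian A f) q := by
  refine ((((contDiffAt_det hA).continuousAt.sqrt).inv₀ (Real.sqrt_pos.2 hq).ne').mul
    (tendsto_finsetSum _ fun i _ => ?_)).neg
  exact (((contDiffAt_gradientFlux hA hf hq i).fderiv_right (m := 0) (by simp)).clm_apply
    (contDiffAt_const (c := (stdVec i : EuclideanSpace ℝ (Fin d))))).continuousAt

theorem coordLaplacian_sum {A : EuclideanSpace ℝ (Fin d) → Matrix (Fin d) (Fin d) ℝ}
    {ι : Type*} {s : Finset ι} {f : ι → EuclideanSpace ℝ (Fin d) → ℝ}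
    {q : EuclideanSpace ℝ (Fin d)}
    (hA : ∀ i j, ContDiffAt ℝ ∞ (fun x => A x i j) q) (hf : ∀ k ∈ s, ContDiffAt ℝ ∞ (f k) q)
    (hq : 0 < (A q).det) :
    coordLaplacian A (fun y => ∑ k ∈ s, f k y) q = ∑ k ∈ s, coordLaplacian A (f k) q := by
  have hd : ∀ᶠ y in 𝓝 q, ∀ k ∈ s, DifferentiableAt ℝ (f k) y :=
    (Finset.eventually_all s).2 fun k hk =>
      (((hf k hk).of_le (m := 1) (by exact_mod_cast le_top)).eventually (by simp)).mono
        fun x hx => hx.differentiableAt (by norm_num)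
  have hflux : ∀ i, gradientFlux A (fun y => ∑ k ∈ s, f k y) i
      =ᶠ[𝓝 q] fun y => ∑ k ∈ s, gradientFlux A (f k) i y := fun i => by
    filter_upwards [hd] with y hy
    simp only [gradientFlux, fderiv_fun_sum hy, sum_apply, Finset.mul_sum]
    rw [Finset.sum_comm]
  simp only [coordLaplacian]
  have h : ∀ i, fderiv ℝ (gradientFlux A (fun y => ∑ k ∈ s, f k y) i) q (stdVec i)
      = ∑ k ∈ s, fderiv ℝ (gradientFlux A (f k) i) q (stdVec i) := fun i => by
    rw [(hflux i).fderiv_eq, fderiv_fun_sum fun k hk =>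
      (contDiffAt_gradientFlux hA (hf k hk) hq i).differentiableAt (by simp), sum_apply]
  simp only [h]
  rw [Finset.sum_comm, Finset.mul_sum, ← Finset.sum_neg_distrib]

variable {H : Type*} [TopologicalSpace H]
  {I : ModelWithCorners ℝ (EuclideanSpace ℝ (Fin d)) H} [I.Boundaryless]
  {M : Type*} [TopologicalSpace M] [ChartedSpace H M] [IsManifold I ∞ M]

theorem metricInChart_eq_pullGram' (g : RiemMetric I M) (c : M) :
    metricInChart g c = pullGram g (extChartAt I c).symm :=
  funext fun y => metricInChart_eq_pullGram g c (by rw [I.range_eq_univ]; exact univ_mem)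

theorem contMDiffAt_extChartAt_symm {c : M} {y : EuclideanSpace ℝ (Fin d)}
    (hy : y ∈ (extChartAt I c).target) :
    ContMDiffAt 𝓘(ℝ, EuclideanSpace ℝ (Fin d)) I ∞ (extChartAt I c).symm y :=
  contMDiffAt_extChartAt_symm_of_mem_nhds hy (by rw [I.range_eq_univ]; exact univ_mem)

/-- The Laplacian in any chart. -/
theorem laplacian_extChartAt_symm (g : RiemMetric I M) {f : M → ℝ} {c : M}
    {y : EuclideanSpace ℝ (Fin d)} (hy : y ∈ (extChartAt I c).target)
    (hf : ContMDiffAt I 𝓘(ℝ, ℝ) ∞ f ((extChartAt I c).symm y)) :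
    laplacian g f ((extChartAt I c).symm y)
      = coordLaplacian (metricInChart g c) (f ∘ (extChartAt I c).symm) y := by
  rw [metricInChart_eq_pullGram']
  refine laplacian_eq_coordLaplacian g (contMDiffAt_extChartAt_symm hy) ?_ hf
  rw [← metricInChart_eq_pullGram']
  exact (metricInChart_det_pos g hy).ne'

theorem contDiffAt_metricInChart' (g : RiemMetric I M) {c : M} {y : EuclideanSpace ℝ (Fin d)}
    (hy : y ∈ (extChartAt I c).target) (i j : Fin d) :
    ContDiffAt ℝ ∞ (fun x => metricInChart g c x i j) y :=
  contDiffAt_metricInChart g hy (by rw [I.range_eq_univ]; exact univ_mem) i j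

theorem contDiffAt_comp_extChartAt_symm {f : M → ℝ} {c : M}
    {y : EuclideanSpace ℝ (Fin d)} (hy : y ∈ (extChartAt I c).target)
    (hf : ContMDiffAt I 𝓘(ℝ, ℝ) ∞ f ((extChartAt I c).symm y)) :
    ContDiffAt ℝ ∞ (f ∘ (extChartAt I c).symm) y :=
  (hf.comp y (contMDiffAt_extChartAt_symm hy)).contDiffAt

theorem continuous_laplacian (g : RiemMetric I M) {f : M → ℝ} (hf : ContMDiff I 𝓘(ℝ, ℝ) ∞ f) :
    Continuous (laplacian g f) := by
  refine continuous_iff_continuousAt.2 fun p => ?_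
  have hp := mem_extChartAt_target (I := I) p
  have h := (continuousAt_coordLaplacian (contDiffAt_metricInChart' g hp)
    (contDiffAt_comp_extChartAt_symm hp (hf _)) (metricInChart_det_pos g hp)).comp
      (continuousAt_extChartAt (I := I) p)
  refine h.congr ?_
  filter_upwards [extChartAt_source_mem_nhds (I := I) p] with x hx
  rw [Function.comp_apply, ← laplacian_extChartAt_symm g ((extChartAt I p).map_source hx) (hf _),
    (extChartAt I p).left_inv hx]

theorem laplacian_sum (g : RiemMetric I M) {ι : Type*} {s : Finset ι} {f : ι → M → ℝ}
    (hf : ∀ k ∈ s, ContMDiff I 𝓘(ℝ, ℝ) ∞ (f k)) (p : M) :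
    laplacian g (fun x => ∑ k ∈ s, f k x) p = ∑ k ∈ s, laplacian g (f k) p := by
  have hr : range I ∈ 𝓝 (extChartAt I p p) := by rw [I.range_eq_univ]; exact univ_mem
  have hp := mem_extChartAt_target (I := I) p
  simp only [laplacian_eq_coordLaplacian_chart g _ hr]
  exact coordLaplacian_sum (contDiffAt_metricInChart' g hp)
    (fun k hk => contDiffAt_comp_extChartAt_symm hp (hf k hk _)) (metricInChart_det_pos g hp)

theorem laplacian_eq_zero_of_notMem_tsupport (g : RiemMetric I M) {f : M → ℝ} {p : M}
    (hp : p ∉ tsupport f) : laplacian g f p = 0 := by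
  have hr : range I ∈ 𝓝 (extChartAt I p p) := by rw [I.range_eq_univ]; exact univ_mem
  have h0 : f =ᶠ[𝓝 p] fun _ => 0 := notMem_tsupport_iff_eventuallyEq.1 hp
  have h1 : f ∘ (extChartAt I p).symm =ᶠ[𝓝 (extChartAt I p p)] fun _ => 0 := by
    have hc : Tendsto (extChartAt I p).symm (𝓝 (extChartAt I p p)) (𝓝 p) := by
      have := continuousAt_extChartAt_symm (I := I) p
      rwa [ContinuousAt, (extChartAt I p).left_inv (mem_extChartAt_source p)] at this
    exact hc.eventually h0
  rw [laplacian_eq_coordLaplacian_chart g _ hr, Filter.EventuallyEq.coordLaplacian_eq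
    (EventuallyEq.refl _ _) h1]
  have : ∀ i, gradientFlux (metricInChart g p) (fun _ : EuclideanSpace ℝ (Fin d) => (0 : ℝ)) i
      = fun _ => 0 := fun i => by
    funext y; simp [gradientFlux]
  simp [coordLaplacian, this]

variable [MeasurableSpace M] [BorelSpace M]

/-- In the chart the density times the Laplacian is minus the divergence of the gradient flux, which
vanishes off the compact image of the support. -/
theorem integral_laplacian_eq_zero_of_tsupport_subset [CompactSpace M]
    [SecondCountableTopology M] (g : RiemMetric I M) {f : M → ℝ}
    (hf : ContMDiff I 𝓘(ℝ, ℝ) ∞ f) {c : M} (hc : tsupport f ⊆ (extChartAt I c).source) :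
    ∫ x, laplacian g f x ∂riemVolume g = 0 := by
  rw [← setIntegral_eq_integral_of_forall_compl_eq_zero (s := (extChartAt I c).source)
    fun x hx => laplacian_eq_zero_of_notMem_tsupport g fun h => hx (hc h),
    setIntegral_riemVolume_source g c (continuous_laplacian g hf).continuousOn]
  have ht := isOpen_extChartAt_target (I := I) c
  have h1 : ∀ y ∈ (extChartAt I c).target, ∀ i, ContDiffAt ℝ ∞
      (gradientFlux (metricInChart g c) (f ∘ (extChartAt I c).symm) i) y := fun y hy i =>
    contDiffAt_gradientFlux (contDiffAt_metricInChart' g hy)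
      (contDiffAt_comp_extChartAt_symm hy (hf _)) (metricInChart_det_pos g hy) i
  have hK : IsCompact (extChartAt I c '' tsupport f) :=
    (isClosed_tsupport f).isCompact.image_of_continuousOn ((continuousOn_extChartAt c).mono hc)
  have hKU : extChartAt I c '' tsupport f ⊆ (extChartAt I c).target := by
    rintro _ ⟨x, hx, rfl⟩
    exact (extChartAt I c).map_source (hc hx)
  have h0 : ∀ y ∈ (extChartAt I c).target, y ∉ extChartAt I c '' tsupport f →
      ∀ i, gradientFlux (metricInChart g c) (f ∘ (extChartAt I c).symm) i y = 0 := by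
    intro y hy hyK i
    have hz : f ∘ (extChartAt I c).symm =ᶠ[𝓝 y] fun _ => 0 := by
      have : (extChartAt I c).symm y ∉ tsupport f := fun h =>
        hyK ⟨_, h, (extChartAt I c).right_inv hy⟩
      exact ((continuousAt_extChartAt_symm'' hy).eventually
        (notMem_tsupport_iff_eventuallyEq.1 this))
    rw [gradientFlux, hz.fderiv_eq]
    simp
  have h2 := fun i => setIntegral_fderiv_eq_zero ht hK hKU
    (fun y hy => (h1 y hy i).of_le (by exact_mod_cast le_top)) (fun y hy hyK => h0 y hy hyK i)
    (stdVec i)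
  have h3 : EqOn (fun y => densityInChart g c y * laplacian g f ((extChartAt I c).symm y))
      (fun y => -∑ i, fderiv ℝ (gradientFlux (metricInChart g c) (f ∘ (extChartAt I c).symm) i) y
        (stdVec i)) (extChartAt I c).target := fun y hy => by
    have := Real.sqrt_pos.2 (metricInChart_det_pos g hy)
    simp only [laplacian_extChartAt_symm g hy (hf _), coordLaplacian, densityInChart]
    field_simp
  rw [setIntegral_congr_fun ht.measurableSet h3, integral_neg,
    integral_finsetSum _ fun i _ => (h2 i).1, Finset.sum_eq_zero fun i _ => (h2 i).2, neg_zero]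

/-- On a compact manifold without boundary the integral of a Laplacian vanishes. -/
theorem integral_laplacian_eq_zero [CompactSpace M] [T2Space M]
    [SecondCountableTopology M] (g : RiemMetric I M) {f : M → ℝ}
    (hf : ContMDiff I 𝓘(ℝ, ℝ) ∞ f) :
    ∫ x, laplacian g f x ∂riemVolume g = 0 := by
  obtain ⟨ρ, hρ⟩ := SmoothPartitionOfUnity.exists_isSubordinate_chartAt_source I M
  -- Compactness leaves finitely many nonzero functions in the partition of unity, so `f` is a
  -- finite sum of functions each supported in one chart.
  have hfin := ρ.locallyFinite.finite_nonempty_of_compact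
  have hsum : ∀ x, ∑ i ∈ hfin.toFinset, ρ i x = 1 := fun x => by
    rw [← ρ.sum_eq_one (mem_univ x)]
    refine (finsum_eq_sum_of_support_subset _ fun i hi => ?_).symm
    simp only [Finite.coe_toFinset, mem_ofPred_eq]
    exact ⟨x, hi⟩
  have hsmooth : ∀ i, ContMDiff I 𝓘(ℝ, ℝ) ∞ fun x => ρ i x * f x := fun i =>
    (ρ i).contMDiff.mul hf
  have hf' : f = fun x => ∑ i ∈ hfin.toFinset, ρ i x * f x := by
    funext x
    rw [← Finset.sum_mul, hsum, one_mul]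
  have hlap : ∀ x, laplacian g f x
      = ∑ i ∈ hfin.toFinset, laplacian g (fun x => ρ i x * f x) x := fun x => by
    conv_lhs => rw [hf']
    exact laplacian_sum g (fun i _ => hsmooth i) x
  simp only [hlap]
  rw [integral_finsetSum _ fun i _ => Continuous.integrable_of_hasCompactSupport
    (continuous_laplacian g (hsmooth i)) (HasCompactSupport.of_compactSpace _)]
  refine Finset.sum_eq_zero fun i _ => ?_
  refine integral_laplacian_eq_zero_of_tsupport_subset g (hsmooth i) (c := i) ?_
  rw [extChartAt_source]
  exact (tsupport_mul_subset_left (f := ρ i)).trans (hρ i)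

end Divergence

/-! ### Warped products dr² + h² B in coordinates. -/

section Split

variable {d : ℕ}

/-- The splitting of `ℝ ^ (d + 1)` into its first coordinate and the others. -/
def splitL (d : ℕ) : EuclideanSpace ℝ (Fin (d + 1)) ≃L[ℝ] ℝ × EuclideanSpace ℝ (Fin d) :=
  (EuclideanSpace.equiv (Fin (d + 1)) ℝ).trans
    ((Fin.consEquivL ℝ fun _ : Fin (d + 1) => ℝ).symm.trans
      ((ContinuousLinearEquiv.refl ℝ ℝ).prodCongr (EuclideanSpace.equiv (Fin d) ℝ).symm))

theorem splitL_apply_fst (q : EuclideanSpace ℝ (Fin (d + 1))) : (splitL d q).1 = q 0 := rfl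

theorem splitL_apply_snd (q : EuclideanSpace ℝ (Fin (d + 1))) (i : Fin d) :
    (splitL d q).2 i = q i.succ := rfl

theorem splitL_stdVec_zero : splitL d (stdVec 0) = (1, 0) := by
  ext i
  · simp [splitL_apply_fst]
  · simp [splitL_apply_snd]

theorem splitL_stdVec_succ (i : Fin d) : splitL d (stdVec i.succ) = (0, stdVec i) := by
  ext j
  · simp [splitL_apply_fst]
  · simp [splitL_apply_snd]

theorem measurePreserving_splitL : MeasurePreserving (splitL d) := by
  have h1 := EuclideanSpace.volume_preserving_symm_measurableEquiv_toLp (Fin (d + 1))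
  have h2 := volume_preserving_piFinSuccAbove (fun _ : Fin (d + 1) => ℝ) 0
  have h3 := (MeasurePreserving.id (volume : Measure ℝ)).prod
    (EuclideanSpace.volume_preserving_symm_measurableEquiv_toLp (Fin d)).symm
  exact h3.comp (h2.comp h1)

theorem fderiv_stdVec_zero {V : EuclideanSpace ℝ (Fin (d + 1)) → ℝ} {r : ℝ}
    {y : EuclideanSpace ℝ (Fin d)} (hV : DifferentiableAt ℝ V ((splitL d).symm (r, y))) :
    fderiv ℝ V ((splitL d).symm (r, y)) (stdVec 0)
      = deriv (fun s => V ((splitL d).symm (s, y))) r := by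
  have h1 : HasDerivAt (fun s : ℝ => (splitL d).symm (s, y)) (stdVec 0) r := by
    have := ((splitL d).symm.hasFDerivAt (x := (r, y))).comp_hasDerivAt r
      ((hasDerivAt_id r).prodMk (hasDerivAt_const r y))
    rwa [ContinuousLinearEquiv.coe_coe, ← splitL_stdVec_zero,
      ContinuousLinearEquiv.symm_apply_apply] at this
  exact ((hV.hasFDerivAt.comp_hasDerivAt r h1).deriv).symm

theorem fderiv_stdVec_succ {V : EuclideanSpace ℝ (Fin (d + 1)) → ℝ} {r : ℝ}
    {y : EuclideanSpace ℝ (Fin d)} (hV : DifferentiableAt ℝ V ((splitL d).symm (r, y)))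
    (i : Fin d) :
    fderiv ℝ V ((splitL d).symm (r, y)) (stdVec i.succ)
      = fderiv ℝ (fun z => V ((splitL d).symm (r, z))) y (stdVec i) := by
  have h1 := ((splitL d).symm.hasFDerivAt (x := (r, y))).comp y
    ((hasFDerivAt_const r y).prodMk (hasFDerivAt_id y))
  have h2 := (hV.hasFDerivAt.comp y h1).fderiv
  have h3 : fderiv ℝ (fun z => V ((splitL d).symm (r, z))) y = _ := h2
  rw [h3]
  simp only [ContinuousLinearMap.comp_apply, ContinuousLinearMap.prod_apply, zero_apply,
    ContinuousLinearMap.id_apply]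
  congr 1
  apply (splitL d).injective
  simp [splitL_stdVec_succ]

/-- The matrix of a metric `dr² + k B`. -/
def warpMatrix (k : ℝ) (B : Matrix (Fin d) (Fin d) ℝ) : Matrix (Fin (d + 1)) (Fin (d + 1)) ℝ :=
  Matrix.of (Fin.cons (Fin.cons 1 0) fun i => Fin.cons 0 fun j => k * B i j)

@[simp] theorem warpMatrix_zero_zero (k : ℝ) (B : Matrix (Fin d) (Fin d) ℝ) :
    warpMatrix k B 0 0 = 1 := rfl

@[simp] theorem warpMatrix_zero_succ (k : ℝ) (B : Matrix (Fin d) (Fin d) ℝ) (j : Fin d) :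
    warpMatrix k B 0 j.succ = 0 := rfl

@[simp] theorem warpMatrix_succ_zero (k : ℝ) (B : Matrix (Fin d) (Fin d) ℝ) (i : Fin d) :
    warpMatrix k B i.succ 0 = 0 := rfl

@[simp] theorem warpMatrix_succ_succ (k : ℝ) (B : Matrix (Fin d) (Fin d) ℝ) (i j : Fin d) :
    warpMatrix k B i.succ j.succ = k * B i j := rfl

/-- `P` stands for the differential of an inverse chart of the slice, or for the identity when the
fixed basis of the tangent space is used. -/
theorem splitL_bilin_eq_warpMatrix (k : ℝ)
    (B : EuclideanSpace ℝ (Fin d) →L[ℝ] EuclideanSpace ℝ (Fin d) →L[ℝ] ℝ)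
    (P : EuclideanSpace ℝ (Fin d) →L[ℝ] EuclideanSpace ℝ (Fin d)) (i j : Fin (d + 1)) :
    (splitL d (stdVec i)).1 * (splitL d (stdVec j)).1
        + k * B (P (splitL d (stdVec i)).2) (P (splitL d (stdVec j)).2)
      = warpMatrix k (Matrix.of fun i j => B (P (stdVec i)) (P (stdVec j))) i j := by
  refine Fin.cases ?_ (fun i => ?_) i <;> refine Fin.cases ?_ (fun j => ?_) j
  · simp [splitL_stdVec_zero]
  · simp [splitL_stdVec_zero, splitL_stdVec_succ]
  · simp [splitL_stdVec_zero, splitL_stdVec_succ]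
  · simp [splitL_stdVec_succ]

theorem warpMatrix_det (k : ℝ) (B : Matrix (Fin d) (Fin d) ℝ) :
    (warpMatrix k B).det = k ^ d * B.det := by
  rw [Matrix.det_succ_row_zero, Fin.sum_univ_succ]
  have h : (warpMatrix k B).submatrix Fin.succ Fin.succ = k • B := by
    ext i j
    simp
  simp [h]

theorem warpMatrix_inv {k : ℝ} (hk : k ≠ 0) {B : Matrix (Fin d) (Fin d) ℝ} (hB : B.det ≠ 0) :
    (warpMatrix k B)⁻¹ = warpMatrix k⁻¹ B⁻¹ := by
  apply Matrix.inv_eq_right_inv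
  have hu := Matrix.mul_nonsing_inv B hB.isUnit
  ext i j
  rw [Matrix.mul_apply, Fin.sum_univ_succ]
  refine Fin.cases ?_ (fun i => ?_) i <;> refine Fin.cases ?_ (fun j => ?_) j
  · simp
  · simp [(Fin.succ_ne_zero j).symm]
  · simp
  · have := congrFun (congrFun hu i) j
    rw [Matrix.mul_apply] at this
    simp only [warpMatrix_succ_zero, zero_mul, warpMatrix_succ_succ, zero_add, Matrix.one_apply,
      Fin.succ_inj] at this ⊢
    rw [← this]
    refine Finset.sum_congr rfl fun l _ => by field_simp

/-- The Laplacian of a warped product `dr² + h(r)² B` with two-dimensional slices. -/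
theorem coordLaplacian_warp {h : ℝ → ℝ}
    {B : EuclideanSpace ℝ (Fin 2) → Matrix (Fin 2) (Fin 2) ℝ}
    {F : EuclideanSpace ℝ (Fin 3) → ℝ} {r : ℝ} {y : EuclideanSpace ℝ (Fin 2)}
    (hh : ContDiffAt ℝ ∞ h r) (hpos : 0 < h r)
    (hB : ∀ i j, ContDiffAt ℝ ∞ (fun x => B x i j) y) (hBpos : 0 < (B y).det)
    (hF : ContDiffAt ℝ ∞ F ((splitL 2).symm (r, y))) :
    h r ^ 2 * coordLaplacian
        (fun q => warpMatrix (h (splitL 2 q).1 ^ 2) (B (splitL 2 q).2)) F ((splitL 2).symm (r, y))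
      = -deriv (fun s => h s ^ 2 * deriv (fun t => F ((splitL 2).symm (t, y))) s) r
        + coordLaplacian B (fun z => F ((splitL 2).symm (r, z))) y := by
  set q := (splitL 2).symm (r, y) with hq
  set A := fun q => warpMatrix (h (splitL 2 q).1 ^ 2) (B (splitL 2 q).2) with hA
  have hq1 : splitL 2 q = (r, y) := (splitL 2).apply_symm_apply _
  have hsp1 : ContDiffAt ℝ ∞ (fun q => (splitL 2 q).1) q :=
    contDiff_fst.contDiffAt.comp q (splitL 2).contDiff.contDiffAt
  have hsp2 : ContDiffAt ℝ ∞ (fun q => (splitL 2 q).2) q :=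
    contDiff_snd.contDiffAt.comp q (splitL 2).contDiff.contDiffAt
  have hh' : ContDiffAt ℝ ∞ (fun q => h (splitL 2 q).1) q :=
    ContDiffAt.comp q (by rwa [hq1]) hsp1
  have hB' : ∀ i j, ContDiffAt ℝ ∞ (fun q => B (splitL 2 q).2 i j) q := fun i j =>
    ContDiffAt.comp (g := fun x => B x i j) q (by rw [hq1]; exact hB i j) hsp2
  have hAs : ∀ i j, ContDiffAt ℝ ∞ (fun q => A q i j) q := fun i j => by
    refine Fin.cases ?_ (fun i => ?_) i <;> refine Fin.cases ?_ (fun j => ?_) j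
    · exact contDiffAt_const
    · exact contDiffAt_const
    · exact contDiffAt_const
    · exact (hh'.pow 2).mul (hB' i j)
  have hdetA : 0 < (A q).det := by
    simp only [hA, warpMatrix_det, hq1]
    positivity
  have hflux := contDiffAt_gradientFlux hAs hF hdetA
  have hgood : ∀ᶠ p in 𝓝 q, 0 < h (splitL 2 p).1 ∧ 0 < (B (splitL 2 p).2).det ∧
      DifferentiableAt ℝ F p := by
    refine (hh'.continuousAt.eventually_const_lt (by simpa only [hq1])).and
      (((contDiffAt_det hB').continuousAt.eventually_const_lt (by simpa only [hq1])).and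
      (((hF.of_le (m := 1) (by exact_mod_cast le_top)).eventually (by simp)).mono
        fun x hx => hx.differentiableAt (by norm_num)))
  -- Here dimension two enters: the determinant of a 2 × 2 block scaled by k² gains k⁴, so the
  -- density gains k².
  have hsqrt : ∀ k : ℝ, 0 < k → ∀ D : Matrix (Fin 2) (Fin 2) ℝ,
      √(warpMatrix (k ^ 2) D).det = k ^ 2 * √D.det := fun k hk D => by
    rw [warpMatrix_det, Real.sqrt_mul (by positivity), Real.sqrt_sq (by positivity)]
  have hcr : ContinuousAt (fun s : ℝ => (splitL 2).symm (s, y)) r := by fun_prop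
  have hcy : ContinuousAt (fun z : EuclideanSpace ℝ (Fin 2) => (splitL 2).symm (r, z)) y := by
    fun_prop
  have e0 : fderiv ℝ (gradientFlux A F 0) q (stdVec 0)
      = √(B y).det * deriv (fun s => h s ^ 2 * deriv (fun t => F ((splitL 2).symm (t, y))) s) r := by
    rw [fderiv_stdVec_zero ((hflux 0).differentiableAt (by simp)), ← deriv_const_mul_field]
    refine Filter.EventuallyEq.deriv_eq ?_
    filter_upwards [hcr.eventually hgood] with s hs
    have hp1 : splitL 2 ((splitL 2).symm (s, y)) = (s, y) := (splitL 2).apply_symm_apply _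
    obtain ⟨h1, h2, h3⟩ := hs
    rw [hp1] at h1 h2
    rw [gradientFlux]
    simp only [hA, hp1]
    dsimp only at h1 h2 ⊢
    rw [hsqrt _ h1, warpMatrix_inv (pow_pos h1 2).ne' h2.ne', Fin.sum_univ_succ,
      fderiv_stdVec_zero h3]
    simp
    ring
  -- The factor h² of the density cancels the h⁻² of the inverse metric, so the tangential flux is
  -- that of `B` alone.
  have e1 : ∀ i : Fin 2, fderiv ℝ (gradientFlux A F i.succ) q (stdVec i.succ)
      = fderiv ℝ (gradientFlux B (fun z => F ((splitL 2).symm (r, z))) i) y (stdVec i) := fun i => by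
    rw [fderiv_stdVec_succ ((hflux i.succ).differentiableAt (by simp))]
    congr 1
    refine Filter.EventuallyEq.fderiv_eq ?_
    filter_upwards [hcy.eventually hgood] with z hz
    have hp1 : splitL 2 ((splitL 2).symm (r, z)) = (r, z) := (splitL 2).apply_symm_apply _
    obtain ⟨h1, h2, h3⟩ := hz
    rw [hp1] at h1 h2
    rw [gradientFlux, gradientFlux]
    simp only [hA, hp1]
    dsimp only at h1 h2 ⊢
    rw [hsqrt _ h1, warpMatrix_inv (pow_pos h1 2).ne' h2.ne', Fin.sum_univ_succ]
    simp only [warpMatrix_succ_zero, zero_mul, warpMatrix_succ_succ, zero_add,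
      fderiv_stdVec_succ h3, Finset.mul_sum]
    refine Finset.sum_congr rfl fun j _ => by field_simp
  have hs := Real.sqrt_pos.2 hBpos
  rw [coordLaplacian, coordLaplacian, Fin.sum_univ_succ, e0, Finset.sum_congr rfl fun i _ => e1 i]
  simp only [hA, hq1]
  rw [hsqrt _ hpos]
  field_simp
  ring

end Split

/-! ### Warped coordinates as local parametrizations of the end. -/

namespace WarpedCoordinates

variable {d : ℕ} {H : Type*} [TopologicalSpace H]
  {I : ModelWithCorners ℝ (EuclideanSpace ℝ (Fin (d + 1))) H} {X : Type*} [TopologicalSpace X]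
  [ChartedSpace H X] [IsManifold I ∞ X] {g g₀ : RiemMetric I X} {E : Set X}
  {N : Type*} [TopologicalSpace N] [ChartedSpace (EuclideanSpace ℝ (Fin d)) N]
  [IsManifold (𝓡 d) ∞ N]

theorem domain_mem_nhds (C : WarpedCoordinates g g₀ E N) {r : ℝ} (hr : C.a < r) (x : N) :
    Ici C.a ×ˢ (univ : Set N) ∈ 𝓝 (r, x) :=
  prod_mem_nhds (Ici_mem_nhds hr) univ_mem

theorem mem_domain (C : WarpedCoordinates g g₀ E N) {r : ℝ} (hr : C.a ≤ r) (x : N) :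
    (r, x) ∈ Ici C.a ×ˢ (univ : Set N) := ⟨hr, mem_univ x⟩

theorem uniqueMDiffOn_domain (C : WarpedCoordinates g g₀ E N) :
    UniqueMDiffOn (𝓘(ℝ, ℝ).prod (𝓡 d)) (Ici C.a ×ˢ (univ : Set N)) :=
  (uniqueDiffOn_Ici C.a).uniqueMDiffOn.prod uniqueMDiffOn_univ

theorem contMDiffAt_param (C : WarpedCoordinates g g₀ E N) {r : ℝ} (hr : C.a < r) (x : N) :
    ContMDiffAt (𝓘(ℝ, ℝ).prod (𝓡 d)) I ∞ C.param (r, x) :=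
  C.smooth_param.contMDiffAt (C.domain_mem_nhds hr x)

theorem injOn_param (C : WarpedCoordinates g g₀ E N) :
    InjOn C.param (Ici C.a ×ˢ (univ : Set N)) := fun q hq q' hq' h => by
  rw [← C.coord_param q hq, h, C.coord_param q' hq']

/-- The differential of the parametrization, on `ℝ × ℝ ^ d`. -/
def dparam (C : WarpedCoordinates g g₀ E N) (r : ℝ) (x : N) :
    ℝ × EuclideanSpace ℝ (Fin d) →L[ℝ] EuclideanSpace ℝ (Fin (d + 1)) :=
  mfderivWithin (𝓘(ℝ, ℝ).prod (𝓡 d)) I C.param (Ici C.a ×ˢ (univ : Set N)) (r, x)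

theorem inner_dparam (C : WarpedCoordinates g g₀ E N) {r : ℝ} (hr : C.a ≤ r) (x : N)
    (z w : ℝ × EuclideanSpace ℝ (Fin d)) :
    g.inner (C.param (r, x)) (C.dparam r x z) (C.dparam r x w)
      = z.1 * w.1 + (C.G r).inner x z.2 w.2 :=
  C.metric_eq r hr x z.1 w.1 z.2 w.2

theorem inner_dparam_background (C : WarpedCoordinates g g₀ E N) {r : ℝ} (hr : C.a ≤ r) (x : N)
    (z w : ℝ × EuclideanSpace ℝ (Fin d)) :
    g₀.inner (C.param (r, x)) (C.dparam r x z) (C.dparam r x w)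
      = z.1 * w.1 + C.h r ^ 2 * C.Ghat.inner x z.2 w.2 :=
  C.background_eq r hr x z.1 w.1 z.2 w.2

/-- The parametrization in a chart of `N`. -/
def localParam (C : WarpedCoordinates g g₀ E N) (c : N) (q : EuclideanSpace ℝ (Fin (d + 1))) : X :=
  C.param ((splitL d q).1, (extChartAt (𝓡 d) c).symm (splitL d q).2)

/-- The domain of `localParam`. -/
def localDomain (C : WarpedCoordinates g g₀ E N) (c : N) :
    Set (EuclideanSpace ℝ (Fin (d + 1))) :=
  splitL d ⁻¹' (Ioi C.a ×ˢ (extChartAt (𝓡 d) c).target)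

theorem isOpen_localDomain (C : WarpedCoordinates g g₀ E N) (c : N) : IsOpen (C.localDomain c) :=
  (isOpen_Ioi.prod (isOpen_extChartAt_target c)).preimage (splitL d).continuous

theorem mem_localDomain (C : WarpedCoordinates g g₀ E N) {r : ℝ} (hr : C.a < r) {c x : N}
    (hx : x ∈ (extChartAt (𝓡 d) c).source) :
    (splitL d).symm (r, extChartAt (𝓡 d) c x) ∈ C.localDomain c := by
  rw [localDomain, mem_preimage, ContinuousLinearEquiv.apply_symm_apply]
  exact ⟨hr, (extChartAt (𝓡 d) c).map_source hx⟩

theorem localParam_apply (C : WarpedCoordinates g g₀ E N) (r : ℝ) {c x : N}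
    (hx : x ∈ (extChartAt (𝓡 d) c).source) :
    C.localParam c ((splitL d).symm (r, extChartAt (𝓡 d) c x)) = C.param (r, x) := by
  rw [localParam, ContinuousLinearEquiv.apply_symm_apply, (extChartAt (𝓡 d) c).left_inv hx]

theorem contMDiffAt_localParam (C : WarpedCoordinates g g₀ E N) {c : N}
    {q : EuclideanSpace ℝ (Fin (d + 1))} (hq : q ∈ C.localDomain c) :
    ContMDiffAt 𝓘(ℝ, EuclideanSpace ℝ (Fin (d + 1))) I ∞ (C.localParam c) q := by
  have h1 : ContMDiffAt 𝓘(ℝ, EuclideanSpace ℝ (Fin (d + 1))) 𝓘(ℝ, ℝ) ∞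
      (fun q => (splitL d q).1) q :=
    (contDiff_fst.comp (splitL d).contDiff).contMDiff.contMDiffAt
  have h2 : ContMDiffAt 𝓘(ℝ, EuclideanSpace ℝ (Fin (d + 1))) 𝓘(ℝ, EuclideanSpace ℝ (Fin d)) ∞
      (fun q => (splitL d q).2) q :=
    (contDiff_snd.comp (splitL d).contDiff).contMDiff.contMDiffAt
  have h3 := (contMDiffAt_extChartAt_symm (I := 𝓡 d) hq.2).comp q h2
  exact (C.contMDiffAt_param hq.1 _).comp q (h1.prodMk h3)

theorem mfderiv_localParam (C : WarpedCoordinates g g₀ E N) {c : N}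
    {q : EuclideanSpace ℝ (Fin (d + 1))} (hq : q ∈ C.localDomain c)
    (w : EuclideanSpace ℝ (Fin (d + 1))) :
    mfderiv 𝓘(ℝ, EuclideanSpace ℝ (Fin (d + 1))) I (C.localParam c) q w
      = C.dparam (splitL d q).1 ((extChartAt (𝓡 d) c).symm (splitL d q).2)
        ((splitL d w).1, mfderiv 𝓘(ℝ, EuclideanSpace ℝ (Fin d)) (𝓡 d)
          (extChartAt (𝓡 d) c).symm (splitL d q).2 (splitL d w).2) := by
  have h1 : HasMFDerivAt 𝓘(ℝ, EuclideanSpace ℝ (Fin (d + 1))) 𝓘(ℝ, ℝ)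
      (fun q => (splitL d q).1) q
      ((ContinuousLinearMap.fst ℝ ℝ (EuclideanSpace ℝ (Fin d))).comp
        (splitL d : EuclideanSpace ℝ (Fin (d + 1)) →L[ℝ] ℝ × EuclideanSpace ℝ (Fin d))) :=
    ((ContinuousLinearMap.fst ℝ ℝ (EuclideanSpace ℝ (Fin d))).comp
      (splitL d : EuclideanSpace ℝ (Fin (d + 1)) →L[ℝ] ℝ × EuclideanSpace ℝ (Fin d))
      ).hasFDerivAt.hasMFDerivAt
  have h2 : HasMFDerivAt 𝓘(ℝ, EuclideanSpace ℝ (Fin (d + 1))) 𝓘(ℝ, EuclideanSpace ℝ (Fin d))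
      (fun q => (splitL d q).2) q
      ((ContinuousLinearMap.snd ℝ ℝ (EuclideanSpace ℝ (Fin d))).comp
        (splitL d : EuclideanSpace ℝ (Fin (d + 1)) →L[ℝ] ℝ × EuclideanSpace ℝ (Fin d))) :=
    ((ContinuousLinearMap.snd ℝ ℝ (EuclideanSpace ℝ (Fin d))).comp
      (splitL d : EuclideanSpace ℝ (Fin (d + 1)) →L[ℝ] ℝ × EuclideanSpace ℝ (Fin d))
      ).hasFDerivAt.hasMFDerivAt
  have h3 := ((contMDiffAt_extChartAt_symm (I := 𝓡 d) hq.2).mdifferentiableAt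
    (by simp)).hasMFDerivAt.comp q h2
  have h4 := ((C.contMDiffAt_param hq.1 ((extChartAt (𝓡 d) c).symm (splitL d q).2)
    ).mdifferentiableAt (by simp)).hasMFDerivAt.comp q (h1.prodMk h3)
  have h5 : mfderiv 𝓘(ℝ, EuclideanSpace ℝ (Fin (d + 1))) I (C.localParam c) q = _ := h4.mfderiv
  rw [h5, dparam, mfderivWithin_of_mem_nhds (C.domain_mem_nhds hq.1 _)]
  rfl

theorem pullGram_localParam_background (C : WarpedCoordinates g g₀ E N) {c : N}
    {q : EuclideanSpace ℝ (Fin (d + 1))} (hq : q ∈ C.localDomain c) :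
    pullGram g₀ (C.localParam c) q
      = warpMatrix (C.h (splitL d q).1 ^ 2) (metricInChart C.Ghat c (splitL d q).2) := by
  rw [metricInChart_eq_pullGram']
  ext i j
  rw [pullGram, Matrix.of_apply, C.mfderiv_localParam hq, C.mfderiv_localParam hq]
  exact (C.inner_dparam_background (le_of_lt hq.1) _ _ _).trans
    (splitL_bilin_eq_warpMatrix _ (C.Ghat.inner _) (mfderiv 𝓘(ℝ, EuclideanSpace ℝ (Fin d)) (𝓡 d)
      (extChartAt (𝓡 d) c).symm (splitL d q).2) i j)

/-- The warping factor is 1 because all dependence on r sits in the slice metric. -/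
theorem pullGram_localParam (C : WarpedCoordinates g g₀ E N) {c : N}
    {q : EuclideanSpace ℝ (Fin (d + 1))} (hq : q ∈ C.localDomain c) :
    pullGram g (C.localParam c) q
      = warpMatrix 1 (metricInChart (C.G (splitL d q).1) c (splitL d q).2) := by
  rw [metricInChart_eq_pullGram']
  ext i j
  rw [pullGram, Matrix.of_apply, C.mfderiv_localParam hq, C.mfderiv_localParam hq]
  refine ((C.inner_dparam (le_of_lt hq.1) _ _ _).trans ?_).trans
    (splitL_bilin_eq_warpMatrix 1 ((C.G (splitL d q).1).inner _)
      (mfderiv 𝓘(ℝ, EuclideanSpace ℝ (Fin d)) (𝓡 d)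
        (extChartAt (𝓡 d) c).symm (splitL d q).2) i j)
  rw [one_mul]
  rfl

theorem pullGram_localParam_det_pos (C : WarpedCoordinates g g₀ E N) {c : N}
    {q : EuclideanSpace ℝ (Fin (d + 1))} (hq : q ∈ C.localDomain c) :
    0 < (pullGram g₀ (C.localParam c) q).det := by
  rw [C.pullGram_localParam_background hq, warpMatrix_det]
  have := C.h_pos (splitL d q).1 (mem_Ici.2 (le_of_lt hq.1))
  have := metricInChart_det_pos C.Ghat hq.2
  positivity

theorem injOn_localParam (C : WarpedCoordinates g g₀ E N) (c : N) :
    InjOn (C.localParam c) (C.localDomain c) := by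
  intro q hq q' hq' h
  have := C.injOn_param (C.mem_domain (le_of_lt hq.1) _) (C.mem_domain (le_of_lt hq'.1) _) h
  rw [Prod.mk.injEq] at this
  exact (splitL d).injective (Prod.ext this.1
    ((extChartAt (𝓡 d) c).symm.injOn hq.2 hq'.2 this.2))

/-- `localParam` is nondegenerate for g₀, so the inverse function theorem makes the part r > a of
the end open in `X`. -/
theorem image_param_mem_nhds (C : WarpedCoordinates g g₀ E N) {r : ℝ} (hr : C.a < r) (x : N)
    {u : Set (ℝ × N)} (hu : u ∈ 𝓝 (r, x)) : C.param '' u ∈ 𝓝 (C.param (r, x)) := by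
  have hx := mem_extChartAt_source (I := 𝓡 d) x
  have hq := C.mem_localDomain hr hx
  have hc : ContinuousAt (fun q : EuclideanSpace ℝ (Fin (d + 1)) =>
      ((splitL d q).1, (extChartAt (𝓡 d) x).symm (splitL d q).2))
      ((splitL d).symm (r, extChartAt (𝓡 d) x x)) := by
    refine ContinuousAt.prodMk (by fun_prop) (ContinuousAt.comp ?_ (by fun_prop))
    exact continuousAt_extChartAt_symm'' hq.2
  have hu' := hc.preimage_mem_nhds (t := u) (by
    rwa [ContinuousLinearEquiv.apply_symm_apply, (extChartAt (𝓡 d) x).left_inv hx])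
  have h := image_mem_nhds_of_pullGram g₀ (C.contMDiffAt_localParam hq)
    (C.pullGram_localParam_det_pos hq).ne' hu'
  rw [C.localParam_apply r hx] at h
  refine mem_of_superset h ?_
  rintro _ ⟨q, hq, rfl⟩
  exact ⟨_, hq, rfl⟩

theorem isOpen_image_param (C : WarpedCoordinates g g₀ E N) {u : Set (ℝ × N)} (hu : IsOpen u)
    (hua : u ⊆ Ioi C.a ×ˢ univ) : IsOpen (C.param '' u) := by
  refine isOpen_iff_mem_nhds.2 ?_
  rintro _ ⟨⟨r, x⟩, hq, rfl⟩
  exact C.image_param_mem_nhds (hua hq).1 x (hu.mem_nhds hq)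

theorem range_mem_nhds_param (C : WarpedCoordinates g g₀ E N) {r : ℝ} (hr : C.a < r) (x : N) :
    range I ∈ 𝓝 (extChartAt I (C.param (r, x)) (C.param (r, x))) := by
  have hx := mem_extChartAt_source (I := 𝓡 d) x
  have hq := C.mem_localDomain hr hx
  have := range_mem_nhds g₀ (C.contMDiffAt_localParam hq) (mem_extChartAt_source _)
    (C.pullGram_localParam_det_pos hq).ne'
  rwa [C.localParam_apply r hx] at this

theorem contMDiffAt_logVolumeRatio_param (C : WarpedCoordinates g g₀ E N) {r : ℝ} (hr : C.a < r)
    (x : N) : ContMDiffAt I 𝓘(ℝ, ℝ) ∞ (logVolumeRatio g₀ g) (C.param (r, x)) :=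
  contMDiffAt_logVolumeRatio g₀ g (C.range_mem_nhds_param hr x)

end WarpedCoordinates

/-! ### Mean curvature and radial mass as radial derivatives. -/

/-- At the center of its own chart the inverse chart has the identity as differential. This links
chart computations with `formMatrix`. -/
theorem metricInChart_self {d : ℕ} {H : Type*} [TopologicalSpace H]
    {I : ModelWithCorners ℝ (EuclideanSpace ℝ (Fin d)) H} {M : Type*} [TopologicalSpace M]
    [ChartedSpace H M] [IsManifold I ∞ M] (g : RiemMetric I M) (x : M) :
    metricInChart g x (extChartAt I x x) = gramAt g x := by
  have h : ∀ i, (coordVec I x i (extChartAt I x x) : EuclideanSpace ℝ (Fin d)) = stdVec i :=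
    fun i => congrArg (fun L : EuclideanSpace ℝ (Fin d) →L[ℝ] EuclideanSpace ℝ (Fin d) =>
      L (stdVec i)) (mfderivWithin_range_extChartAt_symm (I := I) (x := x))
  ext i j
  refine Eq.trans ?_ (g.inner_congr ((extChartAt I x).left_inv (mem_extChartAt_source x)) _ _)
  exact congrArg₂ (fun u w : EuclideanSpace ℝ (Fin d) =>
    g.inner ((extChartAt I x).symm (extChartAt I x x)) u w) (h i) (h j)

/-- The mean curvature is the logarithmic derivative of the volume density. -/
theorem meanCurv_eq_deriv {d : ℕ} {N : Type*} [TopologicalSpace N]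
    [ChartedSpace (EuclideanSpace ℝ (Fin d)) N] [IsManifold (𝓡 d) ∞ N] {a r : ℝ} (hr : a < r)
    {B : ℝ → ∀ x : N, TangentSpace (𝓡 d) x →L[ℝ] TangentSpace (𝓡 d) x →L[ℝ] ℝ} {x : N}
    (hB : ∀ i j, DifferentiableAt ℝ (fun s => formMatrix (B s) x i j) r)
    (hdet : 0 < (formMatrix (B r) x).det) :
    HasDerivAt (fun s => Real.log √(formMatrix (B s) x).det) (meanCurv a B r x) r := by
  -- The logarithmic derivative of √det B is tr(adj(B) B') / (2 det B), which is ½ tr(B⁻¹ B').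
  have h := (hasDerivAt_det fun i j => (hB i j).hasDerivAt (f := fun s => formMatrix (B s) x i j)
    ).sqrt hdet.ne' |>.log (Real.sqrt_pos.2 hdet).ne'
  refine h.congr_deriv ?_
  have hs : secondForm a B r x = (1 / 2 : ℝ) •
      (Matrix.of fun i j => deriv (fun s => formMatrix (B s) x i j) r) := by
    ext i j
    simp [secondForm, derivWithin_of_mem_nhds (Ici_mem_nhds hr)]
  rw [meanCurv, weingarten, hs, Matrix.inv_def, Ring.inverse_eq_inv', Matrix.mul_smul,
    Matrix.smul_mul, Matrix.trace_smul, Matrix.trace_smul, smul_eq_mul, smul_eq_mul]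
  have h2 : √(formMatrix (B r) x).det * √(formMatrix (B r) x).det = (formMatrix (B r) x).det :=
    Real.mul_self_sqrt hdet.le
  have h3 := Real.sqrt_pos.2 hdet
  rw [div_div, mul_assoc, h2]
  field_simp
  rfl

namespace WarpedCoordinates

variable {d : ℕ} {H : Type*} [TopologicalSpace H]
  {I : ModelWithCorners ℝ (EuclideanSpace ℝ (Fin (d + 1))) H} {X : Type*} [TopologicalSpace X]
  [ChartedSpace H X] [IsManifold I ∞ X] {g g₀ : RiemMetric I X} {E : Set X}
  {N : Type*} [TopologicalSpace N] [ChartedSpace (EuclideanSpace ℝ (Fin d)) N]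
  [IsManifold (𝓡 d) ∞ N]

/-- A vector of the kernel has zero length for dr² + h² `Ghat`, which is positive definite. This
covers the boundary slice too. -/
theorem injective_dparam (C : WarpedCoordinates g g₀ E N) {r : ℝ} (hr : C.a ≤ r) (x : N) :
    Function.Injective (C.dparam r x) := by
  refine (injective_iff_map_eq_zero _).2 fun z hz => ?_
  have h := C.inner_dparam_background hr x z z
  have h0 : g₀.inner (C.param (r, x)) (C.dparam r x z) (C.dparam r x z) = 0 := by
    rw [hz]
    exact (congrArg (fun L : EuclideanSpace ℝ (Fin (d + 1)) →L[ℝ] ℝ => L 0)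
      (map_zero (g₀.inner (C.param (r, x))))).trans rfl
  rw [h0] at h
  have hh := C.h_pos r hr
  by_contra hne
  rcases eq_or_ne z.2 0 with h2 | h2
  · have h1 : z.1 ≠ 0 := fun h1 => hne (Prod.ext h1 h2)
    have h3 : C.Ghat.inner x z.2 z.2 = 0 := by
      rw [h2]
      exact (congrArg (fun L : EuclideanSpace ℝ (Fin d) →L[ℝ] ℝ => L 0)
        (map_zero (C.Ghat.inner x))).trans rfl
    rw [h3] at h
    have : 0 < z.1 * z.1 := mul_self_pos.2 h1
    linarith
  · have h3 : 0 < C.Ghat.inner x z.2 z.2 := C.Ghat.pos x z.2 h2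
    have h4 : 0 < C.h r ^ 2 * C.Ghat.inner x z.2 z.2 := by positivity
    have := mul_self_nonneg z.1
    linarith

theorem gramAt_det_pos {n : ℕ} {H : Type*} [TopologicalSpace H]
    {I : ModelWithCorners ℝ (EuclideanSpace ℝ (Fin n)) H} {M : Type*} [TopologicalSpace M]
    [ChartedSpace H M] [IsManifold I ∞ M] (g : RiemMetric I M) (x : M) : 0 < (gramAt g x).det :=
  bilinMatrix_det_pos (B := g.inner x) (fun u w => g.symm x u w) fun u hu => g.pos x u hu

/-- In the frame made of ∂_r and the basis of the slice both metrics are block diagonal with radial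
block 1, so only the slice determinants remain. -/
theorem logVolumeRatio_param (C : WarpedCoordinates g g₀ E N) {r : ℝ} (hr : C.a ≤ r) (x : N) :
    logVolumeRatio g₀ g (C.param (r, x))
      = Real.log √(formMatrix (fun y => C.h r ^ 2 • C.Ghat.inner y) x).det
        - Real.log √(formMatrix (fun y => (C.G r).inner y) x).det := by
  let P : EuclideanSpace ℝ (Fin (d + 1)) →L[ℝ] EuclideanSpace ℝ (Fin (d + 1)) :=
    (C.dparam r x).comp (splitL d : EuclideanSpace ℝ (Fin (d + 1)) →L[ℝ] _)
  have hP : Function.Injective P := (C.injective_dparam hr x).comp (splitL d).injective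
  have e0 : (Matrix.of fun i j => g₀.inner (C.param (r, x)) (P (stdVec i)) (P (stdVec j)))
      = warpMatrix 1 (formMatrix (fun y => C.h r ^ 2 • C.Ghat.inner y) x) := by
    ext i j
    refine ((C.inner_dparam_background hr x _ _).trans ?_).trans
      (splitL_bilin_eq_warpMatrix 1 (C.h r ^ 2 • C.Ghat.inner x) (.id ℝ _) i j)
    rw [one_mul]
    rfl
  have e1 : (Matrix.of fun i j => g.inner (C.param (r, x)) (P (stdVec i)) (P (stdVec j)))
      = warpMatrix 1 (formMatrix (fun y => (C.G r).inner y) x) := by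
    ext i j
    refine ((C.inner_dparam hr x _ _).trans ?_).trans
      (splitL_bilin_eq_warpMatrix 1 ((C.G r).inner x) (.id ℝ _) i j)
    rw [one_mul]
    rfl
  have hf : formMatrix (fun y => C.h r ^ 2 • C.Ghat.inner y) x = C.h r ^ 2 • gramAt C.Ghat x := by
    ext i j
    rfl
  have p0 : 0 < (formMatrix (fun y => C.h r ^ 2 • C.Ghat.inner y) x).det := by
    rw [hf, Matrix.det_smul]
    have := gramAt_det_pos C.Ghat x
    have := C.h_pos r hr
    positivity
  have p1 : 0 < (formMatrix (fun y => (C.G r).inner y) x).det := gramAt_det_pos (C.G r) x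
  rw [logVolumeRatio_eq g₀ g _ hP, e0, e1, warpMatrix_det, warpMatrix_det, one_pow, one_mul,
    one_mul, Real.log_div (Real.sqrt_pos.2 p0).ne' (Real.sqrt_pos.2 p1).ne']

/-- The structure does not postulate smoothness of `G` in r; it is recovered from that of `g` and of
the parametrization. -/
theorem differentiableAt_formMatrix (C : WarpedCoordinates g g₀ E N) {r : ℝ} (hr : C.a < r) (x : N)
    (i j : Fin d) :
    DifferentiableAt ℝ (fun s => formMatrix (fun y => (C.G s).inner y) x i j) r := by
  have hx := mem_extChartAt_source (I := 𝓡 d) x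
  have h := (contDiffAt_pullGram g (C.contMDiffAt_localParam (C.mem_localDomain hr hx))
    i.succ j.succ).differentiableAt (by simp)
  have h2 : DifferentiableAt ℝ (fun s : ℝ => (splitL d).symm (s, extChartAt (𝓡 d) x x)) r := by
    fun_prop
  refine (h.comp r h2).congr_of_eventuallyEq ?_
  filter_upwards [Ioi_mem_nhds hr] with s hs
  rw [Function.comp_apply, C.pullGram_localParam (C.mem_localDomain hs hx),
    ContinuousLinearEquiv.apply_symm_apply, warpMatrix_succ_succ, one_mul, metricInChart_self]
  rfl

/-- The radial mass is the radial derivative of the logarithm of the volume ratio, times `h²`. -/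
theorem radialMass_eq (C : WarpedCoordinates g g₀ E N) {r : ℝ} (hr : C.a < r) (x : N) :
    C.radialMass r x
      = C.h r ^ 2 * deriv (fun s => logVolumeRatio g₀ g (C.param (s, x))) r := by
  have hh : DifferentiableAt ℝ C.h r :=
    (C.smooth_h.contDiffAt (Ici_mem_nhds hr)).differentiableAt (by simp)
  have hf : ∀ s, formMatrix (fun y => C.h s ^ 2 • C.Ghat.inner y) x
      = C.h s ^ 2 • gramAt C.Ghat x := fun s => by
    ext i j
    rfl
  have h0 := meanCurv_eq_deriv (B := fun s y => C.h s ^ 2 • C.Ghat.inner y) (x := x) hr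
    (fun i j => by
      simp only [hf, Matrix.smul_apply, smul_eq_mul]
      exact (hh.pow 2).mul_const _)
    (by
      rw [hf, Matrix.det_smul]
      have := gramAt_det_pos C.Ghat x
      have := C.h_pos r (mem_Ici.2 hr.le)
      positivity)
  have h1 := meanCurv_eq_deriv (B := fun s y => (C.G s).inner y) hr
    (C.differentiableAt_formMatrix hr x) (gramAt_det_pos (C.G r) x)
  rw [radialMass, ← (h0.sub h1).deriv]
  congr 1
  refine Filter.EventuallyEq.deriv_eq ?_
  filter_upwards [Ioi_mem_nhds hr] with s hs
  rw [C.logVolumeRatio_param (le_of_lt hs)]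
  rfl

end WarpedCoordinates

/-! ### The background Laplacian in warped coordinates. -/

namespace WarpedCoordinates

variable {H : Type*} [TopologicalSpace H]
  {I : ModelWithCorners ℝ (EuclideanSpace ℝ (Fin 3)) H} {X : Type*} [TopologicalSpace X]
  [ChartedSpace H X] [IsManifold I ∞ X] {g g₀ : RiemMetric I X} {E : Set X}
  {N : Type*} [TopologicalSpace N] [ChartedSpace (EuclideanSpace ℝ (Fin 2)) N]
  [IsManifold (𝓡 2) ∞ N]

/-- The Laplacian of the background metric in warped coordinates. -/
theorem laplacian_param (C : WarpedCoordinates g g₀ E N) {r : ℝ} (hr : C.a < r) (x : N)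
    {f : X → ℝ} (hf : ContMDiffAt I 𝓘(ℝ, ℝ) ∞ f (C.param (r, x))) :
    C.h r ^ 2 * laplacian g₀ f (C.param (r, x))
      = -deriv (fun s => C.h s ^ 2 * deriv (fun t => f (C.param (t, x))) s) r
        + laplacian C.Ghat (fun z => f (C.param (r, z))) x := by
  have hx := mem_extChartAt_source (I := 𝓡 2) x
  have hy := mem_extChartAt_target (I := 𝓡 2) x
  have hq := C.mem_localDomain hr hx
  set q := (splitL 2).symm (r, extChartAt (𝓡 2) x x) with hqdef
  have hσq : C.localParam x q = C.param (r, x) := C.localParam_apply r hx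
  have hf' : ContMDiffAt I 𝓘(ℝ, ℝ) ∞ f (C.localParam x q) := by rwa [hσq]
  have h1 := laplacian_eq_coordLaplacian g₀ (C.contMDiffAt_localParam hq)
    (C.pullGram_localParam_det_pos hq).ne' hf'
  have h2 : pullGram g₀ (C.localParam x) =ᶠ[𝓝 q] fun q => warpMatrix (C.h (splitL 2 q).1 ^ 2)
      (metricInChart C.Ghat x (splitL 2 q).2) := by
    filter_upwards [(C.isOpen_localDomain x).mem_nhds hq] with p hp
    exact C.pullGram_localParam_background hp
  rw [hσq] at h1
  rw [h1, h2.coordLaplacian_eq (EventuallyEq.refl _ _),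
    coordLaplacian_warp (C.smooth_h.contDiffAt (Ici_mem_nhds hr)) (C.h_pos r hr.le)
      (contDiffAt_metricInChart' C.Ghat hy) (metricInChart_det_pos C.Ghat hy)
      (hf'.comp q (C.contMDiffAt_localParam hq)).contDiffAt]
  have h3 : ContMDiffAt (𝓡 2) 𝓘(ℝ, ℝ) ∞ (fun z => f (C.param (r, z)))
      ((extChartAt (𝓡 2) x).symm (extChartAt (𝓡 2) x x)) := by
    rw [(extChartAt (𝓡 2) x).left_inv hx]
    exact hf.comp x ((C.contMDiffAt_param hr x).comp x (contMDiffAt_const.prodMk contMDiffAt_id))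
  have h4 := laplacian_extChartAt_symm C.Ghat hy h3
  rw [(extChartAt (𝓡 2) x).left_inv hx] at h4
  rw [h4]
  simp only [Function.comp_def, localParam,
    ContinuousLinearEquiv.apply_symm_apply, (extChartAt (𝓡 2) x).left_inv hx]

end WarpedCoordinates

/-! ### The background volume in warped coordinates. -/

namespace WarpedCoordinates

variable {H : Type*} [TopologicalSpace H]
  {I : ModelWithCorners ℝ (EuclideanSpace ℝ (Fin 3)) H} {X : Type*} [TopologicalSpace X]
  [ChartedSpace H X] [IsManifold I ∞ X] {g g₀ : RiemMetric I X} {E : Set X}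
  {N : Type*} [TopologicalSpace N] [ChartedSpace (EuclideanSpace ℝ (Fin 2)) N]
  [IsManifold (𝓡 2) ∞ N]

theorem sqrt_det_pullGram_localParam (C : WarpedCoordinates g g₀ E N) {c : N}
    {q : EuclideanSpace ℝ (Fin 3)} (hq : q ∈ C.localDomain c) :
    √(pullGram g₀ (C.localParam c) q).det
      = C.h (splitL 2 q).1 ^ 2 * densityInChart C.Ghat c (splitL 2 q).2 := by
  rw [C.pullGram_localParam_background hq, warpMatrix_det, Real.sqrt_mul (by positivity),
    Real.sqrt_sq (by positivity), densityInChart]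

/-- The measure `h² dr`. -/
def radialMeasure (C : WarpedCoordinates g g₀ E N) : Measure ℝ :=
  (volume.restrict (Ioi C.a)).withDensity fun r => ENNReal.ofReal (C.h r ^ 2)

theorem aemeasurable_ofReal_sq (C : WarpedCoordinates g g₀ E N) :
    AEMeasurable (fun r => ENNReal.ofReal (C.h r ^ 2)) (volume.restrict (Ioi C.a)) :=
  (((C.smooth_h.continuousOn.mono Ioi_subset_Ici_self).pow 2).aemeasurable
    measurableSet_Ioi).ennreal_ofReal

instance (C : WarpedCoordinates g g₀ E N) : SFinite C.radialMeasure := by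
  unfold radialMeasure; infer_instance

variable [MeasurableSpace N] [BorelSpace N]

/-- The volume of the background metric in warped coordinates. -/
def slabMeasure (C : WarpedCoordinates g g₀ E N) : Measure (ℝ × N) :=
  C.radialMeasure.prod (riemVolume C.Ghat)

variable [CompactSpace N] [SecondCountableTopology N]

theorem slabMeasure_compl (C : WarpedCoordinates g g₀ E N) :
    C.slabMeasure (Ioi C.a ×ˢ (univ : Set N))ᶜ = 0 := by
  have h : (Ioi C.a ×ˢ (univ : Set N))ᶜ = (Ioi C.a)ᶜ ×ˢ univ := by
    ext z; simp
  have h2 : C.radialMeasure (Ioi C.a)ᶜ = 0 := by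
    refine withDensity_absolutelyContinuous _ _ ?_
    rw [Measure.restrict_apply measurableSet_Ioi.compl, compl_inter_self, measure_empty]
  rw [h, slabMeasure, Measure.prod_prod, h2, zero_mul]

/-- Tonelli over r and a chart of the slice. The integrand is the g₀-density in the frame of
`localParam`, ready for comparison with `chartVolume_apply_of_param`. -/
theorem slabMeasure_apply (C : WarpedCoordinates g g₀ E N) (c : N) {D : Set (ℝ × N)}
    (hD : MeasurableSet D) (hDa : D ⊆ Ioi C.a ×ˢ (extChartAt (𝓡 2) c).source) :
    C.slabMeasure D = ∫⁻ q in C.localDomain c ∩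
        (fun q => ((splitL 2 q).1, (extChartAt (𝓡 2) c).symm (splitL 2 q).2)) ⁻¹' D,
      ENNReal.ofReal (C.h (splitL 2 q).1 ^ 2 * densityInChart C.Ghat c (splitL 2 q).2) := by
  set S : Set (ℝ × EuclideanSpace ℝ (Fin 2)) := (Ioi C.a ×ˢ (extChartAt (𝓡 2) c).target) ∩
    (fun z => (z.1, (extChartAt (𝓡 2) c).symm z.2)) ⁻¹' D with hS
  set F : ℝ × EuclideanSpace ℝ (Fin 2) → ENNReal :=
    fun z => ENNReal.ofReal (C.h z.1 ^ 2 * densityInChart C.Ghat c z.2) with hF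
  have ht := isOpen_extChartAt_target (I := 𝓡 2) c
  have hSm : MeasurableSet S := by
    refine ContinuousOn.measurableSet_inter_preimage ?_ (isOpen_Ioi.prod ht).measurableSet hD
    exact continuousOn_fst.prodMk ((continuousOn_extChartAt_symm c).comp continuousOn_snd
      fun z hz => hz.2)
  have hFm : AEMeasurable (S.indicator F) (volume.prod volume) := by
    rw [aemeasurable_indicator_iff hSm]
    refine AEMeasurable.ennreal_ofReal (ContinuousOn.aemeasurable ?_ hSm)
    refine (((C.smooth_h.continuousOn.comp continuousOn_fst fun z hz => ?_).pow 2).mul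
      ((continuousOn_densityInChart C.Ghat c).comp continuousOn_snd fun z hz => hz.1.2))
    exact Ioi_subset_Ici_self hz.1.1
  have e1 : ∫⁻ q in C.localDomain c ∩
        (fun q => ((splitL 2 q).1, (extChartAt (𝓡 2) c).symm (splitL 2 q).2)) ⁻¹' D,
      ENNReal.ofReal (C.h (splitL 2 q).1 ^ 2 * densityInChart C.Ghat c (splitL 2 q).2)
      = ∫⁻ z in S, F z :=
    measurePreserving_splitL.setLIntegral_comp_preimage_emb
      (splitL 2).toHomeomorph.measurableEmbedding F S
  rw [e1, ← lintegral_indicator hSm, Measure.volume_eq_prod, lintegral_prod _ hFm, slabMeasure,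
    Measure.prod_apply hD, radialMeasure,
    lintegral_withDensity_eq_lintegral_mul₀ C.aemeasurable_ofReal_sq
      (measurable_measure_prodMk_left hD).aemeasurable,
    ← lintegral_indicator measurableSet_Ioi]
  refine lintegral_congr fun r => ?_
  by_cases hr : r ∈ Ioi C.a
  · rw [indicator_of_mem hr, Pi.mul_apply]
    have hDr : MeasurableSet (Prod.mk r ⁻¹' D) := measurable_prodMk_left hD
    have hDs : Prod.mk r ⁻¹' D ⊆ (extChartAt (𝓡 2) c).source := fun x hx => (hDa hx).2
    have hm : MeasurableSet ((extChartAt (𝓡 2) c).symm ⁻¹' (Prod.mk r ⁻¹' D) ∩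
        (extChartAt (𝓡 2) c).target) := by
      rw [inter_comm]
      exact (continuousOn_extChartAt_symm c).measurableSet_inter_preimage ht.measurableSet hDr
    have h1 : riemVolume C.Ghat (Prod.mk r ⁻¹' D) = chartVolume C.Ghat c (Prod.mk r ⁻¹' D) := by
      rw [← riemVolume_restrict_source, Measure.restrict_apply hDr, inter_eq_left.2 hDs]
    rw [h1, chartVolume_apply _ _ hDr, ← lintegral_const_mul' _ _ ENNReal.ofReal_ne_top,
      ← lintegral_indicator hm]
    refine lintegral_congr fun y => ?_
    by_cases hy : y ∈ (extChartAt (𝓡 2) c).symm ⁻¹' (Prod.mk r ⁻¹' D) ∩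
        (extChartAt (𝓡 2) c).target
    · rw [indicator_of_mem hy, indicator_of_mem (show (r, y) ∈ S from ⟨⟨hr, hy.2⟩, hy.1⟩),
        ← ENNReal.ofReal_mul (sq_nonneg _)]
    · rw [indicator_of_notMem hy, indicator_of_notMem fun h : (r, y) ∈ S => hy ⟨h.2, h.1.2⟩]
  · rw [indicator_of_notMem hr]
    refine (lintegral_eq_zero_of_ae_eq_zero (ae_of_all _ fun y => ?_)).symm
    exact indicator_of_notMem (fun h : (r, y) ∈ S => hr h.1.1) _

variable [MeasurableSpace X] [BorelSpace X]

/-- The parametrization is arbitrary for r < a, but the slab measure is carried by r > a, where it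
is continuous. -/
theorem aemeasurable_param (C : WarpedCoordinates g g₀ E N) :
    AEMeasurable C.param C.slabMeasure := by
  have h : C.slabMeasure.restrict (Ioi C.a ×ˢ (univ : Set N)) = C.slabMeasure :=
    Measure.restrict_eq_self_of_ae_mem <|
      (measure_eq_zero_iff_ae_notMem.1 C.slabMeasure_compl).mono fun _ hz => not_not.1 hz
  rw [← h]
  exact (C.smooth_param.continuousOn.mono (prod_mono Ioi_subset_Ici_self subset_rfl)).aemeasurable
    (measurableSet_Ioi.prod MeasurableSet.univ)

theorem map_param_apply (C : WarpedCoordinates g g₀ E N) {A : Set X} (hA : MeasurableSet A) :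
    C.slabMeasure.map C.param A
      = C.slabMeasure (Ioi C.a ×ˢ (univ : Set N) ∩ C.param ⁻¹' A) := by
  rw [Measure.map_apply_of_aemeasurable C.aemeasurable_param hA]
  refine le_antisymm ?_ (measure_mono inter_subset_right)
  refine (measure_mono (t := (Ioi C.a ×ˢ (univ : Set N) ∩ C.param ⁻¹' A) ∪
    (Ioi C.a ×ˢ (univ : Set N))ᶜ) fun z hz => ?_).trans ((measure_union_le _ _).trans ?_)
  · by_cases h : z ∈ Ioi C.a ×ˢ (univ : Set N)
    · exact Or.inl ⟨h, hz⟩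
    · exact Or.inr h
  · rw [C.slabMeasure_compl, add_zero]

/-- The parametrization transports `h² dr dμ` to the Riemannian volume of the background metric. -/
theorem riemVolume_restrict_param [SecondCountableTopology X]
    (C : WarpedCoordinates g g₀ E N) :
    (riemVolume g₀).restrict (C.param '' (Ioi C.a ×ˢ univ)) = C.slabMeasure.map C.param := by
  have hopen : ∀ s : Set N, IsOpen s → IsOpen (C.param '' (Ioi C.a ×ˢ s)) := fun s hs =>
    C.isOpen_image_param (isOpen_Ioi.prod hs) (prod_mono subset_rfl (subset_univ s))
  have hO := (hopen univ isOpen_univ).measurableSet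
  have hself : (C.slabMeasure.map C.param).restrict (C.param '' (Ioi C.a ×ˢ univ))
      = C.slabMeasure.map C.param := by
    ext A hA
    rw [Measure.restrict_apply hA, C.map_param_apply (hA.inter hO), C.map_param_apply hA]
    congr 1
    ext z
    exact ⟨fun h => ⟨h.1, h.2.1⟩, fun h => ⟨h.1, h.2, ⟨z, h.1, rfl⟩⟩⟩
  rw [← hself]
  refine riemVolume_restrict_eq g₀ hO fun c A hA hAO hAc => ?_
  -- Countably many charts of `N` reduce the comparison to sets parametrized by a single
  -- `localParam`, where both measures are integrals of the same density.
  obtain ⟨s, hs, hcov⟩ := TopologicalSpace.countable_cover_nhds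
    (fun k : N => extChartAt_source_mem_nhds (I := 𝓡 2) k)
  have hcov' : C.param '' (Ioi C.a ×ˢ univ)
      = ⋃ k ∈ s, C.param '' (Ioi C.a ×ˢ (extChartAt (𝓡 2) k).source) := by
    rw [← hcov, prod_iUnion₂, image_iUnion₂]
  have hk : ∀ k ∈ s, ((chartVolume g₀ c).restrict A).restrict
        (C.param '' (Ioi C.a ×ˢ (extChartAt (𝓡 2) k).source))
      = ((C.slabMeasure.map C.param).restrict A).restrict
        (C.param '' (Ioi C.a ×ˢ (extChartAt (𝓡 2) k).source)) := by
    intro k _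
    have hOk := (hopen _ (isOpen_extChartAt_source (I := 𝓡 2) k)).measurableSet
    ext A' hA'
    rw [Measure.restrict_apply hA', Measure.restrict_apply (hA'.inter hOk),
      Measure.restrict_apply hA', Measure.restrict_apply (hA'.inter hOk)]
    set A'' := A' ∩ C.param '' (Ioi C.a ×ˢ (extChartAt (𝓡 2) k).source) ∩ A with hA''
    have hm : MeasurableSet A'' := (hA'.inter hOk).inter hA
    have hsub : A'' ⊆ C.param '' (Ioi C.a ×ˢ (extChartAt (𝓡 2) k).source) := fun p hp => hp.1.2
    have hσ : ContMDiffOn 𝓘(ℝ, EuclideanSpace ℝ (Fin 3)) I ∞ (C.localParam k)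
        (C.localDomain k) := fun q hq => (C.contMDiffAt_localParam hq).contMDiffWithinAt
    have hDm : MeasurableSet (Ioi C.a ×ˢ (univ : Set N) ∩ C.param ⁻¹' A'') :=
      (C.smooth_param.continuousOn.mono (prod_mono Ioi_subset_Ici_self subset_rfl)
        ).measurableSet_inter_preimage (measurableSet_Ioi.prod MeasurableSet.univ) hm
    have hDs : Ioi C.a ×ˢ (univ : Set N) ∩ C.param ⁻¹' A''
        ⊆ Ioi C.a ×ˢ (extChartAt (𝓡 2) k).source := by
      rintro z ⟨hz, hzA⟩
      obtain ⟨w, hw, hwz⟩ := hsub hzA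
      have : w = z := C.injOn_param ⟨Ioi_subset_Ici_self hw.1, mem_univ _⟩
        ⟨Ioi_subset_Ici_self hz.1, mem_univ _⟩ hwz
      exact this ▸ hw
    rw [C.map_param_apply hm, C.slabMeasure_apply k hDm hDs,
      chartVolume_apply_of_param g₀ (C.isOpen_localDomain k) hσ (C.injOn_localParam k) hm ?_
        fun p hp => hAc hp.2]
    · have hset : C.localDomain k ∩
          (fun q => ((splitL 2 q).1, (extChartAt (𝓡 2) k).symm (splitL 2 q).2)) ⁻¹'
            (Ioi C.a ×ˢ (univ : Set N) ∩ C.param ⁻¹' A'')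
          = C.localDomain k ∩ C.localParam k ⁻¹' A'' := by
        ext q
        exact ⟨fun h => ⟨h.1, h.2.2⟩, fun h => ⟨h.1, ⟨h.1.1, mem_univ _⟩, h.2⟩⟩
      rw [hset]
      refine setLIntegral_congr_fun (hσ.continuousOn.measurableSet_inter_preimage
        (C.isOpen_localDomain k).measurableSet hm) fun q hq => ?_
      simp only [C.sqrt_det_pullGram_localParam hq.1]
    · intro p hp
      obtain ⟨⟨r, x⟩, hz, rfl⟩ := hsub hp
      exact ⟨_, C.mem_localDomain hz.1 hz.2, C.localParam_apply r hz.2⟩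
  have := (Measure.restrict_biUnion_congr hs).2 hk
  rw [← hcov'] at this
  have h2 := congrArg (fun m : Measure X => m A) this
  simp only [Measure.restrict_apply hA, inter_eq_left.2 hAO, inter_self] at h2
  exact h2

end WarpedCoordinates

/-! ### Rigidity of the radial coordinate under a change of warped coordinates. -/

namespace WarpedCoordinates

variable {d : ℕ} {H : Type*} [TopologicalSpace H]
  {I : ModelWithCorners ℝ (EuclideanSpace ℝ (Fin (d + 1))) H} {X : Type*} [TopologicalSpace X]
  [ChartedSpace H X] [IsManifold I ∞ X] {g g₀ : RiemMetric I X} {E : Set X}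
  {N : Type*} [TopologicalSpace N] [ChartedSpace (EuclideanSpace ℝ (Fin d)) N]
  [IsManifold (𝓡 d) ∞ N]

/-- The change of coordinates. -/
def transition (C C' : WarpedCoordinates g g₀ E N) (q : ℝ × N) : ℝ × N :=
  C'.coord (C.param q)

theorem transition_mem (C C' : WarpedCoordinates g g₀ E N) {q : ℝ × N}
    (hq : q ∈ Ici C.a ×ˢ (univ : Set N)) :
    C.transition C' q ∈ Ici C'.a ×ˢ (univ : Set N) :=
  C'.coord_mem _ (C.param_mem q hq)

theorem param_transition (C C' : WarpedCoordinates g g₀ E N) {q : ℝ × N}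
    (hq : q ∈ Ici C.a ×ˢ (univ : Set N)) : C'.param (C.transition C' q) = C.param q :=
  C'.param_coord _ (C.param_mem q hq)

theorem transition_transition (C C' : WarpedCoordinates g g₀ E N) {q : ℝ × N}
    (hq : q ∈ Ici C.a ×ˢ (univ : Set N)) : C'.transition C (C.transition C' q) = q := by
  rw [transition, C.param_transition C' hq, C.coord_param q hq]

theorem contMDiffOn_transition (C C' : WarpedCoordinates g g₀ E N) :
    ContMDiffOn (𝓘(ℝ, ℝ).prod (𝓡 d)) (𝓘(ℝ, ℝ).prod (𝓡 d)) ∞ (C.transition C')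
      (Ici C.a ×ˢ (univ : Set N)) :=
  C'.smooth_coord.comp C.smooth_param fun q hq => C.param_mem q hq

theorem mdifferentiableWithinAt_transition (C C' : WarpedCoordinates g g₀ E N) {q : ℝ × N}
    (hq : q ∈ Ici C.a ×ˢ (univ : Set N)) :
    MDifferentiableWithinAt (𝓘(ℝ, ℝ).prod (𝓡 d)) (𝓘(ℝ, ℝ).prod (𝓡 d)) (C.transition C')
      (Ici C.a ×ˢ (univ : Set N)) q :=
  (C.contMDiffOn_transition C').mdifferentiableOn (by simp) q hq

/-- The differential of the change of coordinates, on `ℝ × ℝ ^ d`. -/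
def dtransition (C C' : WarpedCoordinates g g₀ E N) (q : ℝ × N) :
    ℝ × EuclideanSpace ℝ (Fin d) →L[ℝ] ℝ × EuclideanSpace ℝ (Fin d) :=
  mfderivWithin (𝓘(ℝ, ℝ).prod (𝓡 d)) (𝓘(ℝ, ℝ).prod (𝓡 d)) (C.transition C')
    (Ici C.a ×ˢ (univ : Set N)) q

theorem dparam_dtransition (C C' : WarpedCoordinates g g₀ E N) {r : ℝ} (hr : C.a ≤ r) (x : N)
    (z : ℝ × EuclideanSpace ℝ (Fin d)) :
    C'.dparam (C.transition C' (r, x)).1 (C.transition C' (r, x)).2 (C.dtransition C' (r, x) z)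
      = C.dparam r x z := by
  have hq := C.mem_domain hr x
  have hu := C.uniqueMDiffOn_domain (r, x) hq
  have h1 := mfderivWithin_comp (r, x)
    (C'.smooth_param.mdifferentiableOn (by simp) _ (C.transition_mem C' hq))
    (C.mdifferentiableWithinAt_transition C' hq) (fun p hp => C.transition_mem C' hp) hu
  have h2 : mfderivWithin (𝓘(ℝ, ℝ).prod (𝓡 d)) I (C'.param ∘ C.transition C')
      (Ici C.a ×ˢ (univ : Set N)) (r, x) = mfderivWithin (𝓘(ℝ, ℝ).prod (𝓡 d)) I C.param
      (Ici C.a ×ˢ (univ : Set N)) (r, x) :=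
    mfderivWithin_congr (fun p hp => C.param_transition C' hp) (C.param_transition C' hq)
  exact congrArg (fun L : ℝ × EuclideanSpace ℝ (Fin d) →L[ℝ] EuclideanSpace ℝ (Fin (d + 1)) => L z)
    (h1.symm.trans h2)

/-- Both sides are the squared g₀-length of one tangent vector of `X`, so the transition is an
isometry of the two warped forms. -/
theorem inner_dtransition (C C' : WarpedCoordinates g g₀ E N) {r : ℝ} (hr : C.a ≤ r) (x : N)
    (z : ℝ × EuclideanSpace ℝ (Fin d)) :
    (C.dtransition C' (r, x) z).1 * (C.dtransition C' (r, x) z).1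
      + C'.h (C.transition C' (r, x)).1 ^ 2 * C'.Ghat.inner (C.transition C' (r, x)).2
        (C.dtransition C' (r, x) z).2 (C.dtransition C' (r, x) z).2
      = z.1 * z.1 + C.h r ^ 2 * C.Ghat.inner x z.2 z.2 := by
  have hq := C.mem_domain hr x
  rw [← C.inner_dparam_background hr x, ← C'.inner_dparam_background (C.transition_mem C' hq).1,
    C.dparam_dtransition C' hr x]
  exact g₀.inner_congr (C.param_transition C' hq) _ _

theorem dtransition_dtransition (C C' : WarpedCoordinates g g₀ E N) {r : ℝ} (hr : C.a ≤ r) (x : N)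
    (z : ℝ × EuclideanSpace ℝ (Fin d)) :
    C'.dtransition C (C.transition C' (r, x)) (C.dtransition C' (r, x) z) = z := by
  have hq := C.mem_domain hr x
  apply C.injective_dparam hr x
  have h := C'.dparam_dtransition C (C.transition_mem C' hq).1 (C.transition C' (r, x)).2
    (C.dtransition C' (r, x) z)
  rw [C.dparam_dtransition C' hr x z, Prod.mk.eta, C.transition_transition C' hq] at h
  exact h

theorem hasDerivWithinAt_transition_fst (C C' : WarpedCoordinates g g₀ E N) {r : ℝ}
    (hr : C.a ≤ r) (x : N) :
    HasDerivWithinAt (fun s => (C.transition C' (s, x)).1) (C.dtransition C' (r, x) (1, 0)).1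
      (Ici C.a) r := by
  have hq := C.mem_domain hr x
  have h1 : HasMFDerivWithinAt 𝓘(ℝ, ℝ) (𝓘(ℝ, ℝ).prod (𝓡 d)) (fun s : ℝ => (s, x)) (Ici C.a) r
      ((ContinuousLinearMap.id ℝ ℝ).prod (0 : ℝ →L[ℝ] EuclideanSpace ℝ (Fin d))) :=
    ((hasMFDerivAt_id r).prodMk (hasMFDerivAt_const x r)).hasMFDerivWithinAt
  have h2 := (C.mdifferentiableWithinAt_transition C' hq).hasMFDerivWithinAt.comp r h1
    (show Ici C.a ⊆ (fun s : ℝ => (s, x)) ⁻¹' (Ici C.a ×ˢ univ) from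
      fun s hs => C.mem_domain (mem_Ici.1 hs) x)
  have h3 := (hasMFDerivAt_fst (I := 𝓘(ℝ, ℝ)) (I' := 𝓡 d)
    (C.transition C' (r, x))).comp_hasMFDerivWithinAt r h2
  have h4 : HasFDerivWithinAt (fun s => (C.transition C' (s, x)).1)
      ((ContinuousLinearMap.fst ℝ ℝ (EuclideanSpace ℝ (Fin d))).comp
        ((C.dtransition C' (r, x)).comp
          ((ContinuousLinearMap.id ℝ ℝ).prod (0 : ℝ →L[ℝ] EuclideanSpace ℝ (Fin d)))))
      (Ici C.a) r := hasMFDerivWithinAt_iff_hasFDerivWithinAt.1 h3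
  exact h4.hasDerivWithinAt

/-- The vector ∂_r has g₀-length 1, and the radial component of a vector in the other system is at
most its length. -/
theorem abs_dtransition_fst_le (C C' : WarpedCoordinates g g₀ E N) {r : ℝ} (hr : C.a ≤ r) (x : N) :
    ‖(C.dtransition C' (r, x) (1, 0)).1‖ ≤ 1 := by
  have h := C.inner_dtransition C' hr x (1, 0)
  have h0 : C.Ghat.inner x (0 : EuclideanSpace ℝ (Fin d)) (0 : EuclideanSpace ℝ (Fin d)) = 0 :=
    (congrArg (fun L : EuclideanSpace ℝ (Fin d) →L[ℝ] ℝ => L 0)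
      (map_zero (C.Ghat.inner x))).trans rfl
  have hnn : ∀ (y : N) (u : EuclideanSpace ℝ (Fin d)), 0 ≤ C'.Ghat.inner y u u := fun y u => by
    rcases eq_or_ne u 0 with rfl | hu
    · exact ((congrArg (fun L : EuclideanSpace ℝ (Fin d) →L[ℝ] ℝ => L 0)
        (map_zero (C'.Ghat.inner y))).trans rfl).ge
    · exact (C'.Ghat.pos y u hu).le
  dsimp only at h
  rw [h0] at h
  have h1 := mul_nonneg (sq_nonneg (C'.h (C.transition C' (r, x)).1))
    (hnn (C.transition C' (r, x)).2 (C.dtransition C' (r, x) (1, 0)).2)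
  rw [Real.norm_eq_abs, abs_le_one_iff_mul_self_le_one]
  linarith

/-- At an interior minimum of the radial coordinate its differential vanishes. -/
theorem dtransition_fst_eq_zero (C C' : WarpedCoordinates g g₀ E N) {r : ℝ} (hr : C.a < r) (x : N)
    (hmin : (C.transition C' (r, x)).1 = C'.a) (w : ℝ × EuclideanSpace ℝ (Fin d)) :
    (C.dtransition C' (r, x) w).1 = 0 := by
  have hx := mem_extChartAt_source (I := 𝓡 d) x
  have hy := mem_extChartAt_target (I := 𝓡 d) x
  let Φ : ℝ × EuclideanSpace ℝ (Fin d) → ℝ × N := fun z => (z.1, (extChartAt (𝓡 d) x).symm z.2)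
  have hΦ0 : Φ (r, extChartAt (𝓡 d) x x) = (r, x) := by
    simp only [Φ, (extChartAt (𝓡 d) x).left_inv hx]
  have h1 : HasMFDerivAt 𝓘(ℝ, ℝ × EuclideanSpace ℝ (Fin d)) 𝓘(ℝ, ℝ)
      (Prod.fst : ℝ × EuclideanSpace ℝ (Fin d) → ℝ) (r, extChartAt (𝓡 d) x x)
      (ContinuousLinearMap.fst ℝ ℝ (EuclideanSpace ℝ (Fin d))) :=
    hasFDerivAt_fst.hasMFDerivAt
  have h2 : HasMFDerivAt 𝓘(ℝ, ℝ × EuclideanSpace ℝ (Fin d)) 𝓘(ℝ, EuclideanSpace ℝ (Fin d))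
      (Prod.snd : ℝ × EuclideanSpace ℝ (Fin d) → _) (r, extChartAt (𝓡 d) x x)
      (ContinuousLinearMap.snd ℝ ℝ (EuclideanSpace ℝ (Fin d))) :=
    hasFDerivAt_snd.hasMFDerivAt
  -- With the chart centered at `x` its inverse has the identity as differential there, so composing
  -- with `Φ` leaves `dtransition` unchanged.
  have hid : HasMFDerivAt 𝓘(ℝ, EuclideanSpace ℝ (Fin d)) (𝓡 d) (extChartAt (𝓡 d) x).symm
      (extChartAt (𝓡 d) x x) (ContinuousLinearMap.id ℝ (EuclideanSpace ℝ (Fin d))) := by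
    have h := ((contMDiffAt_extChartAt_symm (I := 𝓡 d) hy).mdifferentiableAt
      (by simp)).hasMFDerivAt
    have e := mfderivWithin_range_extChartAt_symm (I := 𝓡 d) (x := x)
    rw [ModelWithCorners.range_eq_univ, mfderivWithin_univ] at e
    rw [e] at h
    exact h
  have hΦ : HasMFDerivAt 𝓘(ℝ, ℝ × EuclideanSpace ℝ (Fin d)) (𝓘(ℝ, ℝ).prod (𝓡 d)) Φ
      (r, extChartAt (𝓡 d) x x)
      (ContinuousLinearMap.id ℝ (ℝ × EuclideanSpace ℝ (Fin d))) :=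
    h1.prodMk (hid.comp (r, extChartAt (𝓡 d) x x) h2)
  have hT : HasMFDerivAt (𝓘(ℝ, ℝ).prod (𝓡 d)) (𝓘(ℝ, ℝ).prod (𝓡 d)) (C.transition C')
      (Φ (r, extChartAt (𝓡 d) x x)) (C.dtransition C' (r, x)) := by
    rw [hΦ0]
    exact (C.mdifferentiableWithinAt_transition C' (C.mem_domain hr.le x)
      ).hasMFDerivWithinAt.hasMFDerivAt (C.domain_mem_nhds hr x)
  have h3 := (hasMFDerivAt_fst (I := 𝓘(ℝ, ℝ)) (I' := 𝓡 d)
    (C.transition C' (Φ (r, extChartAt (𝓡 d) x x)))).comp (r, extChartAt (𝓡 d) x x)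
    (hT.comp (r, extChartAt (𝓡 d) x x) hΦ)
  have hloc : IsLocalMin (Prod.fst ∘ C.transition C' ∘ Φ) (r, extChartAt (𝓡 d) x x) := by
    have hn : Φ ⁻¹' (Ici C.a ×ˢ univ) ∈ 𝓝 (r, extChartAt (𝓡 d) x x) :=
      hΦ.continuousAt.preimage_mem_nhds (by rw [hΦ0]; exact C.domain_mem_nhds hr x)
    filter_upwards [hn] with z hz
    simp only [Function.comp_apply, hΦ0, hmin]
    exact (C.transition_mem C' hz).1
  have h4 := hloc.hasFDerivAt_eq_zero (hasMFDerivAt_iff_hasFDerivAt.1 h3)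
  exact congrArg (fun L : ℝ × EuclideanSpace ℝ (Fin d) →L[ℝ] ℝ => L w) h4

/-- Changes of coordinates preserve the boundary. -/
theorem transition_boundary (C C' : WarpedCoordinates g g₀ E N) (x : N) :
    (C.transition C' (C.a, x)).1 = C'.a := by
  have hq := C.mem_domain le_rfl x
  by_contra hne
  have hlt : C'.a < (C.transition C' (C.a, x)).1 :=
    lt_of_le_of_ne (C.transition_mem C' hq).1 (Ne.symm hne)
  -- An interior point going to the boundary under the reverse transition would make the radial
  -- differential of that transition vanish there; yet it maps the image of ∂_r back to ∂_r, of
  -- radial component 1.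
  have h := C'.dtransition_fst_eq_zero C hlt (C.transition C' (C.a, x)).2
    (by rw [Prod.mk.eta, C.transition_transition C' hq]) (C.dtransition C' (C.a, x) (1, 0))
  rw [Prod.mk.eta, C.dtransition_dtransition C' le_rfl] at h
  exact one_ne_zero h

/-- Mean value inequality along a radial line, starting at the boundary, where `transition_boundary`
fixes the value. -/
theorem transition_fst_le (C C' : WarpedCoordinates g g₀ E N) {r : ℝ} (hr : C.a ≤ r) (x : N) :
    (C.transition C' (r, x)).1 - C'.a ≤ r - C.a := by
  have h := (convex_Ici C.a).norm_image_sub_le_of_norm_hasDerivWithin_le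
    (fun s hs => C.hasDerivWithinAt_transition_fst C' (mem_Ici.1 hs) x)
    (fun s hs => C.abs_dtransition_fst_le C' (mem_Ici.1 hs) x) (mem_Ici.2 le_rfl) (mem_Ici.2 hr)
  rw [C.transition_boundary C' x, one_mul, Real.norm_eq_abs, Real.norm_eq_abs,
    abs_of_nonneg (sub_nonneg.2 hr)] at h
  exact (le_abs_self _).trans h

/-- The radial coordinates of two warped coordinate systems differ by a constant. -/
theorem transition_fst (C C' : WarpedCoordinates g g₀ E N) {r : ℝ} (hr : C.a ≤ r) (x : N) :
    (C.transition C' (r, x)).1 = r + (C'.a - C.a) := by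
  have hq := C.mem_domain hr x
  have h1 := C.transition_fst_le C' hr x
  -- The same bound for the reverse transition is the opposite inequality.
  have h2 := C'.transition_fst_le C (C.transition_mem C' hq).1 (C.transition C' (r, x)).2
  rw [Prod.mk.eta, C.transition_transition C' hq] at h2
  dsimp only at h2
  linarith

/-- The radial vector fields of two warped coordinate systems coincide. -/
theorem dparam_radial_eq (C C' : WarpedCoordinates g g₀ E N) {r : ℝ} (hr : C.a ≤ r) (x : N) :
    C'.dparam (C.transition C' (r, x)).1 (C.transition C' (r, x)).2 (1, 0)
      = C.dparam r x (1, 0) := by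
  have h1 : (C.dtransition C' (r, x) (1, 0)).1 = 1 := by
    have h := C.hasDerivWithinAt_transition_fst C' hr x
    have h' : HasDerivWithinAt (fun s => (C.transition C' (s, x)).1) 1 (Ici C.a) r :=
      ((hasDerivAt_id r).add_const (C'.a - C.a)).hasDerivWithinAt.congr
        (fun s hs => C.transition_fst C' (mem_Ici.1 hs) x) (C.transition_fst C' hr x)
    exact (uniqueDiffOn_Ici C.a r hr).eq_deriv _ h h'
  have h2 := C.inner_dtransition C' hr x (1, 0)
  have h0 : C.Ghat.inner x (0 : EuclideanSpace ℝ (Fin d)) (0 : EuclideanSpace ℝ (Fin d)) = 0 :=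
    (congrArg (fun L : EuclideanSpace ℝ (Fin d) →L[ℝ] ℝ => L 0)
      (map_zero (C.Ghat.inner x))).trans rfl
  -- The radial component 1 already exhausts the unit length, so nothing is left for the tangential
  -- component.
  have h3 : (C.dtransition C' (r, x) (1, 0)).2 = 0 := by
    by_contra hne
    have hpos := C'.Ghat.pos (C.transition C' (r, x)).2 _ hne
    have hh := C'.h_pos _ (C.transition_mem C' (C.mem_domain hr x)).1
    dsimp only at h2
    rw [h0, h1] at h2
    have := mul_pos (pow_pos hh 2) hpos
    linarith
  rw [← C.dparam_dtransition C' hr x]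
  congr 1
  exact Prod.ext h1.symm h3.symm

end WarpedCoordinates

/-! ### Averaging at infinity, and smoothness and invariance of radial derivatives. -/

/-- Averages over unit intervals have the same limit. -/
theorem tendsto_setIntegral_Ioo_atTop {f : ℝ → ℝ} {m : ℝ} (hf : Tendsto f atTop (𝓝 m))
    (hi : ∀ᶠ R in atTop, IntegrableOn f (Ioo R (R + 1))) :
    Tendsto (fun R => ∫ r in Ioo R (R + 1), f r) atTop (𝓝 m) := by
  rw [Metric.tendsto_nhds]
  intro ε hε
  obtain ⟨R₀, hR₀⟩ := eventually_atTop.1 (Metric.tendsto_nhds.1 hf (ε / 2) (half_pos hε))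
  filter_upwards [hi, eventually_ge_atTop R₀] with R hR hRR
  have hv : volume (Ioo R (R + 1)) = 1 := by simp
  have h1 : ∫ r in Ioo R (R + 1), (f r - m) = (∫ r in Ioo R (R + 1), f r) - m := by
    rw [integral_sub hR (integrableOn_const (by rw [hv]; simp)), setIntegral_const]
    simp [Measure.real, hv]
  have h2 := norm_setIntegral_le_of_norm_le_const (μ := volume) (s := Ioo R (R + 1))
    (f := fun r => f r - m) (C := ε / 2) (by rw [hv]; simp) fun r hr => by
      have := hR₀ r (hRR.trans hr.1.le)
      rw [Real.dist_eq] at this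
      exact this.le
  rw [h1, Measure.real, hv, ENNReal.toReal_one, mul_one] at h2
  rw [Real.dist_eq]
  exact lt_of_le_of_lt h2 (half_lt_self hε)

/-- The radial derivative of a smooth function on `(a, ∞) × N` is smooth. -/
theorem contMDiffAt_radial_deriv {d : ℕ} {N : Type*} [TopologicalSpace N]
    [ChartedSpace (EuclideanSpace ℝ (Fin d)) N] [IsManifold (𝓡 d) ∞ N] {a : ℝ} {F : ℝ × N → ℝ}
    (hF : ∀ r, a < r → ∀ x, ContMDiffAt (𝓘(ℝ, ℝ).prod (𝓡 d)) 𝓘(ℝ, ℝ) ∞ F (r, x)) {r : ℝ}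
    (hr : a < r) (x : N) :
    ContMDiffAt (𝓘(ℝ, ℝ).prod (𝓡 d)) 𝓘(ℝ, ℝ) ∞
      (fun q : ℝ × N => deriv (fun s => F (s, q.2)) q.1) (r, x) := by
  let ψ : ℝ × EuclideanSpace ℝ (Fin d) → ℝ := fun z => F (z.1, (extChartAt (𝓡 d) x).symm z.2)
  have hψ : ∀ z : ℝ × EuclideanSpace ℝ (Fin d), a < z.1 → z.2 ∈ (extChartAt (𝓡 d) x).target →
      ContDiffAt ℝ ∞ ψ z := fun z hz hz2 => by
    refine contMDiffAt_iff_contDiffAt.1 ?_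
    have h1 : ContMDiffAt 𝓘(ℝ, ℝ × EuclideanSpace ℝ (Fin d)) 𝓘(ℝ, ℝ) ∞
        (Prod.fst : ℝ × EuclideanSpace ℝ (Fin d) → ℝ) z := contDiff_fst.contMDiff.contMDiffAt
    have h2 : ContMDiffAt 𝓘(ℝ, ℝ × EuclideanSpace ℝ (Fin d)) 𝓘(ℝ, EuclideanSpace ℝ (Fin d)) ∞
        (Prod.snd : ℝ × EuclideanSpace ℝ (Fin d) → _) z := contDiff_snd.contMDiff.contMDiffAt
    exact (hF z.1 hz ((extChartAt (𝓡 d) x).symm z.2)).comp z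
      (h1.prodMk ((contMDiffAt_extChartAt_symm hz2).comp z h2))
  have hx := mem_extChartAt_source (I := 𝓡 d) x
  have hcomp : ContMDiffAt (𝓘(ℝ, ℝ).prod (𝓡 d)) 𝓘(ℝ, ℝ × EuclideanSpace ℝ (Fin d)) ∞
      (fun q : ℝ × N => (q.1, extChartAt (𝓡 d) x q.2)) (r, x) :=
    contMDiffAt_fst.prodMk_space (contMDiffAt_extChartAt.comp (r, x) contMDiffAt_snd)
  have hd : ContDiffAt ℝ ∞ (fun z => fderiv ℝ ψ z (1, 0)) (r, extChartAt (𝓡 d) x x) :=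
    ((hψ _ hr ((extChartAt (𝓡 d) x).map_source hx)).fderiv_right (by simp)).clm_apply
      contDiffAt_const
  refine (ContMDiffAt.comp (r, x) (g := fun z => fderiv ℝ ψ z (1, 0)) hd.contMDiffAt
    hcomp).congr_of_eventuallyEq ?_
  filter_upwards [prod_mem_nhds (Ioi_mem_nhds hr) (extChartAt_source_mem_nhds (I := 𝓡 d) x)]
    with q hq
  have h := ((hψ (q.1, extChartAt (𝓡 d) x q.2) hq.1
    ((extChartAt (𝓡 d) x).map_source hq.2)).differentiableAt (by simp)).hasFDerivAt.comp_hasDerivAt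
      q.1 ((hasDerivAt_id q.1).prodMk (hasDerivAt_const q.1 (extChartAt (𝓡 d) x q.2)))
  rw [Function.comp_apply, ← h.deriv]
  simp only [ψ, Function.comp_def, id, (extChartAt (𝓡 d) x).left_inv hq.2]

namespace WarpedCoordinates

section

variable {d : ℕ} {H : Type*} [TopologicalSpace H]
  {I : ModelWithCorners ℝ (EuclideanSpace ℝ (Fin (d + 1))) H} {X : Type*} [TopologicalSpace X]
  [ChartedSpace H X] [IsManifold I ∞ X] {g g₀ : RiemMetric I X} {E : Set X}
  {N : Type*} [TopologicalSpace N] [ChartedSpace (EuclideanSpace ℝ (Fin d)) N]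
  [IsManifold (𝓡 d) ∞ N]

/-- The coordinates enter only through the radial vector in `X`, so `dparam_radial_eq` can be
applied. -/
theorem hasDerivAt_comp_param (C : WarpedCoordinates g g₀ E N) {r : ℝ} (hr : C.a < r) (x : N)
    {f : X → ℝ} {L : EuclideanSpace ℝ (Fin (d + 1)) →L[ℝ] ℝ}
    (hf : HasMFDerivAt I 𝓘(ℝ, ℝ) f (C.param (r, x)) L) :
    HasDerivAt (fun s => f (C.param (s, x))) (L (C.dparam r x (1, 0))) r := by
  have h1 : HasMFDerivAt 𝓘(ℝ, ℝ) (𝓘(ℝ, ℝ).prod (𝓡 d)) (fun s : ℝ => (s, x)) r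
      ((ContinuousLinearMap.id ℝ ℝ).prod (0 : ℝ →L[ℝ] EuclideanSpace ℝ (Fin d))) :=
    (hasMFDerivAt_id r).prodMk (hasMFDerivAt_const x r)
  have h2 : HasMFDerivAt (𝓘(ℝ, ℝ).prod (𝓡 d)) I C.param (r, x) (C.dparam r x) :=
    (C.smooth_param.mdifferentiableOn (by simp) _
      (C.mem_domain hr.le x)).hasMFDerivWithinAt.hasMFDerivAt (C.domain_mem_nhds hr x)
  have h3 : HasFDerivAt (fun s => f (C.param (s, x))) (L.comp ((C.dparam r x).comp
      ((ContinuousLinearMap.id ℝ ℝ).prod (0 : ℝ →L[ℝ] EuclideanSpace ℝ (Fin d))))) r :=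
    hasMFDerivAt_iff_hasFDerivAt.1 (hf.comp r (h2.comp r h1))
  exact h3.hasDerivAt

/-- The radial derivative of a function does not depend on the warped coordinates. -/
theorem deriv_comp_param_transition (C C' : WarpedCoordinates g g₀ E N) {r : ℝ} (hr : C.a < r)
    (x : N) {f : X → ℝ} (hf : MDifferentiableAt I 𝓘(ℝ, ℝ) f (C.param (r, x))) :
    deriv (fun s => f (C'.param (s, (C.transition C' (r, x)).2))) (C.transition C' (r, x)).1
      = deriv (fun s => f (C.param (s, x))) r := by
  have hp := C.param_transition C' (C.mem_domain hr.le x)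
  have hr' : C'.a < (C.transition C' (r, x)).1 := by
    rw [C.transition_fst C' hr.le x]; linarith
  obtain ⟨L, hL⟩ : ∃ L : EuclideanSpace ℝ (Fin (d + 1)) →L[ℝ] ℝ,
      HasMFDerivAt I 𝓘(ℝ, ℝ) f (C.param (r, x)) L := ⟨_, hf.hasMFDerivAt⟩
  have hL' : HasMFDerivAt I 𝓘(ℝ, ℝ) f
      (C'.param ((C.transition C' (r, x)).1, (C.transition C' (r, x)).2)) L := by
    rw [Prod.mk.eta, hp]; exact hL
  rw [(C.hasDerivAt_comp_param hr x hL).deriv, (C'.hasDerivAt_comp_param hr' _ hL').deriv,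
    C.dparam_radial_eq C' hr.le x]

theorem image_param_Ioo (C C' : WarpedCoordinates g g₀ E N) {b c : ℝ} (hb : C.a ≤ b) :
    C.param '' (Ioo b c ×ˢ univ)
      ⊆ C'.param '' (Ioo (b + (C'.a - C.a)) (c + (C'.a - C.a)) ×ˢ univ) := by
  rintro _ ⟨⟨r, x⟩, ⟨hr, -⟩, rfl⟩
  have ha : C.a ≤ r := hb.trans hr.1.le
  refine ⟨C.transition C' (r, x), ⟨?_, mem_univ _⟩, C.param_transition C' (C.mem_domain ha x)⟩
  rw [C.transition_fst C' ha x]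
  exact ⟨add_lt_add_left hr.1 _, add_lt_add_left hr.2 _⟩

theorem image_param_Ioo_eq (C C' : WarpedCoordinates g g₀ E N) {b c : ℝ} (hb : C.a ≤ b) :
    C.param '' (Ioo b c ×ˢ univ)
      = C'.param '' (Ioo (b + (C'.a - C.a)) (c + (C'.a - C.a)) ×ˢ univ) := by
  refine (C.image_param_Ioo C' hb).antisymm ?_
  refine (C'.image_param_Ioo C (by linarith)).trans (image_mono (prod_mono ?_ subset_rfl))
  exact Ioo_subset_Ioo (by linarith) (by linarith)

theorem image_param_Ioi_eq (C C' : WarpedCoordinates g g₀ E N) :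
    C.param '' (Ioi C.a ×ˢ univ) = C'.param '' (Ioi C'.a ×ˢ univ) := by
  have key : ∀ C C' : WarpedCoordinates g g₀ E N,
      C.param '' (Ioi C.a ×ˢ univ) ⊆ C'.param '' (Ioi C'.a ×ˢ univ) := by
    rintro C C' _ ⟨⟨r, x⟩, ⟨hr, -⟩, rfl⟩
    have ha : C.a ≤ r := le_of_lt hr
    refine ⟨C.transition C' (r, x), ⟨?_, mem_univ _⟩, C.param_transition C' (C.mem_domain ha x)⟩
    rw [C.transition_fst C' ha x, mem_Ioi]
    have := mem_Ioi.1 hr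
    linarith
  exact (key C C').antisymm (key C' C)

theorem contMDiffAt_comp_param (C : WarpedCoordinates g g₀ E N) (r : ℝ) (hr : C.a < r) (x : N) :
    ContMDiffAt (𝓘(ℝ, ℝ).prod (𝓡 d)) 𝓘(ℝ, ℝ) ∞
      (fun q : ℝ × N => logVolumeRatio g₀ g (C.param q)) (r, x) :=
  (C.contMDiffAt_logVolumeRatio_param hr x).comp (r, x) (C.contMDiffAt_param hr x)

/-- The radial derivative of the logarithm of the volume ratio. -/
def radialDeriv (C : WarpedCoordinates g g₀ E N) (q : ℝ × N) : ℝ :=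
  deriv (fun s => logVolumeRatio g₀ g (C.param (s, q.2))) q.1

theorem contMDiffAt_radialDeriv (C : WarpedCoordinates g g₀ E N) (r : ℝ) (hr : C.a < r) (x : N) :
    ContMDiffAt (𝓘(ℝ, ℝ).prod (𝓡 d)) 𝓘(ℝ, ℝ) ∞ C.radialDeriv (r, x) :=
  contMDiffAt_radial_deriv C.contMDiffAt_comp_param hr x

theorem radialDeriv_transition (C C' : WarpedCoordinates g g₀ E N) {r : ℝ} (hr : C.a < r)
    (x : N) : C'.radialDeriv (C.transition C' (r, x)) = C.radialDeriv (r, x) :=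
  C.deriv_comp_param_transition C' hr x
    ((C.contMDiffAt_logVolumeRatio_param hr x).mdifferentiableAt (by simp))

/-- The radial flux of the logarithm of the volume ratio. -/
def radialFlux (C : WarpedCoordinates g g₀ E N) (q : ℝ × N) : ℝ :=
  C.h q.1 ^ 2 * C.radialDeriv q

theorem contMDiffAt_radialFlux (C : WarpedCoordinates g g₀ E N) (r : ℝ) (hr : C.a < r) (x : N) :
    ContMDiffAt (𝓘(ℝ, ℝ).prod (𝓡 d)) 𝓘(ℝ, ℝ) ∞ C.radialFlux (r, x) := by
  have hh : ContMDiffAt (𝓘(ℝ, ℝ).prod (𝓡 d)) 𝓘(ℝ, ℝ) ∞ (fun q : ℝ × N => C.h q.1 ^ 2) (r, x) :=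
    ContMDiffAt.comp (r, x) (g := fun s => C.h s ^ 2)
      ((C.smooth_h.contDiffAt (Ici_mem_nhds hr)).pow 2).contMDiffAt contMDiffAt_fst
  exact hh.mul (C.contMDiffAt_radialDeriv r hr x)

theorem continuousAt_deriv_radialFlux (C : WarpedCoordinates g g₀ E N) {r : ℝ} (hr : C.a < r)
    (x : N) :
    ContinuousAt (fun q : ℝ × N => deriv (fun s => C.radialFlux (s, q.2)) q.1) (r, x) :=
  (contMDiffAt_radial_deriv C.contMDiffAt_radialFlux hr x).continuousAt

theorem hasDerivAt_radialFlux (C : WarpedCoordinates g g₀ E N) {r : ℝ} (hr : C.a < r) (x : N) :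
    HasDerivAt (fun s => C.radialFlux (s, x)) (deriv (fun s => C.radialFlux (s, x)) r) r := by
  have h : ContMDiffAt 𝓘(ℝ, ℝ) 𝓘(ℝ, ℝ) ∞ (fun s => C.radialFlux (s, x)) r :=
    (C.contMDiffAt_radialFlux r hr x).comp r (contMDiffAt_id.prodMk contMDiffAt_const)
  exact ((contMDiffAt_iff_contDiffAt.1 h).differentiableAt (by simp)).hasDerivAt

end

end WarpedCoordinates

/-! ### Variation of the mass, its limit and its independence of coordinates. -/

namespace WarpedCoordinates

variable {H : Type*} [TopologicalSpace H]
  {I : ModelWithCorners ℝ (EuclideanSpace ℝ (Fin 3)) H} {X : Type*} [TopologicalSpace X]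
  [ChartedSpace H X] [IsManifold I ∞ X] {g g₀ : RiemMetric I X} {E : Set X}
  {N : Type*} [TopologicalSpace N] [ChartedSpace (EuclideanSpace ℝ (Fin 2)) N]
  [IsManifold (𝓡 2) ∞ N] [MeasurableSpace N]

theorem mass_eq (C : WarpedCoordinates g g₀ E N) {r : ℝ} (hr : C.a < r) :
    C.mass r = ∫ x, C.radialFlux (r, x) ∂riemVolume C.Ghat :=
  integral_congr_ae (ae_of_all _ fun x => C.radialMass_eq hr x)

variable [BorelSpace N] [CompactSpace N] [SecondCountableTopology N]

theorem integrable_slab [T2Space N] (C : WarpedCoordinates g g₀ E N) {F : ℝ × N → ℝ}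
    (hF : ∀ r, C.a < r → ∀ x, ContinuousAt F (r, x)) {b c : ℝ} (hb : C.a < b) :
    Integrable F ((volume.restrict (Icc b c)).prod (riemVolume C.Ghat)) := by
  have h : IntegrableOn F (Icc b c ×ˢ univ) (volume.prod (riemVolume C.Ghat)) :=
    ContinuousOn.integrableOn_compact (isCompact_Icc.prod isCompact_univ) fun q hq =>
      (hF q.1 (hb.trans_le hq.1.1) q.2).continuousWithinAt
  rwa [IntegrableOn, ← Measure.prod_restrict, Measure.restrict_univ] at h

theorem integrable_slice (C : WarpedCoordinates g g₀ E N) {F : ℝ × N → ℝ}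
    (hF : ∀ r, C.a < r → ∀ x, ContinuousAt F (r, x)) {r : ℝ} (hr : C.a < r) :
    Integrable (fun x => F (r, x)) (riemVolume C.Ghat) := by
  have h : Continuous fun x => F (r, x) := continuous_iff_continuousAt.2 fun x =>
    (hF r hr x).comp (Continuous.prodMk_right r).continuousAt
  exact h.integrable_of_hasCompactSupport (HasCompactSupport.of_compactSpace _)

theorem integrableOn_mass [T2Space N] (C : WarpedCoordinates g g₀ E N) {b c : ℝ} (hb : C.a < b) :
    IntegrableOn C.mass (Icc b c) := by
  have h := (C.integrable_slab (c := c)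
    (fun r hr x => (C.contMDiffAt_radialFlux r hr x).continuousAt) hb).integral_prod_left
  exact IntegrableOn.congr_fun h (fun r hr => (C.mass_eq (hb.trans_le hr.1)).symm)
    measurableSet_Icc

/-- The flux of `Δ₀ ln (√det g₀ / √det g)` through the slices. -/
def sliceLaplacian (C : WarpedCoordinates g g₀ E N) (r : ℝ) : ℝ :=
  C.h r ^ 2 * ∫ x, laplacian g₀ (logVolumeRatio g₀ g) (C.param (r, x)) ∂riemVolume C.Ghat

/-- Integrate `laplacian_param` over the slice: the Laplacian of `Ghat` contributes nothing on a
closed surface. -/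
theorem integral_deriv_radialFlux [T2Space N] (C : WarpedCoordinates g g₀ E N) {r : ℝ}
    (hr : C.a < r) :
    ∫ x, deriv (fun s => C.radialFlux (s, x)) r ∂riemVolume C.Ghat = -C.sliceLaplacian r := by
  have hsm : ContMDiff (𝓡 2) 𝓘(ℝ, ℝ) ∞ (fun z => logVolumeRatio g₀ g (C.param (r, z))) :=
    fun x => (C.contMDiffAt_comp_param r hr x).comp x (contMDiffAt_const.prodMk contMDiffAt_id)
  have h1 : ∀ x, deriv (fun s => C.radialFlux (s, x)) r
      = laplacian C.Ghat (fun z => logVolumeRatio g₀ g (C.param (r, z))) x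
        - C.h r ^ 2 * laplacian g₀ (logVolumeRatio g₀ g) (C.param (r, x)) := fun x => by
    rw [C.laplacian_param hr x (C.contMDiffAt_logVolumeRatio_param hr x)]
    simp only [radialFlux, radialDeriv]
    ring
  have hi1 := C.integrable_slice
    (F := fun q => deriv (fun s => C.radialFlux (s, q.2)) q.1)
    (fun r hr x => C.continuousAt_deriv_radialFlux hr x) hr
  have hi2 : Integrable (laplacian C.Ghat (fun z => logVolumeRatio g₀ g (C.param (r, z))))
      (riemVolume C.Ghat) :=
    (continuous_laplacian C.Ghat hsm).integrable_of_hasCompactSupport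
      (HasCompactSupport.of_compactSpace _)
  have h2 : ∀ x, C.h r ^ 2 * laplacian g₀ (logVolumeRatio g₀ g) (C.param (r, x))
      = laplacian C.Ghat (fun z => logVolumeRatio g₀ g (C.param (r, z))) x
        - deriv (fun s => C.radialFlux (s, x)) r := fun x => by rw [h1 x]; ring
  rw [sliceLaplacian, ← integral_const_mul, integral_congr_ae (ae_of_all _ h2),
    integral_sub hi2 hi1, integral_laplacian_eq_zero C.Ghat hsm]
  ring

/-- The fundamental theorem of calculus is applied to the flux at each point of `N`, then Fubini
exchanges the integrals; the mass itself is never differentiated. -/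
theorem mass_sub_mass [T2Space N] (C : WarpedCoordinates g g₀ E N) {b R : ℝ} (hb : C.a < b)
    (hR : b ≤ R) : C.mass R = C.mass b - ∫ r in b..R, C.sliceLaplacian r := by
  have hcont : ∀ r, C.a < r → ∀ x, ContinuousAt C.radialFlux (r, x) := fun r hr x =>
    (C.contMDiffAt_radialFlux r hr x).continuousAt
  have hdc : ∀ r, C.a < r → ∀ x,
      ContinuousAt (fun q : ℝ × N => deriv (fun s => C.radialFlux (s, q.2)) q.1) (r, x) :=
    fun r hr x => C.continuousAt_deriv_radialFlux hr x
  have hRa := hb.trans_le hR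
  have h1 : ∀ x, ∫ r in Icc b R, deriv (fun s => C.radialFlux (s, x)) r
      = C.radialFlux (R, x) - C.radialFlux (b, x) := fun x => by
    rw [integral_Icc_eq_integral_Ioc, ← intervalIntegral.integral_of_le hR]
    refine intervalIntegral.integral_eq_sub_of_hasDerivAt (f := fun s => C.radialFlux (s, x))
      (fun r hr => C.hasDerivAt_radialFlux ?_ x) ?_
    · rw [uIcc_of_le hR] at hr
      exact hb.trans_le hr.1
    · refine ContinuousOn.intervalIntegrable fun r hr => ContinuousAt.continuousWithinAt ?_
      rw [uIcc_of_le hR] at hr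
      exact ContinuousAt.comp (f := fun s : ℝ => (s, x)) (hdc r (hb.trans_le hr.1) x)
        (Continuous.prodMk_left x).continuousAt
  have h2 := integral_integral_swap
    (f := fun r x => deriv (fun s => C.radialFlux (s, x)) r) (C.integrable_slab (c := R) hdc hb)
  have h3 : ∫ r in Icc b R, ∫ x, deriv (fun s => C.radialFlux (s, x)) r ∂riemVolume C.Ghat
      = -∫ r in Icc b R, C.sliceLaplacian r := by
    rw [← integral_neg]
    exact setIntegral_congr_fun measurableSet_Icc fun r hr =>
      C.integral_deriv_radialFlux (hb.trans_le hr.1)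
  have h4 : C.mass R - C.mass b = -∫ r in Icc b R, C.sliceLaplacian r := by
    rw [C.mass_eq hRa, C.mass_eq hb, ← integral_sub (C.integrable_slice hcont hRa)
      (C.integrable_slice hcont hb), ← h3]
    refine Eq.trans ?_ h2.symm
    exact integral_congr_ae (ae_of_all _ fun x => (h1 x).symm)
  rw [intervalIntegral.integral_of_le hR, ← integral_Icc_eq_integral_Ioc]
  linarith

variable [MeasurableSpace X] [BorelSpace X] [SecondCountableTopology X]

/-- Integrability for the volume of g₀ is integrability for h² dr dμ, and Fubini passes it to the
slice integrals. -/
theorem integrableOn_sliceLaplacian (C : WarpedCoordinates g g₀ E N)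
    (hL1 : IntegrableOn (laplacian g₀ (logVolumeRatio g₀ g)) E (riemVolume g₀)) :
    IntegrableOn C.sliceLaplacian (Ioi C.a) := by
  have h1 : IntegrableOn (laplacian g₀ (logVolumeRatio g₀ g)) (C.param '' (Ioi C.a ×ˢ univ))
      (riemVolume g₀) := hL1.mono_set <| by
    rintro _ ⟨q, hq, rfl⟩
    exact C.param_mem q ⟨Ioi_subset_Ici_self hq.1, hq.2⟩
  rw [IntegrableOn, C.riemVolume_restrict_param] at h1
  have h2 := (h1.comp_aemeasurable C.aemeasurable_param).integral_prod_left
  rw [radialMeasure, integrable_withDensity_iff_integrable_smul₀' C.aemeasurable_ofReal_sq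
    (ae_of_all _ fun r => ENNReal.ofReal_lt_top)] at h2
  refine h2.congr (ae_of_all _ fun r => ?_)
  dsimp only
  rw [ENNReal.toReal_ofReal (sq_nonneg _)]
  rfl

theorem exists_hasMassAtInfinity [T2Space N] (C : WarpedCoordinates g g₀ E N)
    (hL1 : IntegrableOn (laplacian g₀ (logVolumeRatio g₀ g)) E (riemVolume g₀)) :
    ∃ m, C.HasMassAtInfinity m := by
  -- Any starting radius above `C.a` would do; smoothness of the flux is available only there.
  have hb : C.a < C.a + 1 := by linarith
  have h := intervalIntegral_tendsto_integral_Ioi (C.a + 1)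
    ((C.integrableOn_sliceLaplacian hL1).mono_set (Ioi_subset_Ioi hb.le)) tendsto_id
  refine ⟨_, (h.const_sub (C.mass (C.a + 1))).congr' ?_⟩
  filter_upwards [eventually_ge_atTop (C.a + 1)] with R hR
  exact (C.mass_sub_mass hb hR).symm

theorem setIntegral_image_param [T2Space N] (C : WarpedCoordinates g g₀ E N) {F : X → ℝ}
    (hF : ContinuousOn F (C.param '' (Ioi C.a ×ˢ univ))) {b c : ℝ} (hb : C.a < b) :
    ∫ p in C.param '' (Ioo b c ×ˢ univ), F p ∂riemVolume g₀
      = ∫ r in Ioo b c, C.h r ^ 2 * ∫ x, F (C.param (r, x)) ∂riemVolume C.Ghat := by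
  have hsub : Ioo b c ×ˢ (univ : Set N) ⊆ Ioi C.a ×ˢ univ :=
    prod_mono (fun r hr => hb.trans hr.1) subset_rfl
  have hm := (C.isOpen_image_param (isOpen_Ioo.prod isOpen_univ) hsub).measurableSet
  have hO := (C.isOpen_image_param (isOpen_Ioi.prod isOpen_univ) subset_rfl).measurableSet
  have hFm : AEStronglyMeasurable F (C.slabMeasure.map C.param) := by
    rw [← C.riemVolume_restrict_param]
    exact hF.aestronglyMeasurable hO
  -- Only almost everywhere: for r < a the parametrization is arbitrary and may meet the slab again.
  have hae : (C.param ⁻¹' (C.param '' (Ioo b c ×ˢ univ)) : Set (ℝ × N)) =ᵐ[C.slabMeasure]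
      (Ioo b c ×ˢ univ : Set (ℝ × N)) := by
    filter_upwards [(measure_eq_zero_iff_ae_notMem.1 C.slabMeasure_compl)] with q hq
    have hq' : q ∈ Ioi C.a ×ˢ (univ : Set N) := not_not.1 hq
    refine propext ⟨fun h => ?_, fun h => ⟨q, h, rfl⟩⟩
    obtain ⟨q₁, h₁, h₂⟩ := h
    have := C.injOn_param (C.mem_domain (hb.trans h₁.1.1).le q₁.2)
      (C.mem_domain (le_of_lt hq'.1) q.2) h₂
    rw [Prod.mk.eta, Prod.mk.eta] at this
    exact this ▸ h₁
  have hc : ContinuousOn (fun q => F (C.param q)) (Icc b c ×ˢ (univ : Set N)) := by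
    refine hF.comp (C.smooth_param.continuousOn.mono fun q hq => ?_) fun q hq => ⟨q, ?_, rfl⟩
    · exact C.mem_domain (hb.le.trans hq.1.1) q.2
    · exact ⟨hb.trans_le hq.1.1, hq.2⟩
  -- A bound on the closed slab and the finiteness of its volume give the integrability that Fubini
  -- requires.
  obtain ⟨K, hK⟩ := (isCompact_Icc.prod isCompact_univ).exists_bound_of_continuousOn hc
  have hIoo : Ioo b c ∩ Ioi C.a = Ioo b c := inter_eq_left.2 fun r hr => hb.trans hr.1
  have hfin : C.radialMeasure (Ioo b c) < ⊤ := by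
    rw [radialMeasure, withDensity_apply _ measurableSet_Ioo,
      Measure.restrict_restrict measurableSet_Ioo, hIoo]
    have hi : IntegrableOn (fun r => C.h r ^ 2) (Icc b c) :=
      ((C.smooth_h.continuousOn.mono fun r hr =>
        mem_Ici.2 (hb.le.trans hr.1)).pow 2).integrableOn_compact isCompact_Icc
    exact (hi.mono_set Ioo_subset_Icc_self).lintegral_lt_top
  have hint : IntegrableOn (fun q => F (C.param q)) (Ioo b c ×ˢ univ)
      (C.radialMeasure.prod (riemVolume C.Ghat)) := by
    refine Measure.integrableOn_of_bounded (M := K) ?_ ?_ ?_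
    · rw [Measure.prod_prod]
      exact (ENNReal.mul_lt_top hfin (measure_lt_top _ _)).ne
    · exact hFm.comp_aemeasurable C.aemeasurable_param
    · refine (ae_restrict_iff' (measurableSet_Ioo.prod MeasurableSet.univ)).2
        (ae_of_all _ fun q hq => hK q ⟨Ioo_subset_Icc_self hq.1, hq.2⟩)
  have hr : (riemVolume g₀).restrict (C.param '' (Ioo b c ×ˢ univ))
      = (C.slabMeasure.map C.param).restrict (C.param '' (Ioo b c ×ˢ univ)) := by
    rw [← C.riemVolume_restrict_param, Measure.restrict_restrict hm,
      inter_eq_left.2 (image_mono hsub)]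
  rw [hr, setIntegral_map hm hFm C.aemeasurable_param, setIntegral_congr_set hae, slabMeasure,
    setIntegral_prod _ hint, radialMeasure, restrict_withDensity measurableSet_Ioo,
    Measure.restrict_restrict measurableSet_Ioo, hIoo,
    integral_withDensity_eq_integral_toReal_smul₀
      (C.aemeasurable_ofReal_sq.mono_measure (Measure.restrict_mono_set _ fun r hr => hb.trans hr.1))
      (ae_of_all _ fun r => ENNReal.ofReal_lt_top)]
  refine integral_congr_ae (ae_of_all _ fun r => ?_)
  dsimp only
  rw [ENNReal.toReal_ofReal (sq_nonneg _), Measure.restrict_univ, smul_eq_mul]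

/-- The weight h² in the mass is exactly the radial weight of the volume of g₀. `F` is kept abstract
so that one function on `X` serves two coordinate systems. -/
theorem setIntegral_mass [T2Space N] (C : WarpedCoordinates g g₀ E N) {F : X → ℝ}
    (hF : ContinuousOn F (C.param '' (Ioi C.a ×ˢ univ)))
    (hFd : ∀ r, C.a < r → ∀ x, F (C.param (r, x)) = C.radialDeriv (r, x)) {b c : ℝ}
    (hb : C.a < b) :
    ∫ p in C.param '' (Ioo b c ×ˢ univ), F p ∂riemVolume g₀ = ∫ r in Ioo b c, C.mass r := by
  rw [C.setIntegral_image_param hF hb]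
  refine setIntegral_congr_fun measurableSet_Ioo fun r hr => ?_
  have hr' := hb.trans hr.1
  rw [C.mass_eq hr', ← integral_const_mul]
  refine integral_congr_ae (ae_of_all _ fun x => ?_)
  dsimp only
  rw [hFd r hr' x, radialFlux]

/-- The masses of two warped coordinate systems have the same integrals. -/
theorem setIntegral_mass_eq [T2Space N] (C C' : WarpedCoordinates g g₀ E N) {b c : ℝ}
    (hb : C.a < b) :
    ∫ r in Ioo b c, C.mass r
      = ∫ r in Ioo (b + (C'.a - C.a)) (c + (C'.a - C.a)), C'.mass r := by
  -- The radial derivative of the log ratio as a function on `X`; `radialDeriv_transition` shows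
  -- that `C'` yields the same one.
  let F : X → ℝ := fun p => C.radialDeriv (C.coord p)
  have hF : ContinuousOn F (C.param '' (Ioi C.a ×ˢ univ)) := by
    have hc : ContinuousOn C.radialDeriv (Ioi C.a ×ˢ univ) := fun q hq =>
      (C.contMDiffAt_radialDeriv q.1 hq.1 q.2).continuousAt.continuousWithinAt
    refine hc.comp (C.smooth_coord.continuousOn.mono ?_) ?_
    · rintro _ ⟨q, hq, rfl⟩
      exact C.param_mem q ⟨Ioi_subset_Ici_self hq.1, hq.2⟩
    · rintro _ ⟨q, hq, rfl⟩
      rw [C.coord_param q ⟨Ioi_subset_Ici_self hq.1, hq.2⟩]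
      exact hq
  have h1 : ∀ r, C.a < r → ∀ x, F (C.param (r, x)) = C.radialDeriv (r, x) := fun r hr x => by
    simp only [F, C.coord_param (r, x) (C.mem_domain hr.le x)]
  have h2 : ∀ r, C'.a < r → ∀ x, F (C'.param (r, x)) = C'.radialDeriv (r, x) := fun r hr x =>
    C'.radialDeriv_transition C hr x
  rw [← C.setIntegral_mass hF h1 hb, C.image_param_Ioo_eq C' hb.le]
  rw [C.image_param_Ioi_eq C'] at hF
  exact C'.setIntegral_mass hF h2 (by linarith)

/-- Unit-interval averages of the two masses agree up to the constant shift of the radius, which is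
invisible in the limit. -/
theorem hasMassAtInfinity_unique [T2Space N] (C C' : WarpedCoordinates g g₀ E N) {m m' : ℝ}
    (hm : C.HasMassAtInfinity m) (hm' : C'.HasMassAtInfinity m') : m = m' := by
  have key : ∀ (C : WarpedCoordinates g g₀ E N) {m : ℝ}, C.HasMassAtInfinity m →
      Tendsto (fun R => ∫ r in Ioo R (R + 1), C.mass r) atTop (𝓝 m) := fun C m h =>
    tendsto_setIntegral_Ioo_atTop h <| by
      filter_upwards [eventually_gt_atTop C.a] with R hR
      exact (C.integrableOn_mass hR).mono_set Ioo_subset_Icc_self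
  refine tendsto_nhds_unique (key C hm) (((key C' hm').comp
    (tendsto_atTop_add_const_right atTop (C'.a - C.a) tendsto_id)).congr' ?_)
  filter_upwards [eventually_gt_atTop C.a] with R hR
  rw [C.setIntegral_mass_eq C' hR, Function.comp_apply, id, add_right_comm]

end WarpedCoordinates
theorem proposition6p2
    {H : Type*} [TopologicalSpace H]
    {I : ModelWithCorners ℝ (EuclideanSpace ℝ (Fin 3)) H}
    {X : Type*} [TopologicalSpace X] [T2Space X] [SecondCountableTopology X]
    [ChartedSpace H X] [IsManifold I ∞ X] [MeasurableSpace X] [BorelSpace X]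
    {N : Type*} [TopologicalSpace N] [T2Space N] [CompactSpace N]
    [ChartedSpace (EuclideanSpace ℝ (Fin 2)) N] [IsManifold (𝓡 2) ∞ N]
    [MeasurableSpace N] [BorelSpace N]
    (g g₀ : RiemMetric I X) (E : Set X)
    (C C' : WarpedCoordinates g g₀ E N)
    (hL1 : IntegrableOn (laplacian g₀ (logVolumeRatio g₀ g)) E (riemVolume g₀)) :
    ∃ μ : ℝ, C.HasMassAtInfinity μ ∧ C'.HasMassAtInfinity μ := by
  -- Compactness gives the second countability on which the volume arguments rely.
  have : SecondCountableTopology N :=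
    ChartedSpace.secondCountable_of_sigmaCompact (EuclideanSpace ℝ (Fin 2)) N
  obtain ⟨m, hm⟩ := C.exists_hasMassAtInfinity hL1
  obtain ⟨m', hm'⟩ := C'.exists_hasMassAtInfinity hL1
  exact ⟨m, hm, C.hasMassAtInfinity_unique C' hm hm' ▸ hm'⟩
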